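/- Let $d\ge 2$ and $\delta\in(0,1]$. Write $x=(x_1,x')\in\mathbb R\times\mathbb R^{d-1}$, $\mathbb R^d_+=\{x_1>0\}$, $B_r=\{x\in\mathbb R^d:|x|<r\}$ and $B_r^+=B_r\cap\mathbb R^d_+$. There is a constant $N=N(d,\delta)$ such that the following holds. Let $A_0^{\alpha\beta}=A_0^{\alpha\beta}(x_1)$, $\alpha,\beta\in\{1,\dots,d\}$, be measurable $d\times d$ matrix valued functions of $x_1\in\mathbb R$ only, with $$|A_0^{\alpha\beta}|\le\delta^{-1},\qquad \sum_{\alpha,\beta=1}^d A_0^{\alpha\beta}\xi_\beta\cdot\xi_\alpha\ge\delta\sum_{\alpha=1}^d|\xi_\alpha|^2\qquad\text{for all }x_1\in\mathbb R,\ \xi_1,\dots,\xi_d\in\mathbb R^d .$$ Let $(u,p)\in W^1_2(B_2^+)^d\times L_2(B_2^+)$ satisfy (with summation over repeated indices) $$\operatorname{div}u=0\ \text{ in }B_2^+,\qquad D_\alpha(A_0^{\alpha\beta}D_\beta u)+\nabla p=0\ \text{ in }B_2^+,\qquad A_0^{\alpha\beta}D_\beta u\,n_\alpha+np=0\ \text{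 on }B_2\cap\partial\mathbb R^d_+,$$ the last two in the weak sense that $$\int_{B_2^+}A_0^{\alpha\beta}D_\beta u\cdot D_\alpha\phi\,dx+\int_{B_2^+}p\operatorname{div}\phi\,dx=0$$ for all $\phi\in\mathring W^1_2(B_2)^d$, the closure of $C_0^\infty(B_2)^d$ in $W^1_2(B_2)^d$. Set $U=A_0^{1\beta}D_\beta u+p\,e_1$, with $e_1$ the first unit vector, let $D_{x'}u$ be the collection of the $D_\beta u$ with $\beta=2,\dots,d$, and let $[f]_{C^{1/2}(B_1^+)}=\sup_{x\ne y\in B_1^+}|f(x)-f(y)|/|x-y|^{1/2}$. Then, after modification of $D_{x'}u$ and $U$ on a set of measure zero, $$\|Du\|_{L_\infty(B_1^+)}+\|p\|_{L_\infty(B_1^+)}+[D_{x'}u]_{C^{1/2}(B_1^+)}+[U]_{C^{1/2}(B_1^+)}\le N\,\|Du\|_{L_2(B_2^+)} .$$ -/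

import Mathlib

open MeasureTheory Filter Topology
open scoped NNReal ENNReal ContDiff

noncomputable section

namespace StokesConormal

/-- `ℝ^d` with its Euclidean norm. The coordinate `x₁` is `x 0`. -/
abbrev Vec (d : ℕ) := EuclideanSpace ℝ (Fin d)

/-- Values of the gradient of a vector field on `ℝ^d`, with the Euclidean (Frobenius) norm;
the entry `(β, j)` stands for `D_β u_j`. -/
abbrev Grad (d : ℕ) := EuclideanSpace ℝ (Fin d × Fin d)

/-- Values of the tangential gradient `D_{x'} u`; the entry `(β, j)`, `β` different from the first
index, stands for `D_β u_j`. -/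
abbrev TanGrad (d : ℕ) [NeZero d] := EuclideanSpace ℝ ({β : Fin d // β ≠ 0} × Fin d)

/-- The half ball `B_r^+ = {x : |x| < r, x₁ > 0}`. -/
def halfBall (d : ℕ) [NeZero d] (r : ℝ) : Set (Vec d) :=
  {x | x ∈ Metric.ball (0 : Vec d) r ∧ 0 < x 0}

/-- Classical partial derivative; only ever applied to smooth functions. -/
def partialDeriv {d : ℕ} (i : Fin d) (φ : Vec d → ℝ) (x : Vec d) : ℝ :=
  fderiv ℝ φ x (EuclideanSpace.single i 1)

/-- Classical gradient of a vector field; only ever applied to smooth fields. -/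
def classicalGrad {d : ℕ} (φ : Vec d → Vec d) (x : Vec d) : Grad d :=
  WithLp.toLp 2 fun k : Fin d × Fin d => partialDeriv k.1 (fun y => φ y k.2) x

/-- `φ ∈ C_c^∞(Ω)`. -/
structure IsTestFunction {d : ℕ} {F : Type*} [NormedAddCommGroup F] [NormedSpace ℝ F]
    (Ω : Set (Vec d)) (φ : Vec d → F) : Prop where
  smooth : ContDiff ℝ ∞ φ
  hasCompactSupport : HasCompactSupport φ
  tsupport_subset : tsupport φ ⊆ Ω

/-- `g` is the weak derivative `D_i f` in the open set `Ω`. -/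
structure HasWeakPartial {d : ℕ} (Ω : Set (Vec d)) (i : Fin d) (f g : Vec d → ℝ) : Prop where
  locallyIntegrableOn : LocallyIntegrableOn f Ω volume
  locallyIntegrableOn_deriv : LocallyIntegrableOn g Ω volume
  integral_eq : ∀ φ : Vec d → ℝ, IsTestFunction Ω φ →
    ∫ x in Ω, f x * partialDeriv i φ x = -∫ x in Ω, g x * φ x

/-- `u ∈ W^1_2(Ω)^d`, with (a version of) its weak gradient being `Du`. -/
structure IsW12 {d : ℕ} (Ω : Set (Vec d)) (u : Vec d → Vec d) (Du : Vec d → Grad d) : Prop where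
  memLp : MemLp u 2 (volume.restrict Ω)
  memLp_grad : MemLp Du 2 (volume.restrict Ω)
  hasWeakPartial : ∀ β j : Fin d, HasWeakPartial Ω β (fun x => u x j) (fun x => Du x (β, j))

/-- `φ` belongs to the closure of `C_c^∞(Ω)^d` in `W^1_2(Ω)^d`, with weak gradient `Dφ`. -/
structure IsW12Zero {d : ℕ} (Ω : Set (Vec d)) (φ : Vec d → Vec d) (Dφ : Vec d → Grad d) :
    Prop where
  isW12 : IsW12 Ω φ Dφ
  exists_approx : ∃ ψ : ℕ → Vec d → Vec d, (∀ n, IsTestFunction Ω (ψ n)) ∧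
    Tendsto (fun n => eLpNorm (fun x => ψ n x - φ x) 2 (volume.restrict Ω)) atTop (𝓝 0) ∧
    Tendsto (fun n => eLpNorm (fun x => classicalGrad (ψ n) x - Dφ x) 2 (volume.restrict Ω))
      atTop (𝓝 0)

/-- Coefficients depending only on the first variable; `A t α β i j` is `A^{αβ}_{ij}(x₁)` at
`x₁ = t`. -/
abbrev Coeff (d : ℕ) := ℝ → Fin d → Fin d → Matrix (Fin d) (Fin d) ℝ

/-- Measurable coefficients that satisfy the strong ellipticity condition with constant `δ`.
The bound is put on the entries, which is implied by the same bound on the Frobenius or the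
operator norm of the matrices `A^{αβ}`. -/
structure IsStronglyElliptic {d : ℕ} (δ : ℝ) (A : Coeff d) : Prop where
  aemeasurable : ∀ α β i j, AEMeasurable (fun t => A t α β i j) volume
  bounded : ∀ t α β i j, |A t α β i j| ≤ δ⁻¹
  elliptic : ∀ (t : ℝ) (ξ : Fin d → Vec d),
    δ * ∑ α, ‖ξ α‖ ^ 2 ≤ ∑ α, ∑ β, ∑ i, ∑ j, A t α β i j * ξ β j * ξ α i

/-- `(u, p) ∈ W^1_2(B_R^+)^d × L_2(B_R^+)`, with `Du` the weak gradient of `u`, satisfies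
`div u = 0` and `D_α(A^{αβ} D_β u) + ∇p = 0` in `B_R^+`, and the conormal condition
`A^{αβ} D_β u n_α + n p = 0` on `B_R ∩ {x₁ = 0}`, in the weak sense: the test functions vanish
on the curved part of the boundary of the half ball only. -/
structure IsConormalStokesSolution {d : ℕ} [NeZero d] (A : Coeff d) (R : ℝ)
    (u : Vec d → Vec d) (Du : Vec d → Grad d) (p : Vec d → ℝ) : Prop where
  isW12 : IsW12 (halfBall d R) u Du
  memLp_pressure : MemLp p 2 (volume.restrict (halfBall d R))
  div_eq_zero : ∀ᵐ x ∂volume.restrict (halfBall d R), ∑ i, Du x (i, i) = 0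
  weak_eq : ∀ (φ : Vec d → Vec d) (Dφ : Vec d → Grad d),
    IsW12Zero (Metric.ball (0 : Vec d) R) φ Dφ →
      (∫ x in halfBall d R,
          ∑ α, ∑ β, ∑ i, ∑ j, A (x 0) α β i j * Du x (β, j) * Dφ x (α, i))
        + ∫ x in halfBall d R, p x * ∑ i, Dφ x (i, i) = 0

/-- `D_{x'} u`: the entries `D_β u_j` of the gradient with `β` different from the first index. -/
def tanGrad {d : ℕ} [NeZero d] (Du : Vec d → Grad d) (x : Vec d) : TanGrad d :=
  WithLp.toLp 2 fun k : {β : Fin d // β ≠ 0} × Fin d => Du x (k.1.1, k.2)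

/-- `U = A^{1β} D_β u + p e₁`. -/
def conormalU {d : ℕ} [NeZero d] (A : Coeff d) (Du : Vec d → Grad d) (p : Vec d → ℝ)
    (x : Vec d) : Vec d :=
  WithLp.toLp 2 (fun i : Fin d => ∑ β, ∑ j, A (x 0) 0 β i j * Du x (β, j))
    + EuclideanSpace.single 0 (p x)

/-- The Hölder seminorm `[f]_{C^γ(Ω)}`, the supremum of `|f x - f y| / |x - y|^γ` over distinct
`x, y ∈ Ω`, with value `∞` if `f` is not Hölder continuous on `Ω`. -/
def holderSeminorm {d : ℕ} {F : Type*} [NormedAddCommGroup F] (γ : ℝ≥0) (Ω : Set (Vec d))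
    (f : Vec d → F) : ℝ≥0∞ :=
  eHolderNorm γ (fun x : Ω => f x)

end StokesConormal

end

noncomputable section

namespace StokesConormal

/-! The coefficients depend on x₁ only, so tangential difference quotients of a solution solve the
same conormal problem on a slightly smaller half ball. A Caccioppoli inequality up to the flat
boundary (`exists_caccioppoli`), applied once for each difference, bounds the tangential difference
quotients of Du and p up to order d in L² by the L² norm of Du (`exists_diffs_bound`).

No regularity of A in x₁ is available, hence none of D₁u. But D₁D_ju = D_jD₁u for tangential j, and
the equation reads D₁U = -∑_{α≠1} D_α(A^{αβ}D_βu + p e_α). One normal derivative of D_{x'}u or of U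
is thus traded for a tangential one, and every mixed derivative of these functions that uses each
coordinate at most once is bounded in L² (`exists_mixed_bound`). This is all that an elementary
embedding on cubes needs (`exists_holder_bound`): integrating out the coordinates one by one gives
the supremum, and an increment t in one coordinate costs √t by Cauchy–Schwarz, whence the exponent
1/2.

The rest is pointwise algebra (`abs_le_of_tangential`). D₁u₁ comes from div u = 0. The components of
U other than the first contain no pressure, and ellipticity of A¹¹ on vectors with vanishing first
component gives the rest of D₁u. The first component of U then gives p.

The pressure is estimated by duality with a right inverse of the divergence
(`exists_div_corrector`). Test fields are free on the flat boundary, so the inverse needs no mean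
value condition, and the pressure is bounded by Du without subtracting a constant.

All functions are extended by zero to ℝ^d and mollified with a kernel shifted into the half space.
The mollifications are smooth and satisfy the differentiated relations up to the flat boundary. -/

/-- The `i`-th standard basis vector. -/
abbrev basisVec {d : ℕ} (i : Fin d) : Vec d := EuclideanSpace.single i (1 : ℝ)

/-! ### Convolution with finite measures on L² -/

section Contraction

theorem lintegral_sq_le {α : Type*} [MeasurableSpace α] (ν : Measure α) {f : α → ℝ≥0∞}
    (hf : AEMeasurable f ν) : (∫⁻ t, f t ∂ν) ^ 2 ≤ ν Set.univ * ∫⁻ t, f t ^ 2 ∂ν := by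
  have h := ENNReal.lintegral_mul_le_Lp_mul_Lq ν (Real.HolderConjugate.two_two) hf
    (aemeasurable_const (b := (1 : ℝ≥0∞)))
  simp only [Pi.mul_apply, mul_one, ENNReal.one_rpow, lintegral_const, one_mul] at h
  calc (∫⁻ t, f t ∂ν) ^ 2 ≤ ((∫⁻ t, f t ^ (2 : ℝ) ∂ν) ^ (1 / 2 : ℝ) * ν Set.univ ^ (1 / 2 : ℝ)) ^ 2 :=
        pow_le_pow_left' h 2
    _ = _ := by
      rw [mul_pow, ← ENNReal.rpow_natCast, ← ENNReal.rpow_natCast, ← ENNReal.rpow_mul,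
        ← ENNReal.rpow_mul, mul_comm]
      norm_num

theorem memLp_two_iff_lintegral {α : Type*} [MeasurableSpace α] {ν : Measure α} {F : α → ℝ} :
    MemLp F 2 ν ↔ AEStronglyMeasurable F ν ∧ ∫⁻ x, ‖F x‖ₑ ^ 2 ∂ν < ⊤ := by
  unfold MemLp
  refine and_congr_right fun _ => ?_
  rw [eLpNorm_lt_top_iff_lintegral_rpow_enorm_lt_top (by norm_num) (by norm_num)]
  norm_num

theorem ofReal_integral_sq {α : Type*} [MeasurableSpace α] {ν : Measure α} {F : α → ℝ}
    (hF : MemLp F 2 ν) : ENNReal.ofReal (∫ x, F x ^ 2 ∂ν) = ∫⁻ x, ‖F x‖ₑ ^ 2 ∂ν := by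
  rw [ofReal_integral_eq_lintegral_ofReal hF.integrable_sq (ae_of_all _ fun x => sq_nonneg _)]
  refine lintegral_congr fun x => ?_
  rw [← sq_abs, ENNReal.ofReal_pow (abs_nonneg _), Real.enorm_eq_ofReal_abs]

variable {d : ℕ}

/-- Convolution of a function with a measure. -/
def measConv (ν : Measure (Vec d)) (F : Vec d → ℝ) (x : Vec d) : ℝ := ∫ t, F (x - t) ∂ν

theorem quasiMeasurePreserving_sub_prod (ν : Measure (Vec d)) [SFinite ν] :
    Measure.QuasiMeasurePreserving (fun p : Vec d × Vec d => p.1 - p.2)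
      ((volume : Measure (Vec d)).prod ν) volume := by
  exact QuasiMeasurePreserving.prod_of_left measurable_sub
    (ae_of_all _ fun t => (measurePreserving_sub_right volume t).quasiMeasurePreserving)

theorem aestronglyMeasurable_sub_prod (ν : Measure (Vec d)) [SFinite ν] {F : Vec d → ℝ}
    (hF : AEStronglyMeasurable F volume) :
    AEStronglyMeasurable (fun p : Vec d × Vec d => F (p.1 - p.2))
      ((volume : Measure (Vec d)).prod ν) :=
  hF.comp_quasiMeasurePreserving (quasiMeasurePreserving_sub_prod ν)

theorem measConv_aestronglyMeasurable (ν : Measure (Vec d)) [SFinite ν] {F : Vec d → ℝ}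
    (hF : AEStronglyMeasurable F volume) : AEStronglyMeasurable (measConv ν F) volume :=
  (aestronglyMeasurable_sub_prod ν hF).integral_prod_right'

/-- Cauchy–Schwarz in t for the finite measure ν, then Tonelli and translation invariance. The pair
`E`, `E'` localises the bound. It serves both mollification (ν a probability measure) and
integration along segments. -/
theorem lintegral_measConv_sq_le (ν : Measure (Vec d)) [IsFiniteMeasure ν] {F : Vec d → ℝ}
    (hF : AEStronglyMeasurable F volume) {E E' : Set (Vec d)}
    (hE : MeasurableSet E) (hE' : MeasurableSet E')
    (h : ∀ᵐ t ∂ν, ∀ x ∈ E, x - t ∈ E') :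
    ∫⁻ x in E, ‖measConv ν F x‖ₑ ^ 2 ≤ ν Set.univ ^ 2 * ∫⁻ x in E', ‖F x‖ₑ ^ 2 := by
  have hm := aestronglyMeasurable_sub_prod ν hF
  have hm' : AEStronglyMeasurable (fun p : Vec d × Vec d => F (p.1 - p.2))
      ((volume.restrict E).prod ν) :=
    hm.mono_ac (Measure.AbsolutelyContinuous.prod Measure.restrict_le_self.absolutelyContinuous
      Measure.AbsolutelyContinuous.rfl)
  have h1 : ∀ᵐ x ∂(volume.restrict E), ‖measConv ν F x‖ₑ ^ 2
      ≤ ν Set.univ * ∫⁻ t, ‖F (x - t)‖ₑ ^ 2 ∂ν := by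
    filter_upwards [hm'.prodMk_left] with x hx
    exact (pow_le_pow_left' (enorm_integral_le_lintegral_enorm _) 2).trans (lintegral_sq_le ν hx.enorm)
  calc ∫⁻ x in E, ‖measConv ν F x‖ₑ ^ 2
      ≤ ∫⁻ x in E, ν Set.univ * ∫⁻ t, ‖F (x - t)‖ₑ ^ 2 ∂ν := lintegral_mono_ae h1
    _ = ν Set.univ * ∫⁻ x in E, (∫⁻ t, ‖F (x - t)‖ₑ ^ 2 ∂ν) :=
        lintegral_const_mul' _ _ (measure_ne_top _ _)
    _ = ν Set.univ * ∫⁻ t, (∫⁻ x in E, ‖F (x - t)‖ₑ ^ 2) ∂ν := by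
        rw [lintegral_lintegral_swap]
        exact (hm'.enorm.pow_const 2)
    _ ≤ ν Set.univ * ∫⁻ t, (∫⁻ x in E', ‖F x‖ₑ ^ 2) ∂ν := by
        refine mul_le_mul_right (lintegral_mono_ae ?_) _
        filter_upwards [h] with t ht
        rw [← lintegral_indicator hE, ← lintegral_indicator hE',
          ← lintegral_sub_right_eq_self (fun x => E'.indicator (fun x => ‖F x‖ₑ ^ 2) x) t]
        refine lintegral_mono fun x => ?_
        by_cases hx : x ∈ E
        · simp [hx, ht x hx]
        · simp [hx]
    _ = _ := by rw [lintegral_const]; ring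

theorem measConv_memLp (ν : Measure (Vec d)) [IsFiniteMeasure ν] {F : Vec d → ℝ}
    (hF : MemLp F 2 volume) : MemLp (measConv ν F) 2 volume := by
  rw [memLp_two_iff_lintegral] at hF ⊢
  refine ⟨measConv_aestronglyMeasurable ν hF.1, ?_⟩
  have := lintegral_measConv_sq_le ν hF.1 MeasurableSet.univ MeasurableSet.univ (by simp)
  simp only [Measure.restrict_univ] at this
  exact this.trans_lt (ENNReal.mul_lt_top (by finiteness) hF.2)

theorem integral_measConv_sq_le (ν : Measure (Vec d)) [IsFiniteMeasure ν] {F : Vec d → ℝ}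
    (hF : MemLp F 2 volume) {E E' : Set (Vec d)}
    (hE : MeasurableSet E) (hE' : MeasurableSet E')
    (h : ∀ᵐ t ∂ν, ∀ x ∈ E, x - t ∈ E') :
    ∫ x in E, measConv ν F x ^ 2 ≤ ν.real Set.univ ^ 2 * ∫ x in E', F x ^ 2 := by
  have h1 := lintegral_measConv_sq_le ν hF.1 hE hE' h
  rw [← ofReal_integral_sq ((measConv_memLp ν hF).restrict E),
    ← ofReal_integral_sq (hF.restrict E')] at h1
  have h2 : ν Set.univ ^ 2 = ENNReal.ofReal (ν.real Set.univ ^ 2) := by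
    rw [ENNReal.ofReal_pow measureReal_nonneg, ofReal_measureReal]
  rw [h2, ← ENNReal.ofReal_mul (by positivity)] at h1
  exact (ENNReal.ofReal_le_ofReal_iff (by positivity)).1 h1

end Contraction

/-! ### Mollification with a kernel shifted into the half space -/

section Translation

variable {d : ℕ}

theorem memLp_comp_add {F : Vec d → ℝ} (hF : MemLp F 2 volume) (t : Vec d) :
    MemLp (fun x => F (x + t)) 2 volume :=
  hF.comp_measurePreserving (measurePreserving_add_right volume t)

theorem tendsto_eLpNorm_translation {F : Vec d → ℝ} (hF : MemLp F 2 volume) :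
    Tendsto (fun t : Vec d => eLpNorm (fun x => F (x - t) - F x) 2 volume) (𝓝 0) (𝓝 0) := by
  have : Fact ((1 : ℝ≥0∞) ≤ 2) := ⟨by norm_num⟩
  let g : Vec d → C(Vec d, Vec d) := fun t => ⟨fun x => x - t, by fun_prop⟩
  have hg : Continuous g := by
    refine ContinuousMap.continuous_of_continuous_uncurry _ ?_
    simp only [g, Function.uncurry_def, ContinuousMap.coe_mk]
    fun_prop
  have hgm : ∀ t, MeasurePreserving (g t) (volume : Measure (Vec d)) volume := fun t =>
    measurePreserving_sub_right volume t
  have hc := Continuous.compMeasurePreservingLp (f := fun _ : Vec d => hF.toLp F)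
    continuous_const hg hgm (by norm_num)
  have h1 := (hc.tendsto 0)
  rw [Lp.tendsto_Lp_iff_tendsto_eLpNorm'] at h1
  refine h1.congr fun t => eLpNorm_congr_ae ?_
  have e0 := hF.coeFn_toLp
  have e1 := Lp.coeFn_compMeasurePreserving (hF.toLp F) (hgm t)
  have e2 := Lp.coeFn_compMeasurePreserving (hF.toLp F) (hgm 0)
  have e3 := (hgm t).quasiMeasurePreserving.ae_eq_comp e0
  have e4 := (hgm 0).quasiMeasurePreserving.ae_eq_comp e0
  filter_upwards [e1, e2, e3, e4] with x h1 h2 h3 h4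
  simp only [Pi.sub_apply, h1, h2]
  simp only [Function.comp_apply] at h3 h4 ⊢
  rw [h3, h4]
  simp [g]

end Translation

section Mollifier

variable {d : ℕ} [NeZero d]

/-- The mollification scale. -/
def molScale (n : ℕ) : ℝ := 1 / ((n : ℝ) + 1)

theorem molScale_pos (n : ℕ) : 0 < molScale n := by unfold molScale; positivity

theorem molScale_tendsto : Tendsto molScale atTop (𝓝 0) := tendsto_one_div_add_atTop_nhds_zero_nat

/-- A smooth bump supported in the ball of radius `ε` around `-2 ε e₁`. -/
def molBump (d : ℕ) [NeZero d] (n : ℕ) :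
    ContDiffBump (-((2 * molScale n) • (basisVec 0 : Vec d))) where
  rIn := molScale n / 2
  rOut := molScale n
  rIn_pos := by have := molScale_pos n; positivity
  rIn_lt_rOut := by have := molScale_pos n; linarith

/-- The normalized mollification kernel. -/
def molKer (d : ℕ) [NeZero d] (n : ℕ) : Vec d → ℝ := (molBump d n).normed volume

theorem molKer_nonneg (n : ℕ) (t : Vec d) : 0 ≤ molKer d n t := (molBump d n).nonneg_normed t

theorem molKer_contDiff (n : ℕ) : ContDiff ℝ ∞ (molKer d n) := (molBump d n).contDiff_normed

theorem molKer_hasCompactSupport (n : ℕ) : HasCompactSupport (molKer d n) :=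
  (molBump d n).hasCompactSupport_normed

theorem tsupport_molKer (n : ℕ) : tsupport (molKer d n) =
    Metric.closedBall (-((2 * molScale n) • (basisVec 0 : Vec d))) (molScale n) :=
  (molBump d n).tsupport_normed_eq

/-- The measure with density the mollification kernel. -/
def molMeas (d : ℕ) [NeZero d] (n : ℕ) : Measure (Vec d) :=
  volume.withDensity fun t => ENNReal.ofReal (molKer d n t)

instance (n : ℕ) : IsProbabilityMeasure (molMeas d n) := by
  refine ⟨?_⟩
  rw [molMeas, withDensity_apply _ MeasurableSet.univ, Measure.restrict_univ]
  unfold molKer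
  rw [← ofReal_integral_eq_lintegral_ofReal ((molBump d n).integrable_normed)
      (ae_of_all _ (molKer_nonneg n))]
  simp [(molBump d n).integral_normed]

theorem integral_molMeas (n : ℕ) (F : Vec d → ℝ) :
    ∫ t, F t ∂(molMeas d n) = ∫ t, molKer d n t * F t := by
  rw [molMeas, integral_withDensity_eq_integral_toReal_smul
    ((molKer_contDiff n).continuous.measurable.ennreal_ofReal) (by simp)]
  refine integral_congr_ae (ae_of_all _ fun t => ?_)
  simp [ENNReal.toReal_ofReal (molKer_nonneg n t)]

theorem ae_molMeas (n : ℕ) : ∀ᵐ t ∂(molMeas d n),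
    t ∈ Metric.ball (-((2 * molScale n) • (basisVec 0 : Vec d))) (molScale n) := by
  rw [molMeas, ae_withDensity_iff ((molKer_contDiff n).continuous.measurable.ennreal_ofReal)]
  refine ae_of_all _ fun t ht => ?_
  have : t ∈ Function.support ((molBump d n).normed volume) := by
    intro h0; apply ht
    show ENNReal.ofReal ((molBump d n).normed volume t) = 0
    simp [h0]
  rwa [(molBump d n).support_normed_eq] at this

/-- Mollification; the value at `x` only depends on the values in the ball of radius `ε` around
`x + 2 ε e₁`. -/
def moll (n : ℕ) (F : Vec d → ℝ) : Vec d → ℝ := measConv (molMeas d n) F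

theorem moll_memLp (n : ℕ) {F : Vec d → ℝ} (hF : MemLp F 2 volume) : MemLp (moll n F) 2 volume :=
  measConv_memLp _ hF

theorem moll_eq_convolution (n : ℕ) (F : Vec d → ℝ) :
    moll n F = convolution (molKer d n) F (ContinuousLinearMap.lsmul ℝ ℝ) volume := by
  ext x
  rw [moll, measConv, integral_molMeas]
  simp [convolution]

theorem moll_contDiff (n : ℕ) {F : Vec d → ℝ} (hF : MemLp F 2 volume) :
    ContDiff ℝ ∞ (moll n F) := by
  rw [moll_eq_convolution]
  exact (molKer_hasCompactSupport n).contDiff_convolution_left _ (molKer_contDiff n)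
    (hF.locallyIntegrable (by norm_num))

theorem molKer_mul_integrable (n : ℕ) {F : Vec d → ℝ} (hF : MemLp F 2 volume) (x : Vec d) :
    Integrable (fun t => molKer d n t * F (x - t)) volume := by
  have := (molKer_hasCompactSupport (d := d) n).convolutionExists_left
    (ContinuousLinearMap.lsmul ℝ ℝ) (molKer_contDiff n).continuous
    (hF.locallyIntegrable (by norm_num)) x
  simpa [ConvolutionExistsAt] using this

theorem molMeas_integrable (n : ℕ) {F : Vec d → ℝ} (hF : MemLp F 2 volume) (x : Vec d) :
    Integrable (fun t => F (x - t)) (molMeas d n) := by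
  rw [molMeas, integrable_withDensity_iff_integrable_smul'
    ((molKer_contDiff n).continuous.measurable.ennreal_ofReal) (by simp)]
  simpa [ENNReal.toReal_ofReal, molKer_nonneg] using molKer_mul_integrable n hF x

theorem moll_const_mul (n : ℕ) (c : ℝ) (F : Vec d → ℝ) :
    moll n (fun x => c * F x) = fun x => c * moll n F x := by
  ext x
  exact integral_const_mul _ _

theorem moll_sub (n : ℕ) {F G : Vec d → ℝ} (hF : MemLp F 2 volume) (hG : MemLp G 2 volume) :
    moll n (fun x => F x - G x) = fun x => moll n F x - moll n G x := by
  ext x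
  exact integral_sub (molMeas_integrable n hF x) (molMeas_integrable n hG x)

theorem moll_comp_add (n : ℕ) (F : Vec d → ℝ) (v : Vec d) :
    moll n (fun x => F (x + v)) = fun x => moll n F (x + v) := by
  ext x
  simp only [moll, measConv]
  congr 1; ext t; congr 1; abel

/-- The mollification kernel translated to `x`, as a test function. -/
def molTest (n : ℕ) (x : Vec d) : Vec d → ℝ := fun y => molKer d n (x - y)

theorem moll_eq_integral_molTest (n : ℕ) (F : Vec d → ℝ) (x : Vec d) :
    moll n F x = ∫ y, F y * molTest n x y := by
  rw [moll, measConv, integral_molMeas, ← integral_sub_left_eq_self _ volume x]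
  refine integral_congr_ae (ae_of_all _ fun y => ?_)
  simp [molTest, mul_comm]

theorem molTest_contDiff (n : ℕ) (x : Vec d) : ContDiff ℝ ∞ (molTest n x) :=
  (molKer_contDiff n).comp (contDiff_const.sub contDiff_id)

theorem tsupport_molTest_subset (n : ℕ) (x : Vec d) : tsupport (molTest n x) ⊆
    Metric.closedBall (x + (2 * molScale n) • (basisVec 0 : Vec d)) (molScale n) := by
  refine closure_minimal ?_ Metric.isClosed_closedBall
  intro y hy
  have : x - y ∈ tsupport (molKer d n) := subset_closure hy
  rw [tsupport_molKer, mem_closedBall_iff_norm] at this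
  rw [mem_closedBall_iff_norm, ← norm_neg]
  rw [show -(y - (x + (2 * molScale n) • (basisVec 0 : Vec d))) =
    x - y - -((2 * molScale n) • (basisVec 0 : Vec d)) by abel]
  exact this

theorem molTest_isTestFunction (n : ℕ) (x : Vec d) {Ω : Set (Vec d)}
    (h : Metric.closedBall (x + (2 * molScale n) • (basisVec 0 : Vec d)) (molScale n) ⊆ Ω) :
    IsTestFunction Ω (molTest n x) where
  smooth := molTest_contDiff n x
  hasCompactSupport := (isCompact_closedBall _ _).of_isClosed_subset (isClosed_tsupport _)
    (tsupport_molTest_subset n x)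
  tsupport_subset := (tsupport_molTest_subset n x).trans h

theorem partialDeriv_molTest (n : ℕ) (i : Fin d) (x y : Vec d) :
    partialDeriv i (molTest n x) y = -partialDeriv i (molKer d n) (x - y) := by
  unfold partialDeriv molTest
  have h1 : HasFDerivAt (molKer d n) (fderiv ℝ (molKer d n) (x - y)) (x - y) :=
    ((molKer_contDiff n).differentiable (by norm_num) _).hasFDerivAt
  have h2 : HasFDerivAt (fun y : Vec d => x - y) (-ContinuousLinearMap.id ℝ (Vec d)) y :=
    (hasFDerivAt_id y).const_sub x
  have h3 := (h1.comp y h2).fderiv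
  simp only [Function.comp_def] at h3
  rw [h3]
  simp

/-- The derivative is moved onto the kernel as a function of the integration variable, so that weak
identities tested with `molTest` apply directly. -/
theorem partialDeriv_moll (n : ℕ) {F : Vec d → ℝ} (hF : MemLp F 2 volume) (i : Fin d)
    (x : Vec d) : partialDeriv i (moll n F) x = -∫ y, F y * partialDeriv i (molTest n x) y := by
  have hloc : LocallyIntegrable F volume := hF.locallyIntegrable (by norm_num)
  have hk1 : ContDiff ℝ 1 (molKer d n) := (molKer_contDiff n).of_le (by norm_num)
  have h1 := (molKer_hasCompactSupport (d := d) n).hasFDerivAt_convolution_left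
    (ContinuousLinearMap.lsmul ℝ ℝ) hk1 hloc x
  rw [partialDeriv, moll_eq_convolution, h1.fderiv, convolution]
  have hex := ((molKer_hasCompactSupport (d := d) n).fderiv (𝕜 := ℝ)).convolutionExists_left
    ((ContinuousLinearMap.lsmul ℝ ℝ).precompL (Vec d)) (hk1.continuous_fderiv (by norm_num)) hloc x
  rw [ContinuousLinearMap.integral_apply hex, ← integral_sub_left_eq_self _ volume x, ← integral_neg]
  refine integral_congr_ae (ae_of_all _ fun y => ?_)
  simp only [partialDeriv_molTest]
  simp [partialDeriv, mul_comm]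

theorem lintegral_moll_sub_sq_le (n : ℕ) {F : Vec d → ℝ} (hF : MemLp F 2 volume) :
    ∫⁻ x, ‖moll n F x - F x‖ₑ ^ 2 ≤
      ∫⁻ t, (eLpNorm (fun x => F (x - t) - F x) 2 volume) ^ 2 ∂(molMeas d n) := by
  have hm : AEStronglyMeasurable (fun p : Vec d × Vec d => F (p.1 - p.2) - F p.1)
      ((volume : Measure (Vec d)).prod (molMeas d n)) :=
    (aestronglyMeasurable_sub_prod (molMeas d n) hF.1).sub hF.1.comp_fst
  calc ∫⁻ x, ‖moll n F x - F x‖ₑ ^ 2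
      ≤ ∫⁻ x, (∫⁻ t, ‖F (x - t) - F x‖ₑ ^ 2 ∂(molMeas d n)) := by
        refine lintegral_mono_ae ?_
        filter_upwards [hm.prodMk_left] with x hx
        have e : moll n F x - F x = ∫ t, (F (x - t) - F x) ∂(molMeas d n) := by
          rw [integral_sub (molMeas_integrable n hF x) (integrable_const _)]
          simp [moll, measConv]
        rw [e]
        refine (pow_le_pow_left' (enorm_integral_le_lintegral_enorm _) 2).trans ?_
        simpa using lintegral_sq_le (molMeas d n) hx.enorm
    _ = ∫⁻ t, (∫⁻ x, ‖F (x - t) - F x‖ₑ ^ 2) ∂(molMeas d n) := by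
        rw [lintegral_lintegral_swap]
        exact hm.enorm.pow_const 2
    _ = _ := by
        refine lintegral_congr fun t => ?_
        rw [eLpNorm_eq_lintegral_rpow_enorm_toReal (by norm_num) (by norm_num), ← ENNReal.rpow_natCast,
          ← ENNReal.rpow_mul]
        norm_num

theorem moll_tendsto {F : Vec d → ℝ} (hF : MemLp F 2 volume) :
    Tendsto (fun n => ∫ x, (moll n F x - F x) ^ 2) atTop (𝓝 0) := by
  have key : Tendsto (fun n => ∫⁻ x, ‖moll n F x - F x‖ₑ ^ 2) atTop (𝓝 0) := by
    rw [ENNReal.tendsto_nhds_zero]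
    intro ε hε
    have h2 : Tendsto (fun t : Vec d => eLpNorm (fun x => F (x - t) - F x) 2 volume ^ 2)
        (𝓝 0) (𝓝 0) := by
      have := (ENNReal.continuous_pow 2).tendsto 0 |>.comp (tendsto_eLpNorm_translation hF)
      simpa [Function.comp_def] using this
    have h3 := (ENNReal.tendsto_nhds_zero.1 h2) ε hε
    obtain ⟨r, hr, hball⟩ := Metric.eventually_nhds_iff_ball.1 h3
    -- The kernel lives in a ball of radius ε centred at distance 2ε from the origin, so only
    -- translations shorter than 3ε occur.
    have h4 : ∀ᶠ n in atTop, 3 * molScale n < r := by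
      have := molScale_tendsto.const_mul 3
      rw [mul_zero] at this
      exact this.eventually_lt_const hr
    filter_upwards [h4] with n hn
    refine (lintegral_moll_sub_sq_le n hF).trans ?_
    calc _ ≤ ∫⁻ t, ε ∂(molMeas d n) := by
          refine lintegral_mono_ae ?_
          filter_upwards [ae_molMeas n] with t ht
          refine hball t ?_
          rw [mem_ball_zero_iff]
          rw [mem_ball_iff_norm] at ht
          have h5 : ‖-((2 * molScale n) • (basisVec 0 : Vec d))‖ = 2 * molScale n := by
            rw [norm_neg, norm_smul, PiLp.norm_single]
            have := molScale_pos n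
            simp [abs_of_pos this]
          have := norm_le_norm_sub_add t (-((2 * molScale n) • (basisVec 0 : Vec d)))
          linarith
      _ = ε := by simp
  have h6 : ∀ n, ∫ x, (moll n F x - F x) ^ 2 = (∫⁻ x, ‖moll n F x - F x‖ₑ ^ 2).toReal := by
    intro n
    have := ofReal_integral_sq ((moll_memLp n hF).sub hF)
    simp only [Pi.sub_apply] at this
    rw [← this, ENNReal.toReal_ofReal (by positivity)]
  simp_rw [h6]
  simpa [Function.comp_def] using (ENNReal.tendsto_toReal ENNReal.zero_ne_top).comp key

end Mollifier

/-! ### Embedding of functions with square integrable mixed derivatives into C^{1/2} -/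

section IteratedPartial

variable {d : ℕ}

theorem partialDeriv_contDiff {g : Vec d → ℝ} (hg : ContDiff ℝ ∞ g) (i : Fin d) :
    ContDiff ℝ ∞ (partialDeriv i g) :=
  (hg.fderiv_right (m := ∞) (by simp)).clm_apply contDiff_const

theorem partialDeriv_comm {g : Vec d → ℝ} (hg : ContDiff ℝ ∞ g) (i j : Fin d) :
    partialDeriv i (partialDeriv j g) = partialDeriv j (partialDeriv i g) := by
  have key : ∀ (a b : Fin d) (x : Vec d), partialDeriv a (partialDeriv b g) x
      = fderiv ℝ (fderiv ℝ g) x (basisVec a) (basisVec b) := by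
    intro a b x
    have h1 : DifferentiableAt ℝ (fderiv ℝ g) x :=
      (hg.fderiv_right (m := ∞) (by simp)).differentiable (by simp) x
    show fderiv ℝ (fun y => fderiv ℝ g y (basisVec b)) x (basisVec a) = _
    rw [fderiv_clm_apply h1 (by fun_prop)]
    simp
  ext x
  rw [key, key]
  exact (hg.contDiffAt.isSymmSndFDerivAt (by
    simp only [minSmoothness_of_isRCLikeNormedField]
    exact WithTop.coe_le_coe.2 le_top)).eq _ _

/-- Iterated partial derivatives. -/
def iterPartial : List (Fin d) → (Vec d → ℝ) → Vec d → ℝ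
  | [], g => g
  | i :: L, g => iterPartial L (partialDeriv i g)

theorem iterPartial_contDiff (L : List (Fin d)) {g : Vec d → ℝ} (hg : ContDiff ℝ ∞ g) :
    ContDiff ℝ ∞ (iterPartial L g) := by
  induction L generalizing g with
  | nil => exact hg
  | cons i L ih => exact ih (partialDeriv_contDiff hg i)

theorem iterPartial_partialDeriv (L : List (Fin d)) {g : Vec d → ℝ} (hg : ContDiff ℝ ∞ g)
    (i : Fin d) : iterPartial L (partialDeriv i g) = partialDeriv i (iterPartial L g) := by
  induction L generalizing g with
  | nil => rfl
  | cons j L ih =>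
    simp only [iterPartial]
    rw [partialDeriv_comm hg, ih (partialDeriv_contDiff hg j)]

theorem iterPartial_perm {L L' : List (Fin d)} (h : L.Perm L') {g : Vec d → ℝ}
    (hg : ContDiff ℝ ∞ g) : iterPartial L g = iterPartial L' g := by
  induction h generalizing g with
  | nil => rfl
  | cons i _ ih => exact ih (partialDeriv_contDiff hg i)
  | swap i j L => simp only [iterPartial]; rw [partialDeriv_comm hg]
  | trans _ _ ih1 ih2 => exact (ih1 hg).trans (ih2 hg)

/-- The sum of the squares of the partial derivatives along the sublists of a list. -/
def mixedEnergy : List (Fin d) → (Vec d → ℝ) → Vec d → ℝ≥0∞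
  | [], g, x => ‖g x‖ₑ ^ 2
  | i :: L, g, x => mixedEnergy L g x + mixedEnergy L (partialDeriv i g) x

theorem mixedEnergy_measurable (L : List (Fin d)) {g : Vec d → ℝ} (hg : ContDiff ℝ ∞ g) :
    Measurable (mixedEnergy L g) := by
  induction L generalizing g with
  | nil => exact (hg.continuous.measurable.enorm.pow_const 2)
  | cons i L ih => exact (ih hg).add (ih (partialDeriv_contDiff hg i))

/-- The energy has one term for each way of keeping or dropping the entries of the list, hence the
power of 2. -/
theorem lintegral_mixedEnergy_le (L : List (Fin d)) {g : Vec d → ℝ} (hg : ContDiff ℝ ∞ g)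
    {E : Set (Vec d)} {M : ℝ≥0∞}
    (h : ∀ S : List (Fin d), S.Sublist L → ∫⁻ x in E, ‖iterPartial S g x‖ₑ ^ 2 ≤ M) :
    ∫⁻ x in E, mixedEnergy L g x ≤ 2 ^ L.length * M := by
  induction L generalizing g with
  | nil => simpa [mixedEnergy, iterPartial] using h [] (List.Sublist.refl _)
  | cons i L ih =>
    simp only [mixedEnergy]
    rw [lintegral_add_left (mixedEnergy_measurable L hg)]
    calc _ ≤ 2 ^ L.length * M + 2 ^ L.length * M := by
          refine add_le_add (ih hg fun S hS => h S (hS.cons i))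
            (ih (partialDeriv_contDiff hg i) fun S hS => ?_)
          exact h (i :: S) (hS.cons_cons i)
      _ = _ := by rw [List.length_cons, pow_succ]; ring

end IteratedPartial

section OneDimensional

theorem enorm_sq_eq_ofReal (a : ℝ) : ‖a‖ₑ ^ 2 = ENNReal.ofReal (a ^ 2) := by
  rw [← sq_abs, ENNReal.ofReal_pow (abs_nonneg _), Real.enorm_eq_ofReal_abs]

/-- For each s in the interval, f(a)² = f(s)² - ∫ 2ff' over [a, s], which is at most f(s)² plus the
full integral J. Averaging over s gives the constant 1/l + 1. -/
theorem sq_le_integral_of_hasDerivAt {f f' : ℝ → ℝ} (hf : ∀ s, HasDerivAt f (f' s) s)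
    (hc : Continuous f') (a : ℝ) {l : ℝ} (hl : 0 < l) :
    f a ^ 2 ≤ (1 / l + 1) * ∫ s in a..(a + l), (f s ^ 2 + f' s ^ 2) := by
  have hcf : Continuous f := continuous_iff_continuousAt.2 fun s => (hf s).continuousAt
  set J := ∫ s in a..(a + l), (f s ^ 2 + f' s ^ 2) with hJ
  have hpt : ∀ s ∈ Set.Icc a (a + l), f a ^ 2 ≤ f s ^ 2 + f' s ^ 2 + J := by
    intro s hs
    have h1 : ∫ r in a..s, 2 * f r * f' r = f s ^ 2 - f a ^ 2 := by
      refine intervalIntegral.integral_eq_sub_of_hasDerivAt (f := fun r => f r ^ 2) (fun r _ => ?_)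
        (Continuous.intervalIntegrable (by fun_prop) _ _)
      simpa using (hf r).fun_pow 2
    have h2 : -∫ r in a..s, 2 * f r * f' r ≤ ∫ r in a..s, (f r ^ 2 + f' r ^ 2) := by
      rw [← intervalIntegral.integral_neg]
      refine intervalIntegral.integral_mono_on hs.1 (Continuous.intervalIntegrable (by fun_prop) _ _)
        (Continuous.intervalIntegrable (by fun_prop) _ _) fun r _ => ?_
      nlinarith [sq_nonneg (f r + f' r)]
    have h3 : ∫ r in a..s, (f r ^ 2 + f' r ^ 2) ≤ J :=
      intervalIntegral.integral_mono_interval le_rfl hs.1 hs.2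
        (ae_of_all _ fun r => by positivity) (Continuous.intervalIntegrable (by fun_prop) _ _)
    nlinarith [sq_nonneg (f' s)]
  have h4 : ∫ _ in a..(a + l), f a ^ 2 ≤ ∫ s in a..(a + l), (f s ^ 2 + f' s ^ 2 + J) :=
    intervalIntegral.integral_mono_on (by linarith) (by simp)
      (Continuous.intervalIntegrable (by fun_prop) _ _) hpt
  rw [intervalIntegral.integral_add (Continuous.intervalIntegrable (by fun_prop) _ _) (by simp),
    intervalIntegral.integral_const, intervalIntegral.integral_const, ← hJ] at h4
  simp only [add_sub_cancel_left, smul_eq_mul] at h4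
  have : (1 / l + 1) * J = (J + l * J) / l := by field_simp
  rw [this, le_div_iff₀ hl]
  linarith

theorem enorm_sq_le_lintegral_of_hasDerivAt {f f' : ℝ → ℝ} (hf : ∀ s, HasDerivAt f (f' s) s)
    (hc : Continuous f') (a : ℝ) {l : ℝ} (hl : 0 < l) :
    ‖f a‖ₑ ^ 2 ≤ ENNReal.ofReal (1 / l + 1) *
      ∫⁻ s in Set.Icc a (a + l), (‖f s‖ₑ ^ 2 + ‖f' s‖ₑ ^ 2) := by
  have hcf : Continuous f := continuous_iff_continuousAt.2 fun s => (hf s).continuousAt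
  have h := sq_le_integral_of_hasDerivAt hf hc a hl
  rw [intervalIntegral.integral_of_le (by linarith), ← integral_Icc_eq_integral_Ioc] at h
  have h2 : ∫⁻ s in Set.Icc a (a + l), (‖f s‖ₑ ^ 2 + ‖f' s‖ₑ ^ 2)
      = ENNReal.ofReal (∫ s in Set.Icc a (a + l), (f s ^ 2 + f' s ^ 2)) := by
    rw [ofReal_integral_eq_lintegral_ofReal
      (Continuous.integrableOn_Icc (by fun_prop)) (ae_of_all _ fun s => by positivity)]
    refine lintegral_congr fun s => ?_
    rw [enorm_sq_eq_ofReal, enorm_sq_eq_ofReal, ENNReal.ofReal_add (by positivity) (by positivity)]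
  rw [h2, ← ENNReal.ofReal_mul (by positivity), enorm_sq_eq_ofReal]
  exact ENNReal.ofReal_le_ofReal h

theorem enorm_sub_sq_le_lintegral_of_hasDerivAt {f f' : ℝ → ℝ} (hf : ∀ s, HasDerivAt f (f' s) s)
    (hc : Continuous f') (a : ℝ) {t : ℝ} (ht : 0 ≤ t) :
    ‖f (a + t) - f a‖ₑ ^ 2 ≤ ENNReal.ofReal t * ∫⁻ s in Set.Icc a (a + t), ‖f' s‖ₑ ^ 2 := by
  have h1 : f (a + t) - f a = ∫ s in Set.Icc a (a + t), f' s := by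
    rw [integral_Icc_eq_integral_Ioc, ← intervalIntegral.integral_of_le (by linarith),
      intervalIntegral.integral_eq_sub_of_hasDerivAt (fun s _ => hf s) (hc.intervalIntegrable _ _)]
  rw [h1]
  refine (pow_le_pow_left' (enorm_integral_le_lintegral_enorm _) 2).trans ?_
  refine (lintegral_sq_le _ hc.measurable.enorm.aemeasurable).trans ?_
  simp

end OneDimensional

section Box

variable {d : ℕ}

theorem hasDerivAt_update {g : Vec d → ℝ} (hg : ContDiff ℝ ∞ g) (x : Fin d → ℝ) (i : Fin d)
    (s : ℝ) : HasDerivAt (fun s => g (WithLp.toLp 2 (Function.update x i s)))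
      (partialDeriv i g (WithLp.toLp 2 (Function.update x i s))) s := by
  have h1 : HasDerivAt (fun s : ℝ => (WithLp.toLp 2 (Function.update x i s) : Vec d))
      (basisVec i) s := by
    have : ∀ s : ℝ, (WithLp.toLp 2 (Function.update x i s) : Vec d)
        = WithLp.toLp 2 x + (s - x i) • basisVec i := by
      intro s; ext j
      by_cases hj : j = i
      · subst hj; simp
      · simp [hj]
    simp_rw [this]
    simpa using (((hasDerivAt_id s).sub_const (x i)).smul_const (basisVec i)).const_add
      (WithLp.toLp 2 x : Vec d)
  exact ((hg.differentiable (by simp) _).hasFDerivAt).comp_hasDerivAt s h1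

theorem continuous_toLp_update (x : Fin d → ℝ) (i : Fin d) :
    Continuous fun s : ℝ => (WithLp.toLp 2 (Function.update x i s) : Vec d) :=
  (PiLp.continuous_toLp 2 _).comp (continuous_const.update i continuous_id)

/-- The cube with lower corner `p` and side length `l`. -/
def cornerBox (p : Fin d → ℝ) (l : ℝ) : Set (Fin d → ℝ) :=
  Set.univ.pi fun i => Set.Icc (p i) (p i + l)

/-- Lebesgue measure on the interval `[p i, p i + l]`. -/
def sideMeas (p : Fin d → ℝ) (l : ℝ) (i : Fin d) : Measure ℝ :=
  volume.restrict (Set.Icc (p i) (p i + l))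

instance (p : Fin d → ℝ) (l : ℝ) (i : Fin d) : SigmaFinite (sideMeas p l i) := by
  unfold sideMeas; infer_instance

/-- The one-dimensional inequality is applied in one coordinate after another, each time to the
function and to its derivative in that coordinate. Each coordinate is used once, so no derivative is
repeated. -/
theorem enorm_sq_le_lmarginal (p : Fin d → ℝ) {l : ℝ} (hl : 0 < l) (L : List (Fin d))
    (hL : L.Nodup) {g : Vec d → ℝ} (hg : ContDiff ℝ ∞ g) (x : Fin d → ℝ)
    (hx : ∀ i ∈ L, x i = p i) :
    ‖g (WithLp.toLp 2 x)‖ₑ ^ 2 ≤ ENNReal.ofReal (1 / l + 1) ^ L.length *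
      lmarginal (sideMeas p l) L.toFinset (fun y => mixedEnergy L g (WithLp.toLp 2 y)) x := by
  induction L generalizing g x with
  | nil => simp [mixedEnergy]
  | cons i L ih =>
    have hi : i ∉ L := (List.nodup_cons.1 hL).1
    have hm : ∀ {g : Vec d → ℝ}, ContDiff ℝ ∞ g →
        Measurable fun y : Fin d → ℝ => mixedEnergy L g (WithLp.toLp 2 y) := fun hg =>
      (mixedEnergy_measurable L hg).comp (PiLp.continuous_toLp 2 _).measurable
    have hg' := partialDeriv_contDiff hg i
    have hcont : Continuous (fun s => partialDeriv i g (WithLp.toLp 2 (Function.update x i s))) :=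
      hg'.continuous.comp (continuous_toLp_update x i)
    have h1 := enorm_sq_le_lintegral_of_hasDerivAt (fun s => hasDerivAt_update hg x i s) hcont
      (x i) hl
    simp only [Function.update_eq_self] at h1
    rw [List.toFinset_cons, lmarginal_insert _ ?_ (by simpa using hi)]
    swap
    · exact (mixedEnergy_measurable (i :: L) hg).comp (PiLp.continuous_toLp 2 _).measurable
    refine h1.trans ?_
    rw [List.length_cons, pow_succ', mul_assoc, hx i (by simp)]
    refine mul_le_mul_right ?_ _
    rw [← lintegral_const_mul' _ _ (by finiteness)]
    refine lintegral_mono fun s => ?_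
    have hx' : ∀ j ∈ L, Function.update x i s j = p j := by
      intro j hj
      rw [Function.update_of_ne (by rintro rfl; exact hi hj)]
      exact hx j (by simp [hj])
    have e : lmarginal (sideMeas p l) L.toFinset
        (fun y => mixedEnergy (i :: L) g (WithLp.toLp 2 y)) (Function.update x i s) =
        lmarginal (sideMeas p l) L.toFinset
          (fun y => mixedEnergy L g (WithLp.toLp 2 y)) (Function.update x i s) +
        lmarginal (sideMeas p l) L.toFinset
          (fun y => mixedEnergy L (partialDeriv i g) (WithLp.toLp 2 y)) (Function.update x i s) := by
      simp only [lmarginal, mixedEnergy]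
      rw [lintegral_add_left]
      exact (hm hg).comp (measurable_updateFinset)
    rw [e, mul_add]
    exact add_le_add (ih (List.nodup_cons.1 hL).2 hg _ hx') (ih (List.nodup_cons.1 hL).2 hg' _ hx')

theorem lintegral_pi_sideMeas_le (p : Fin d → ℝ) (l : ℝ) {E : Set (Vec d)}
    (h : ∀ y ∈ cornerBox p l, (WithLp.toLp 2 y : Vec d) ∈ E) (f : Vec d → ℝ≥0∞) :
    ∫⁻ y, f (WithLp.toLp 2 y) ∂(Measure.pi (sideMeas p l)) ≤ ∫⁻ x in E, f x := by
  have h1 : Measure.pi (sideMeas p l) = volume.restrict (cornerBox p l) := by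
    unfold sideMeas cornerBox
    rw [← Measure.restrict_pi_pi]; rfl
  have hbox : MeasurableSet (cornerBox p l) :=
    MeasurableSet.univ_pi fun i => measurableSet_Icc
  rw [h1, ← (PiLp.volume_preserving_toLp (Fin d)).setLIntegral_comp_preimage_emb
    (MeasurableEquiv.toLp 2 _).measurableEmbedding]
  exact lintegral_mono_set fun y hy => h y hy

theorem enorm_sq_le_of_box {p : Fin d → ℝ} {l : ℝ} (hl : 0 < l) {g : Vec d → ℝ}
    (hg : ContDiff ℝ ∞ g) {E : Set (Vec d)}
    (h : ∀ y ∈ cornerBox p l, (WithLp.toLp 2 y : Vec d) ∈ E) {M : ℝ≥0∞}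
    (hM : ∀ S : List (Fin d), S.Nodup → ∫⁻ x in E, ‖iterPartial S g x‖ₑ ^ 2 ≤ M) :
    ‖g (WithLp.toLp 2 p)‖ₑ ^ 2 ≤ (2 * ENNReal.ofReal (1 / l + 1)) ^ d * M := by
  have h1 := enorm_sq_le_lmarginal p hl (Finset.univ : Finset (Fin d)).toList
    (Finset.nodup_toList _) hg p (fun _ _ => rfl)
  rw [Finset.toList_toFinset, lmarginal_univ, Finset.length_toList, Finset.card_univ,
    Fintype.card_fin] at h1
  refine h1.trans ?_
  rw [mul_pow, mul_comm (2 ^ d), mul_assoc]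
  refine mul_le_mul_right ((lintegral_pi_sideMeas_le p l h _).trans ?_) _
  refine (lintegral_mixedEnergy_le _ hg fun S hS =>
    hM S (hS.nodup (Finset.nodup_toList _))).trans ?_
  simp

/-- Source of the Hölder exponent. Cauchy–Schwarz along direction j bounds the squared increment by
t times the integral of |∂_j g|² over the segment, and the values of ∂_j g there are controlled by
integrating out the other d - 1 coordinates. -/
theorem enorm_sub_sq_le_of_box {p : Fin d → ℝ} {l : ℝ} (hl : 0 < l) {g : Vec d → ℝ}
    (hg : ContDiff ℝ ∞ g) {E : Set (Vec d)}
    (h : ∀ y ∈ cornerBox p l, (WithLp.toLp 2 y : Vec d) ∈ E) {M : ℝ≥0∞}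
    (hM : ∀ S : List (Fin d), S.Nodup → ∫⁻ x in E, ‖iterPartial S g x‖ₑ ^ 2 ≤ M)
    (j : Fin d) {t : ℝ} (ht : 0 ≤ t) (htl : t ≤ l) :
    ‖g (WithLp.toLp 2 (Function.update p j (p j + t))) - g (WithLp.toLp 2 p)‖ₑ ^ 2
      ≤ ENNReal.ofReal t * ((2 * ENNReal.ofReal (1 / l + 1)) ^ (d - 1) * M) := by
  have hg' := partialDeriv_contDiff hg j
  have hcont : Continuous (fun s => partialDeriv j g (WithLp.toLp 2 (Function.update p j s))) :=
    hg'.continuous.comp (continuous_toLp_update p j)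
  have h1 := enorm_sub_sq_le_lintegral_of_hasDerivAt (fun s => hasDerivAt_update hg p j s) hcont
    (p j) ht
  simp only [Function.update_eq_self] at h1
  refine h1.trans (mul_le_mul_right ?_ _)
  set L := (Finset.univ.erase j : Finset (Fin d)).toList with hL
  have hjL : j ∉ L := by simp [hL]
  have hlen : L.length = d - 1 := by simp [hL]
  calc ∫⁻ s in Set.Icc (p j) (p j + t), ‖partialDeriv j g (WithLp.toLp 2 (Function.update p j s))‖ₑ ^ 2
      ≤ ∫⁻ s in Set.Icc (p j) (p j + l),
          ‖partialDeriv j g (WithLp.toLp 2 (Function.update p j s))‖ₑ ^ 2 :=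
        lintegral_mono_set (Set.Icc_subset_Icc le_rfl (by linarith))
    _ ≤ ∫⁻ s in Set.Icc (p j) (p j + l), ENNReal.ofReal (1 / l + 1) ^ L.length *
          lmarginal (sideMeas p l) L.toFinset
            (fun y => mixedEnergy L (partialDeriv j g) (WithLp.toLp 2 y))
            (Function.update p j s) := by
        refine lintegral_mono fun s => ?_
        refine enorm_sq_le_lmarginal p hl L (Finset.nodup_toList _) hg' _ fun i hi => ?_
        rw [Function.update_of_ne (by rintro rfl; exact hjL hi)]
    _ = ENNReal.ofReal (1 / l + 1) ^ L.length *
          ∫⁻ y, mixedEnergy L (partialDeriv j g) (WithLp.toLp 2 y)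
            ∂(Measure.pi (sideMeas p l)) := by
        rw [lintegral_const_mul' _ _ (by finiteness), lintegral_eq_lmarginal_univ p]
        have huniv : (Finset.univ : Finset (Fin d)) = insert j L.toFinset := by
          simp [hL, Finset.insert_erase]
        rw [huniv, lmarginal_insert _ ?_ (by simpa using hjL)]
        · rfl
        · exact (mixedEnergy_measurable L hg').comp (PiLp.continuous_toLp 2 _).measurable
    _ ≤ ENNReal.ofReal (1 / l + 1) ^ L.length * (2 ^ L.length * M) := by
        refine mul_le_mul_right ((lintegral_pi_sideMeas_le p l h _).trans ?_) _
        -- The derivative in direction j is already spent; since `L` omits j, the list `j :: S`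
        -- still has no repetition.
        refine lintegral_mixedEnergy_le _ hg' fun S hS => hM (j :: S) ?_
        refine List.nodup_cons.2 ⟨fun hj => hjL (hS.subset hj), hS.nodup (Finset.nodup_toList _)⟩
    _ = _ := by rw [hlen, mul_pow]; ring

theorem norm_le_sum_abs (x : Vec d) : ‖x‖ ≤ ∑ i, |x i| := by
  rw [EuclideanSpace.norm_eq]
  refine Real.sqrt_le_iff.2 ⟨by positivity, ?_⟩
  simp only [Real.norm_eq_abs]
  exact Finset.sum_sq_le_sq_sum_of_nonneg fun i _ => abs_nonneg _

end Box

section Holder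

variable {d : ℕ} [NeZero d]

theorem isOpen_halfBall (r : ℝ) : IsOpen (halfBall d r) :=
  Metric.isOpen_ball.inter (isOpen_lt continuous_const
    (EuclideanSpace.proj (0 : Fin d) : Vec d →L[ℝ] ℝ).continuous)

theorem measurableSet_halfBall (r : ℝ) : MeasurableSet (halfBall d r) :=
  (isOpen_halfBall r).measurableSet

theorem halfBall_mono {r R : ℝ} (h : r ≤ R) : halfBall d r ⊆ halfBall d R :=
  fun _ hx => ⟨Metric.ball_subset_ball h hx.1, hx.2⟩

theorem mem_halfBall {r : ℝ} {x : Vec d} : x ∈ halfBall d r ↔ ‖x‖ < r ∧ 0 < x 0 := by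
  simp [halfBall]

/-- The side length of the cubes used for interpolation. -/
def boxSide (d : ℕ) : ℝ := 1 / (4 * (d + 1))

theorem boxSide_pos (d : ℕ) : 0 < boxSide d := by unfold boxSide; positivity

/-- The cube extends upwards from its corner and cannot leave the half space. Its side is chosen so
that the displacement is at most d times the side, hence at most 1/4 = 3/2 - 5/4. -/
theorem cornerBox_subset {p : Fin d → ℝ} (hp : (WithLp.toLp 2 p : Vec d) ∈ halfBall d (5 / 4)) :
    ∀ y ∈ cornerBox p (boxSide d), (WithLp.toLp 2 y : Vec d) ∈ halfBall d (3 / 2) := by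
  intro y hy
  rw [mem_halfBall] at hp ⊢
  have hy' : ∀ i, p i ≤ y i ∧ y i ≤ p i + boxSide d := fun i => hy i (Set.mem_univ i)
  refine ⟨?_, hp.2.trans_le (hy' 0).1⟩
  have h1 : ‖(WithLp.toLp 2 y : Vec d) - WithLp.toLp 2 p‖ ≤ 1 / 4 := by
    refine (norm_le_sum_abs _).trans ?_
    calc ∑ i, |((WithLp.toLp 2 y : Vec d) - WithLp.toLp 2 p) i| ≤ ∑ _i : Fin d, boxSide d := by
          refine Finset.sum_le_sum fun i _ => ?_
          simp only [PiLp.sub_apply]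
          rw [abs_le]; constructor <;> linarith [(hy' i).1, (hy' i).2, boxSide_pos d]
      _ ≤ 1 / 4 := by
          simp only [Finset.sum_const, Finset.card_univ, Fintype.card_fin, nsmul_eq_mul, boxSide]
          rw [mul_one_div, div_le_div_iff₀ (by positivity) (by norm_num)]
          linarith
  have := norm_le_norm_sub_add (WithLp.toLp 2 y : Vec d) (WithLp.toLp 2 p)
  linarith [hp.1]

/-- The path from x to z changes one coordinate at a time. As x ≤ z coordinatewise, every increment
is nonnegative and every intermediate point is an admissible corner of a cube, no farther from x
than z is. -/
theorem abs_sub_le_of_increments {g : Vec d → ℝ} {K : ℝ}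
    (h : ∀ p : Fin d → ℝ, (WithLp.toLp 2 p : Vec d) ∈ halfBall d (5 / 4) → ∀ j t, 0 ≤ t →
      t ≤ boxSide d →
      |g (WithLp.toLp 2 (Function.update p j (p j + t))) - g (WithLp.toLp 2 p)| ≤ K * √t)
    (hK : 0 ≤ K) {x z : Vec d} (hx : x ∈ halfBall d 1) {ρ : ℝ} (hρ : ρ ≤ boxSide d)
    (hxz : ∀ i, x i ≤ z i) (hn : ‖z - x‖ ≤ ρ) : |g z - g x| ≤ d * (K * √ρ) := by
  have hco : ∀ i, z i - x i ≤ ρ := fun i => by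
    have := (PiLp.norm_apply_le (z - x) i).trans hn
    rw [PiLp.sub_apply, Real.norm_eq_abs] at this
    exact (le_abs_self _).trans this
  have key : ∀ s : Finset (Fin d),
      |g (WithLp.toLp 2 (fun i => if i ∈ s then z i else x i)) - g x| ≤ s.card * (K * √ρ) := by
    intro s
    induction s using Finset.induction_on with
    | empty => simp
    | insert j s hj ih =>
      set p : Fin d → ℝ := fun i => if i ∈ s then z i else x i with hp
      have hmem : (WithLp.toLp 2 p : Vec d) ∈ halfBall d (5 / 4) := by
        rw [mem_halfBall] at hx ⊢
        refine ⟨?_, ?_⟩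
        · have h1 : ‖(WithLp.toLp 2 p : Vec d) - x‖ ≤ ‖z - x‖ := by
            rw [EuclideanSpace.norm_eq, EuclideanSpace.norm_eq]
            refine Real.sqrt_le_sqrt (Finset.sum_le_sum fun i _ => ?_)
            simp only [PiLp.sub_apply, hp]
            split_ifs
            · exact le_rfl
            · simp [sq_nonneg]
          have h2 := norm_le_norm_sub_add (WithLp.toLp 2 p : Vec d) x
          have h3 : boxSide d ≤ 1 / 4 := by
            unfold boxSide
            rw [div_le_div_iff₀ (by positivity) (by norm_num)]
            have : (0 : ℝ) ≤ d := by positivity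
            linarith
          linarith [hx.1]
        · simp only [hp]
          split_ifs
          · exact hx.2.trans_le (hxz 0)
          · exact hx.2
      have e : (fun i => if i ∈ insert j s then z i else x i)
          = Function.update p j (p j + (z j - x j)) := by
        ext i
        by_cases hij : i = j
        · subst hij; simp [hp, hj]
        · simp [hp, hij]
      rw [e, Finset.card_insert_of_notMem hj]
      have h1 := h p hmem j (z j - x j) (by linarith [hxz j]) ((hco j).trans hρ)
      have h2 : K * √(z j - x j) ≤ K * √ρ :=
        mul_le_mul_of_nonneg_left (Real.sqrt_le_sqrt (hco j)) hK
      have h3 := abs_sub_le (g (WithLp.toLp 2 (Function.update p j (p j + (z j - x j)))))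
        (g (WithLp.toLp 2 p)) (g x)
      push_cast
      linarith
  have := key Finset.univ
  simpa using this

theorem exists_holder_bound (d : ℕ) [NeZero d] : ∃ C : ℝ, 0 ≤ C ∧ ∀ g : Vec d → ℝ,
    ContDiff ℝ ∞ g → ∀ M : ℝ, 0 ≤ M →
    (∀ S : List (Fin d), S.Nodup →
      ∫⁻ x in halfBall d (3 / 2), ‖iterPartial S g x‖ₑ ^ 2 ≤ ENNReal.ofReal M) →
    (∀ x ∈ halfBall d 1, |g x| ≤ C * √M) ∧
    (∀ x ∈ halfBall d 1, ∀ y ∈ halfBall d 1, |g x - g y| ≤ C * √M * √‖x - y‖) := by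
  set l := boxSide d with hl
  have hlpos : 0 < l := boxSide_pos d
  set c : ℝ := (2 * (1 / l + 1)) with hc
  have hcpos : 1 ≤ c := by
    have : 0 < 1 / l := by positivity
    linarith
  set K : ℝ := √(c ^ d) with hK
  have hKpos : 0 ≤ K := Real.sqrt_nonneg _
  have hcE : ∀ k : ℕ, (2 * ENNReal.ofReal (1 / l + 1)) ^ k = ENNReal.ofReal (c ^ k) := fun k => by
    rw [ENNReal.ofReal_pow (by positivity), hc, ENNReal.ofReal_mul (by norm_num)]
    norm_num
  refine ⟨2 * d * K + 2 * K + 2 * K / √l, by positivity, fun g hg M hM0 hM => ?_⟩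
  have hsup : ∀ x ∈ halfBall d (5 / 4), |g x| ≤ K * √M := by
    intro x hx
    have h1 := enorm_sq_le_of_box (p := x.ofLp) hlpos hg (cornerBox_subset hx) hM
    rw [hcE, ← ENNReal.ofReal_mul (by positivity), enorm_sq_eq_ofReal,
      ENNReal.ofReal_le_ofReal_iff (by positivity)] at h1
    rw [hK, ← Real.sqrt_mul (by positivity)]
    exact Real.abs_le_sqrt h1
  have hinc : ∀ p : Fin d → ℝ, (WithLp.toLp 2 p : Vec d) ∈ halfBall d (5 / 4) → ∀ j t, 0 ≤ t →
      t ≤ boxSide d →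
      |g (WithLp.toLp 2 (Function.update p j (p j + t))) - g (WithLp.toLp 2 p)|
        ≤ K * √M * √t := by
    intro p hp j t ht htl
    have h1 := enorm_sub_sq_le_of_box hlpos hg (cornerBox_subset hp) hM j ht htl
    rw [hcE, ← ENNReal.ofReal_mul (by positivity), ← ENNReal.ofReal_mul (by positivity),
      enorm_sq_eq_ofReal, ENNReal.ofReal_le_ofReal_iff (by positivity)] at h1
    rw [hK, ← Real.sqrt_mul (by positivity), ← Real.sqrt_mul (by positivity)]
    refine Real.abs_le_sqrt (h1.trans ?_)
    have : c ^ (d - 1) ≤ c ^ d := pow_le_pow_right₀ hcpos (Nat.sub_le _ _)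
    calc t * (c ^ (d - 1) * M) ≤ t * (c ^ d * M) := by gcongr
      _ = _ := by ring
  have hKM : 0 ≤ K * √M := by positivity
  have hsq : 0 < √l := Real.sqrt_pos.2 hlpos
  have hd0 : (0 : ℝ) ≤ d := by positivity
  refine ⟨fun x hx => (hsup x (halfBall_mono (by norm_num) hx)).trans ?_, fun x hx y hy => ?_⟩
  · refine mul_le_mul_of_nonneg_right ?_ (Real.sqrt_nonneg _)
    have h1 : 0 ≤ 2 * K / √l := by positivity
    have h2 : 0 ≤ 2 * d * K := by positivity
    linarith
  · by_cases hxy : ‖x - y‖ ≤ l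
    -- Only increasing steps are controlled. The coordinatewise maximum is reached by increasing
    -- steps from both points, and its distance to either is at most ‖x - y‖.
    · set z : Vec d := WithLp.toLp 2 fun i => max (x i) (y i) with hz
      have hzx : ‖z - x‖ ≤ ‖x - y‖ := by
        rw [EuclideanSpace.norm_eq, EuclideanSpace.norm_eq]
        refine Real.sqrt_le_sqrt (Finset.sum_le_sum fun i _ => ?_)
        simp only [PiLp.sub_apply, hz, Real.norm_eq_abs, sq_abs]
        rcases max_cases (x i) (y i) with h | h <;> simp only [h.1] <;> nlinarith [sq_nonneg (x i - y i)]
      have hzy : ‖z - y‖ ≤ ‖x - y‖ := by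
        rw [EuclideanSpace.norm_eq, EuclideanSpace.norm_eq]
        refine Real.sqrt_le_sqrt (Finset.sum_le_sum fun i _ => ?_)
        simp only [PiLp.sub_apply, hz, Real.norm_eq_abs, sq_abs]
        rcases max_cases (x i) (y i) with h | h <;> simp only [h.1] <;> nlinarith [sq_nonneg (x i - y i)]
      have h1 := abs_sub_le_of_increments hinc hKM hx hxy (fun i => by simp [hz]) hzx
      have h2 := abs_sub_le_of_increments hinc hKM hy hxy (fun i => by simp [hz]) hzy
      have h3 := abs_sub_le (g x) (g z) (g y)
      rw [abs_sub_comm (g x) (g z)] at h3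
      have h4 : 0 ≤ (2 * K + 2 * K / √l) * √M * √‖x - y‖ := by positivity
      nlinarith
    -- For points farther apart than the cube side the supremum bound suffices, since √‖x - y‖ is
    -- bounded below.
    · have h1 := hsup x (halfBall_mono (by norm_num) hx)
      have h2 := hsup y (halfBall_mono (by norm_num) hy)
      have h3 : |g x - g y| ≤ 2 * (K * √M) := by
        have := abs_sub (g x) (g y); linarith
      have h4 : √l ≤ √‖x - y‖ := Real.sqrt_le_sqrt (by linarith)
      have h5 : 2 * (K * √M) ≤ 2 * K / √l * √M * √‖x - y‖ := by
        have : 1 ≤ √‖x - y‖ / √l := (one_le_div hsq).2 h4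
        calc 2 * (K * √M) ≤ 2 * (K * √M) * (√‖x - y‖ / √l) :=
              le_mul_of_one_le_right (by positivity) this
          _ = _ := by ring
      have h6 : 0 ≤ (2 * d * K + 2 * K) * √M * √‖x - y‖ := by positivity
      nlinarith

end Holder

/-! ### Calculus of partial derivatives and bookkeeping of L² bounds -/

section Calculus

variable {d : ℕ}

theorem partialDeriv_add {f g : Vec d → ℝ} (hf : ContDiff ℝ ∞ f) (hg : ContDiff ℝ ∞ g)
    (i : Fin d) (x : Vec d) : partialDeriv i (fun y => f y + g y) x =
      partialDeriv i f x + partialDeriv i g x := by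
  unfold partialDeriv
  rw [fderiv_fun_add (hf.differentiable (by simp) x) (hg.differentiable (by simp) x)]
  rfl

theorem partialDeriv_sub {f g : Vec d → ℝ} (hf : ContDiff ℝ ∞ f) (hg : ContDiff ℝ ∞ g)
    (i : Fin d) (x : Vec d) : partialDeriv i (fun y => f y - g y) x =
      partialDeriv i f x - partialDeriv i g x := by
  unfold partialDeriv
  rw [fderiv_fun_sub (hf.differentiable (by simp) x) (hg.differentiable (by simp) x)]
  rfl

theorem partialDeriv_mul {f g : Vec d → ℝ} (hf : ContDiff ℝ ∞ f) (hg : ContDiff ℝ ∞ g)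
    (i : Fin d) (x : Vec d) : partialDeriv i (fun y => f y * g y) x =
      partialDeriv i f x * g x + f x * partialDeriv i g x := by
  unfold partialDeriv
  rw [fderiv_fun_mul (hf.differentiable (by simp) x) (hg.differentiable (by simp) x)]
  simp
  ring

theorem partialDeriv_const_mul (c : ℝ) {g : Vec d → ℝ} (hg : ContDiff ℝ ∞ g)
    (i : Fin d) (x : Vec d) : partialDeriv i (fun y => c * g y) x = c * partialDeriv i g x := by
  unfold partialDeriv
  rw [fderiv_const_mul (hg.differentiable (by simp) x)]
  rfl

theorem partialDeriv_neg (g : Vec d → ℝ) (i : Fin d) (x : Vec d) :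
    partialDeriv i (fun y => -g y) x = -partialDeriv i g x := by
  unfold partialDeriv
  rw [fderiv_fun_neg]
  rfl

theorem partialDeriv_sum {ι : Type*} (s : Finset ι) {g : ι → Vec d → ℝ}
    (hg : ∀ k ∈ s, ContDiff ℝ ∞ (g k)) (i : Fin d) (x : Vec d) :
    partialDeriv i (fun y => ∑ k ∈ s, g k y) x = ∑ k ∈ s, partialDeriv i (g k) x := by
  unfold partialDeriv
  rw [fderiv_fun_sum fun k hk => (hg k hk).differentiable (by simp) x]
  simp

theorem partialDeriv_congr_of_eventuallyEq {f g : Vec d → ℝ} {x : Vec d} (h : f =ᶠ[𝓝 x] g)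
    (i : Fin d) : partialDeriv i f x = partialDeriv i g x := by
  unfold partialDeriv
  rw [h.fderiv_eq]

theorem tsupport_partialDeriv_subset (i : Fin d) (g : Vec d → ℝ) :
    tsupport (partialDeriv i g) ⊆ tsupport g := by
  refine closure_minimal ?_ (isClosed_tsupport g)
  intro x hx
  by_contra h
  refine hx ?_
  rw [partialDeriv_congr_of_eventuallyEq (notMem_tsupport_iff_eventuallyEq.1 h) i]
  simp [partialDeriv]

theorem hasCompactSupport_partialDeriv {g : Vec d → ℝ} (hg : HasCompactSupport g) (i : Fin d) :
    HasCompactSupport (partialDeriv i g) :=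
  hg.of_isClosed_subset (isClosed_tsupport _) (tsupport_partialDeriv_subset i g)

end Calculus

section L2Bound

variable {d : ℕ}

/-- `F` is square integrable on `ℝ^d` and the square of its norm is at most `B`. -/
structure L2Bound (F : Vec d → ℝ) (B : ℝ) : Prop where
  memLp : MemLp F 2 volume
  le : ∫ x, F x ^ 2 ≤ B

theorem L2Bound.mono {F : Vec d → ℝ} {B B' : ℝ} (h : L2Bound F B) (hB : B ≤ B') : L2Bound F B' :=
  ⟨h.memLp, h.le.trans hB⟩

theorem L2Bound.add {F G : Vec d → ℝ} {A B : ℝ} (hF : L2Bound F A) (hG : L2Bound G B) :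
    L2Bound (fun x => F x + G x) (2 * A + 2 * B) := by
  refine ⟨hF.memLp.add hG.memLp, ?_⟩
  have i1 := hF.memLp.integrable_sq
  have i2 := hG.memLp.integrable_sq
  calc ∫ x, (F x + G x) ^ 2 ≤ ∫ x, (2 * F x ^ 2 + 2 * G x ^ 2) := by
        refine integral_mono (hF.memLp.add hG.memLp).integrable_sq
          ((i1.const_mul 2).add (i2.const_mul 2)) fun x => ?_
        nlinarith [sq_nonneg (F x - G x)]
    _ = 2 * (∫ x, F x ^ 2) + 2 * ∫ x, G x ^ 2 := by
        rw [integral_add (i1.const_mul 2) (i2.const_mul 2), integral_const_mul, integral_const_mul]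
    _ ≤ _ := by linarith [hF.le, hG.le]

theorem L2Bound.mul {F h : Vec d → ℝ} {A M : ℝ} (hF : L2Bound F A) (hc : Continuous h)
    (hM : ∀ x, |h x| ≤ M) : L2Bound (fun x => h x * F x) (M ^ 2 * A) := by
  have hM0 : 0 ≤ M := (abs_nonneg _).trans (hM 0)
  have hm : MemLp (fun x => h x * F x) 2 volume := by
    refine MemLp.of_le_mul (c := M) hF.memLp (hc.aestronglyMeasurable.mul hF.memLp.1)
      (ae_of_all _ fun x => ?_)
    rw [norm_mul]
    exact mul_le_mul_of_nonneg_right (hM x) (norm_nonneg _)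
  refine ⟨hm, ?_⟩
  calc ∫ x, (h x * F x) ^ 2 ≤ ∫ x, M ^ 2 * F x ^ 2 := by
        refine integral_mono hm.integrable_sq (hF.memLp.integrable_sq.const_mul _) fun x => ?_
        simp only
        rw [mul_pow]
        exact mul_le_mul_of_nonneg_right (sq_le_sq' (abs_le.1 (hM x)).1 (abs_le.1 (hM x)).2)
          (sq_nonneg _)
    _ ≤ _ := by
      rw [integral_const_mul]
      exact mul_le_mul_of_nonneg_left hF.le (sq_nonneg _)

theorem L2Bound.const_mul {F : Vec d → ℝ} {A : ℝ} (hF : L2Bound F A) (c : ℝ) :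
    L2Bound (fun x => c * F x) (c ^ 2 * A) := by
  have := hF.mul (h := fun _ => c) continuous_const (M := |c|) fun _ => le_rfl
  rwa [sq_abs] at this

theorem L2Bound.neg {F : Vec d → ℝ} {A : ℝ} (hF : L2Bound F A) : L2Bound (fun x => -F x) A := by
  simpa using hF.const_mul (-1)

theorem L2Bound.sub {F G : Vec d → ℝ} {A B : ℝ} (hF : L2Bound F A) (hG : L2Bound G B) :
    L2Bound (fun x => F x - G x) (2 * A + 2 * B) := by
  simpa [sub_eq_add_neg] using hF.add hG.neg

theorem L2Bound.sum {ι : Type*} (s : Finset ι) {F : ι → Vec d → ℝ} {A : ℝ}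
    (hF : ∀ k ∈ s, L2Bound (F k) A) :
    L2Bound (fun x => ∑ k ∈ s, F k x) (s.card * (s.card * A)) := by
  have hm : MemLp (fun x => ∑ k ∈ s, F k x) 2 volume :=
    memLp_finsetSum s fun k hk => (hF k hk).memLp
  refine ⟨hm, ?_⟩
  have hi : ∀ k ∈ s, Integrable (fun x => F k x ^ 2) volume := fun k hk =>
    (hF k hk).memLp.integrable_sq
  calc ∫ x, (∑ k ∈ s, F k x) ^ 2 ≤ ∫ x, s.card * ∑ k ∈ s, F k x ^ 2 :=
        integral_mono hm.integrable_sq ((integrable_finsetSum _ hi).const_mul _) fun x =>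
          sq_sum_le_card_mul_sum_sq
    _ = s.card * ∑ k ∈ s, ∫ x, F k x ^ 2 := by
        rw [integral_const_mul, integral_finsetSum _ hi]
    _ ≤ _ := by
        refine mul_le_mul_of_nonneg_left ?_ (by positivity)
        calc _ ≤ ∑ k ∈ s, A := Finset.sum_le_sum fun k hk => (hF k hk).le
          _ = _ := by simp

theorem L2Bound.measConv {F : Vec d → ℝ} {A : ℝ} (hF : L2Bound F A) (ν : Measure (Vec d))
    [IsFiniteMeasure ν] : L2Bound (measConv ν F) (ν.real Set.univ ^ 2 * A) := by
  refine ⟨measConv_memLp ν hF.memLp, ?_⟩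
  have := integral_measConv_sq_le ν hF.memLp MeasurableSet.univ MeasurableSet.univ (by simp)
  simp only [Measure.restrict_univ] at this
  exact this.trans (mul_le_mul_of_nonneg_left hF.le (sq_nonneg _))

end L2Bound

/-! ### Integration along segments, and cutoff functions -/

section Segment

variable {d : ℕ}

theorem measConv_eq_convolution (ν : Measure (Vec d)) (g : Vec d → ℝ) :
    measConv ν g = convolution (fun _ => (1 : ℝ)) g (ContinuousLinearMap.lsmul ℝ ℝ) ν := by
  ext x
  simp [measConv, convolution]

theorem measConv_contDiff (ν : Measure (Vec d)) [IsFiniteMeasure ν] {g : Vec d → ℝ}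
    (hg : ContDiff ℝ ∞ g) (hc : HasCompactSupport g) : ContDiff ℝ ∞ (measConv ν g) := by
  rw [measConv_eq_convolution]
  exact hc.contDiff_convolution_right _ (locallyIntegrable_const 1) hg

theorem partialDeriv_measConv (ν : Measure (Vec d)) [IsFiniteMeasure ν] {g : Vec d → ℝ}
    (hg : ContDiff ℝ ∞ g) (hc : HasCompactSupport g) (i : Fin d) :
    partialDeriv i (measConv ν g) = measConv ν (partialDeriv i g) := by
  ext x
  have hcf : Continuous (fderiv ℝ g) := hg.continuous_fderiv (by simp)
  obtain ⟨B, hB⟩ := hcf.bounded_above_of_compact_support (hc.fderiv (𝕜 := ℝ))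
  obtain ⟨B', hB'⟩ := hg.continuous.bounded_above_of_compact_support hc
  have h1 : HasFDerivAt (measConv ν g) (∫ t, fderiv ℝ g (x - t) ∂ν) x := by
    refine hasFDerivAt_integral_of_dominated_of_fderiv_le (s := Set.univ) (bound := fun _ => B)
      (F := fun y t => g (y - t)) (F' := fun y t => fderiv ℝ g (y - t))
      Filter.univ_mem (Eventually.of_forall fun y => ?_) ?_ ?_ ?_ (integrable_const _) ?_
    · exact (hg.continuous.comp (by fun_prop)).aestronglyMeasurable
    · exact Integrable.of_bound (hg.continuous.comp (by fun_prop)).aestronglyMeasurable B'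
        (ae_of_all _ fun t => hB' _)
    · exact (hcf.comp (by fun_prop)).aestronglyMeasurable
    · exact ae_of_all _ fun t y _ => hB _
    · refine ae_of_all _ fun t y _ => ?_
      have h2 : HasFDerivAt (fun y : Vec d => y - t) (ContinuousLinearMap.id ℝ (Vec d)) y :=
        (hasFDerivAt_id y).sub_const t
      simpa [Function.comp_def] using
        ((hg.differentiable (by simp) (y - t)).hasFDerivAt).comp y h2
  have hint : Integrable (fun t => fderiv ℝ g (x - t)) ν :=
    Integrable.of_bound (hcf.comp (by fun_prop)).aestronglyMeasurable B (ae_of_all _ fun t => hB _)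
  rw [partialDeriv, h1.fderiv, ContinuousLinearMap.integral_apply hint]
  rfl

/-- The measure whose convolution is integration along the segment `[x, x + T e_i]`. -/
def segMeas (i : Fin d) (T : ℝ) : Measure (Vec d) :=
  (volume.restrict (Set.Icc 0 T)).map fun t : ℝ => -(t • basisVec i)

theorem measurable_segMap (i : Fin d) : Measurable fun t : ℝ => -(t • (basisVec i : Vec d)) :=
  (by fun_prop : Continuous fun t : ℝ => -(t • (basisVec i : Vec d))).measurable

instance (i : Fin d) (T : ℝ) : IsFiniteMeasure (segMeas i T) := by
  unfold segMeas; infer_instance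

theorem segMeas_real_univ (i : Fin d) {T : ℝ} (hT : 0 ≤ T) :
    (segMeas i T).real Set.univ = T := by
  rw [Measure.real, segMeas, Measure.map_apply (measurable_segMap i) MeasurableSet.univ]
  simp [hT]

theorem ae_segMeas (i : Fin d) (T : ℝ) {P : Vec d → Prop} (hP : MeasurableSet {x | P x})
    (h : ∀ t ∈ Set.Icc 0 T, P (-(t • basisVec i))) : ∀ᵐ v ∂(segMeas i T), P v := by
  rw [segMeas, ae_map_iff (measurable_segMap i).aemeasurable hP,
    ae_restrict_iff' measurableSet_Icc]
  exact ae_of_all _ h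

theorem measConv_segMeas (i : Fin d) (T : ℝ) {g : Vec d → ℝ} (hg : Continuous g) (x : Vec d) :
    measConv (segMeas i T) g x = ∫ t in Set.Icc 0 T, g (x + t • basisVec i) := by
  rw [measConv, segMeas, integral_map (measurable_segMap i).aemeasurable
    (Continuous.aestronglyMeasurable (by fun_prop))]
  simp

theorem hasDerivAt_along {g : Vec d → ℝ} (hg : ContDiff ℝ ∞ g) (x : Vec d) (i : Fin d) (t : ℝ) :
    HasDerivAt (fun t : ℝ => g (x + t • basisVec i)) (partialDeriv i g (x + t • basisVec i)) t := by
  have h1 : HasDerivAt (fun t : ℝ => x + t • (basisVec i : Vec d)) (basisVec i) t := by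
    simpa using ((hasDerivAt_id t).smul_const (basisVec i : Vec d)).const_add x
  exact ((hg.differentiable (by simp) _).hasFDerivAt).comp_hasDerivAt t h1

theorem measConv_segMeas_partialDeriv {g : Vec d → ℝ} (hg : ContDiff ℝ ∞ g) (i : Fin d) {T : ℝ}
    (hT : 0 ≤ T) (x : Vec d) :
    measConv (segMeas i T) (partialDeriv i g) x = g (x + T • basisVec i) - g x := by
  have hc := (partialDeriv_contDiff hg i).continuous
  rw [measConv_segMeas i T hc, integral_Icc_eq_integral_Ioc, ← intervalIntegral.integral_of_le hT,
    intervalIntegral.integral_eq_sub_of_hasDerivAt (fun t _ => hasDerivAt_along hg x i t)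
      (Continuous.intervalIntegrable (by fun_prop) _ _)]
  simp

end Segment

section Cutoff

variable {d : ℕ}

theorem exists_bound_of_eq_zero {f : ℝ → ℝ} (hf : Continuous f)
    (h : ∀ t, t ∉ Set.Icc (0 : ℝ) 1 → f t = 0) : ∃ K, ∀ t, |f t| ≤ K := by
  obtain ⟨K, hK⟩ := isCompact_Icc.exists_bound_of_continuousOn (hf.continuousOn (s := Set.Icc 0 1))
  refine ⟨max K 0, fun t => ?_⟩
  by_cases ht : t ∈ Set.Icc (0 : ℝ) 1
  · exact (hK t ht).trans (le_max_left _ _)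
  · rw [h t ht]; simp

theorem deriv_eq_zero_of_locally_const {f : ℝ → ℝ} {a b : ℝ}
    (h0 : ∀ t < 0, f t = a) (h1 : ∀ t > 1, f t = b) :
    ∀ t, t ∉ Set.Icc (0 : ℝ) 1 → deriv f t = 0 := by
  intro t ht
  rw [Set.mem_Icc, not_and_or, not_le, not_le] at ht
  rcases ht with ht | ht
  · have : f =ᶠ[𝓝 t] fun _ => a := by
      filter_upwards [Iio_mem_nhds ht] with s hs using h0 s hs
    rw [this.deriv_eq]; simp
  · have : f =ᶠ[𝓝 t] fun _ => b := by
      filter_upwards [Ioi_mem_nhds ht] with s hs using h1 s hs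
    rw [this.deriv_eq]; simp

theorem smoothTransition_bounds : ∃ K : ℝ, 1 ≤ K ∧
    (∀ t, |deriv Real.smoothTransition t| ≤ K) ∧
    (∀ t, |deriv (deriv Real.smoothTransition) t| ≤ K) := by
  have hs : ContDiff ℝ 2 Real.smoothTransition := Real.smoothTransition.contDiff
  have hs1 : ContDiff ℝ 1 (deriv Real.smoothTransition) :=
    ((contDiff_succ_iff_deriv (n := 1)).1 (by rw [one_add_one_eq_two]; exact hs)).2.2
  have h0 : ∀ t, t ∉ Set.Icc (0 : ℝ) 1 → deriv Real.smoothTransition t = 0 :=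
    deriv_eq_zero_of_locally_const (a := 0) (b := 1)
      (fun t ht => Real.smoothTransition.zero_of_nonpos ht.le)
      (fun t ht => Real.smoothTransition.one_of_one_le ht.le)
  obtain ⟨K1, h1⟩ := exists_bound_of_eq_zero hs1.continuous h0
  obtain ⟨K2, h2⟩ := exists_bound_of_eq_zero (hs1.continuous_deriv le_rfl)
    (deriv_eq_zero_of_locally_const (a := 0) (b := 0)
      (fun t ht => h0 t fun h => absurd h.1 (by linarith))
      (fun t ht => h0 t fun h => absurd h.2 (by linarith)))
  exact ⟨max 1 (max K1 K2), le_max_left _ _,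
    fun t => (h1 t).trans ((le_max_left _ _).trans (le_max_right _ _)),
    fun t => (h2 t).trans ((le_max_right _ _).trans (le_max_right _ _))⟩

/-- A smooth cutoff between the balls of radii `r` and `R`, with the sizes of its first and second
derivatives bounded by `M`. -/
structure IsCutoff (r R M : ℝ) (η : Vec d → ℝ) : Prop where
  smooth : ContDiff ℝ ∞ η
  nonneg : ∀ x, 0 ≤ η x
  le_one : ∀ x, η x ≤ 1
  eq_one : ∀ x, ‖x‖ ≤ r → η x = 1
  tsupport_subset : tsupport η ⊆ Metric.ball 0 R
  deriv_le : ∀ i x, |partialDeriv i η x| ≤ M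
  deriv2_le : ∀ i j x, |partialDeriv i (partialDeriv j η) x| ≤ M

theorem partialDeriv_comp_real {θ : ℝ → ℝ} (hθ : ContDiff ℝ ∞ θ) {h : Vec d → ℝ}
    (hh : ContDiff ℝ ∞ h) (i : Fin d) (x : Vec d) :
    partialDeriv i (fun y => θ (h y)) x = deriv θ (h x) * partialDeriv i h x := by
  have h1 := ((hθ.differentiable (by simp) (h x)).hasDerivAt).comp_hasFDerivAt x
    ((hh.differentiable (by simp) x).hasFDerivAt)
  have h2 := h1.fderiv
  simp only [Function.comp_def] at h2
  rw [partialDeriv, h2]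
  simp [partialDeriv]

theorem partialDeriv_coord (i j : Fin d) (x : Vec d) :
    partialDeriv i (fun y : Vec d => y j) x = if i = j then 1 else 0 := by
  have : fderiv ℝ (fun y : Vec d => y j) x = (EuclideanSpace.proj j : Vec d →L[ℝ] ℝ) :=
    (EuclideanSpace.proj j : Vec d →L[ℝ] ℝ).hasFDerivAt.fderiv
  rw [partialDeriv, this]
  simp [eq_comm]

theorem partialDeriv_norm_sq (i : Fin d) (x : Vec d) :
    partialDeriv i (fun y : Vec d => ‖y‖ ^ 2) x = 2 * x i := by
  have h := (hasStrictFDerivAt_norm_sq x).hasFDerivAt.fderiv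
  rw [partialDeriv, h]
  simp [EuclideanSpace.inner_single_right]

/-- The cutoff is `Real.smoothTransition` of b(ρ² - ‖x‖²), with ρ the midpoint and b = 1/(ρ² - r²),
which makes the argument at least 1 on the inner ball. Here b is of order (R - r)⁻², and second
derivatives carry b², hence the fourth power. The numerical constant is generous. -/
theorem exists_isCutoff (d : ℕ) : ∃ K : ℝ, 1 ≤ K ∧ ∀ r R : ℝ, 0 ≤ r → r < R → R ≤ 2 →
    ∃ η : Vec d → ℝ, IsCutoff r R (K / (R - r) ^ 4) η := by
  obtain ⟨K, hK1, hKa, hKb⟩ := smoothTransition_bounds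
  refine ⟨10000 * K, by linarith, fun r R hr hrR hR => ?_⟩
  set ρ := (r + R) / 2 with hρ
  have hρ0 : 0 < ρ := by rw [hρ]; linarith
  have hden : (R - r) ^ 2 / 4 ≤ ρ ^ 2 - r ^ 2 := by rw [hρ]; nlinarith
  have hpos : 0 < (R - r) ^ 2 := by have : 0 < R - r := by linarith
                                    positivity
  have hden0 : 0 < ρ ^ 2 - r ^ 2 := by linarith
  set b := 1 / (ρ ^ 2 - r ^ 2) with hb
  have hb0 : 0 < b := by positivity
  have hb1 : b ≤ 4 / (R - r) ^ 2 := by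
    rw [hb, div_le_div_iff₀ hden0 hpos]; linarith
  have hRr : (R - r) ^ 2 ≤ 4 := by nlinarith
  set Q := 1 / (R - r) ^ 2 with hQ
  have hQ1 : 1 / 4 ≤ Q := by rw [hQ, div_le_div_iff₀ (by norm_num) hpos]; linarith
  have hbQ : b ≤ 4 * Q := by rw [hQ]; linarith [hb1, (by ring : 4 * (1 / (R - r) ^ 2) = 4 / (R - r) ^ 2)]
  have hQ2 : 10000 * K / (R - r) ^ 4 = 10000 * K * Q ^ 2 := by rw [hQ]; field_simp
  set θ := Real.smoothTransition with hθ
  have hθc : ContDiff ℝ ∞ θ := Real.smoothTransition.contDiff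
  have hθ' : ContDiff ℝ ∞ (deriv θ) :=
    ((contDiff_succ_iff_deriv (n := ∞)).1 (by simpa using hθc)).2.2
  set h : Vec d → ℝ := fun x => b * (ρ ^ 2 - ‖x‖ ^ 2) with hh
  have hhc : ContDiff ℝ ∞ h := contDiff_const.mul (contDiff_const.sub (contDiff_norm_sq ℝ))
  have hdh : ∀ i x, partialDeriv i h x = -(2 * b) * x i := by
    intro i x
    rw [hh, partialDeriv_const_mul b (contDiff_const.sub (contDiff_norm_sq ℝ)),
      partialDeriv_sub contDiff_const (contDiff_norm_sq ℝ), partialDeriv_norm_sq]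
    simp [partialDeriv]; ring
  have hcoord : ∀ j, ContDiff ℝ ∞ (fun y : Vec d => y j) := fun j =>
    (EuclideanSpace.proj j : Vec d →L[ℝ] ℝ).contDiff
  have hd1 : ∀ j, partialDeriv j (fun x => θ (h x)) = fun x => deriv θ (h x) * (-(2 * b) * x j) := by
    intro j; ext x
    rw [partialDeriv_comp_real hθc hhc, hdh]
  have hsupp : ∀ x : Vec d, ρ < ‖x‖ → h x < 0 := by
    intro x hx
    have : ρ ^ 2 < ‖x‖ ^ 2 := by nlinarith
    simp only [hh]
    nlinarith
  have hx2 : ∀ (x : Vec d) j, ‖x‖ ≤ ρ → |x j| ≤ 2 := by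
    intro x j hx
    have := PiLp.norm_apply_le x j
    rw [Real.norm_eq_abs] at this
    linarith
  have hθ0 : ∀ t < 0, deriv θ t = 0 := fun t ht => by
    have : θ =ᶠ[𝓝 t] fun _ => 0 := by
      filter_upwards [Iio_mem_nhds ht] with s hs using Real.smoothTransition.zero_of_nonpos hs.le
    rw [this.deriv_eq]; simp
  have hθ00 : ∀ t < 0, deriv (deriv θ) t = 0 := fun t ht => by
    have : deriv θ =ᶠ[𝓝 t] fun _ => 0 := by
      filter_upwards [Iio_mem_nhds ht] with s hs using hθ0 s hs
    rw [this.deriv_eq]; simp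
  refine ⟨fun x => θ (h x), hθc.comp hhc, fun x => Real.smoothTransition.nonneg _,
    fun x => Real.smoothTransition.le_one _, fun x hx => ?_, ?_, fun i x => ?_, fun i j x => ?_⟩
  · apply Real.smoothTransition.one_of_one_le
    simp only [hh, hb]
    rw [one_div, inv_mul_eq_div, le_div_iff₀ hden0]
    nlinarith [norm_nonneg x]
  · have : tsupport (fun x => θ (h x)) ⊆ Metric.closedBall 0 ρ := by
      refine closure_minimal (fun x hx => ?_) Metric.isClosed_closedBall
      rw [mem_closedBall_zero_iff]
      by_contra hcon
      exact hx (Real.smoothTransition.zero_of_nonpos (hsupp x (not_le.1 hcon)).le)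
    exact this.trans (Metric.closedBall_subset_ball (by rw [hρ]; linarith))
  · rw [hd1, hQ2]
    by_cases hx : ‖x‖ ≤ ρ
    · simp only [abs_mul, abs_neg, abs_of_pos hb0, abs_two]
      have e1 := hKa (h x)
      have e2 := hx2 x i hx
      calc |deriv θ (h x)| * (2 * b * |x i|) ≤ K * (2 * (4 * Q) * 2) := by gcongr
        _ = 16 * (K * Q) := by ring
        _ ≤ 10000 * (K * Q) * Q := by
          have : 0 ≤ K * Q := by positivity
          nlinarith
        _ = 10000 * K * Q ^ 2 := by ring
    · simp only [hθ0 _ (hsupp x (not_le.1 hx))]; simp; positivity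
  · rw [hd1, hQ2, partialDeriv_mul (f := fun x => deriv θ (h x)) (hθ'.comp hhc)
      (contDiff_const.mul (hcoord j)),
      partialDeriv_comp_real hθ' hhc, hdh, partialDeriv_const_mul _ (hcoord j), partialDeriv_coord]
    by_cases hx : ‖x‖ ≤ ρ
    · have e1 := hKa (h x)
      have e1' := hKb (h x)
      have e2 := hx2 x i hx
      have e3 := hx2 x j hx
      have e4 : |(if i = j then (1 : ℝ) else 0)| ≤ 1 := by split_ifs <;> simp
      refine (abs_add_le _ _).trans ?_
      simp only [abs_mul, abs_neg, abs_of_pos hb0, abs_two]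
      calc |deriv (deriv θ) (h x)| * (2 * b * |x i|) * (2 * b * |x j|)
            + |deriv θ (h x)| * (2 * b * |(if i = j then (1 : ℝ) else 0)|)
          ≤ K * (2 * (4 * Q) * 2) * (2 * (4 * Q) * 2) + K * (2 * (4 * Q) * 1) := by gcongr
        _ = 256 * (K * Q ^ 2) + 8 * (K * Q) := by ring
        _ ≤ 10000 * (K * Q ^ 2) := by
          have : 0 ≤ K * Q := by positivity
          nlinarith
        _ = 10000 * K * Q ^ 2 := by ring
    · rw [hθ0 _ (hsupp x (not_le.1 hx)), hθ00 _ (hsupp x (not_le.1 hx))]; simp; positivity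

theorem IsCutoff.hasCompactSupport {r R M : ℝ} {η : Vec d → ℝ} (h : IsCutoff r R M η) :
    HasCompactSupport η :=
  (isCompact_closedBall (0 : Vec d) R).of_isClosed_subset (isClosed_tsupport _)
    (h.tsupport_subset.trans Metric.ball_subset_closedBall)

end Cutoff

/-! ### A right inverse of the divergence on half balls -/

section Bessel

open SchwartzMap FourierTransform LineDeriv Laplacian

variable {d : ℕ}

/-- Plancherel, used once on each side of the multiplication by the bounded symbol. -/
theorem integral_norm_sq_fourierMultiplier_le {σ : Vec d → ℝ} (hσ : σ.HasTemperateGrowth) {B : ℝ}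
    (hB : ∀ ξ, |σ ξ| ≤ B) (f : 𝓢(Vec d, ℂ)) :
    ∫ x, ‖fourierMultiplierCLM ℂ σ f x‖ ^ 2 ≤ B ^ 2 * ∫ x, ‖f x‖ ^ 2 := by
  rw [← integral_norm_sq_fourier (fourierMultiplierCLM ℂ σ f), fourierMultiplierCLM_apply,
    fourier_fourierInv_eq, ← integral_norm_sq_fourier f, ← integral_const_mul]
  have hint : ∀ h : 𝓢(Vec d, ℂ), Integrable (fun x => ‖h x‖ ^ 2) volume := fun h =>
    (h.memLp 2 volume).integrable_norm_pow (by norm_num)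
  refine integral_mono (hint _) ((hint _).const_mul _) fun ξ => ?_
  simp only
  rw [smulLeftCLM_apply_apply hσ, norm_smul, mul_pow]
  refine mul_le_mul_of_nonneg_right ?_ (by positivity)
  rw [Real.norm_eq_abs, sq_abs]
  exact sq_le_sq' (abs_le.1 (hB ξ)).1 (abs_le.1 (hB ξ)).2

theorem partialDeriv_re (h : 𝓢(Vec d, ℂ)) (i : Fin d) :
    partialDeriv i (fun x => (h x).re) = fun x => ((∂_{basisVec i} h : 𝓢(Vec d, ℂ)) x).re := by
  ext x
  have h1 := (Complex.reCLM.hasFDerivAt (x := h x)).comp x (h.hasFDerivAt x)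
  have h2 := h1.fderiv
  simp only [Function.comp_def, Complex.reCLM_apply] at h2
  rw [partialDeriv, h2, lineDerivOp_apply_eq_fderiv]
  simp

theorem l2Bound_re (h : 𝓢(Vec d, ℂ)) {B : ℝ} (hB : ∫ x, ‖h x‖ ^ 2 ≤ B) :
    L2Bound (fun x => (h x).re) B := by
  have hm : MemLp (fun x => (h x).re) 2 volume := (h.memLp 2 volume).re
  refine ⟨hm, le_trans ?_ hB⟩
  refine integral_mono hm.integrable_sq ((h.memLp 2 volume).integrable_norm_pow (by norm_num))
    fun x => ?_
  simp only
  rw [← sq_abs]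
  exact pow_le_pow_left₀ (abs_nonneg _) (Complex.abs_re_le_norm _) 2

theorem contDiff_re (h : 𝓢(Vec d, ℂ)) : ContDiff ℝ ∞ (fun x => (h x).re) :=
  Complex.reCLM.contDiff.comp (h.smooth ⊤)

/-- The symbol `(1 + |ξ|²)⁻¹`. -/
def besselSymbol (d : ℕ) (ξ : Vec d) : ℝ := (1 + ‖ξ‖ ^ 2) ^ (-1 : ℝ)

theorem besselSymbol_temperate : (besselSymbol d).HasTemperateGrowth :=
  Function.hasTemperateGrowth_one_add_norm_sq_rpow (Vec d) (-1)

theorem besselSymbol_eq (ξ : Vec d) : besselSymbol d ξ = (1 + ‖ξ‖ ^ 2)⁻¹ := by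
  rw [besselSymbol, Real.rpow_neg_one]

theorem fourierMultiplierCLM_smul_complex {σ : Vec d → ℝ} (hσ : σ.HasTemperateGrowth) (c : ℂ)
    (f : 𝓢(Vec d, ℂ)) :
    fourierMultiplierCLM ℂ σ (c • f) = c • fourierMultiplierCLM ℂ σ f := by
  rw [← fourierMultiplierCLM_ofReal ℂ hσ, ← fourierMultiplierCLM_ofReal ℂ hσ, map_smul]

theorem integral_norm_sq_smul (c : ℂ) (f : 𝓢(Vec d, ℂ)) :
    ∫ x, ‖(c • f) x‖ ^ 2 = ‖c‖ ^ 2 * ∫ x, ‖f x‖ ^ 2 := by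
  rw [← integral_const_mul]
  simp [mul_pow]

theorem abs_coord_le_norm (ξ : Vec d) (i : Fin d) : |ξ i| ≤ ‖ξ‖ := PiLp.norm_apply_le ξ i

theorem inner_basisVec (ξ : Vec d) (i : Fin d) : inner ℝ ξ (basisVec i) = ξ i := by
  simp [EuclideanSpace.inner_single_right]

/-- Take q = (1 - cΔ)⁻¹f and s = -c∇q with c = (2π)⁻², so that div s = -cΔq = f - q. In the 2π
normalisation the symbol of q is m = (1 + |ξ|²)⁻¹, and m, ξ_i m, ξ_iξ_j m are all bounded by 1; the
factor 40 exceeds (2π)². Unlike the inverse Laplacian, the resolvent has no singularity at low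
frequencies. The error q is harmless because its gradient is also bounded in L². -/
theorem exists_resolvent {f : Vec d → ℝ} (hf : ContDiff ℝ ∞ f) (hc : HasCompactSupport f) :
    ∃ (q : Vec d → ℝ) (s : Fin d → Vec d → ℝ), ContDiff ℝ ∞ q ∧ (∀ i, ContDiff ℝ ∞ (s i)) ∧
      (∀ x, ∑ i, partialDeriv i (s i) x = f x - q x) ∧
      L2Bound q (40 * ∫ x, f x ^ 2) ∧ (∀ i, L2Bound (partialDeriv i q) (40 * ∫ x, f x ^ 2)) ∧
      (∀ i, L2Bound (s i) (40 * ∫ x, f x ^ 2)) ∧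
      (∀ i j, L2Bound (partialDeriv i (s j)) (40 * ∫ x, f x ^ 2)) := by
  have hc' : HasCompactSupport (fun x => (f x : ℂ)) :=
    hc.comp_left (g := fun t : ℝ => (t : ℂ)) (by simp)
  have hf' : ContDiff ℝ ∞ (fun x => (f x : ℂ)) := Complex.ofRealCLM.contDiff.comp hf
  set F : 𝓢(Vec d, ℂ) := hc'.toSchwartzMap hf' with hF
  have hFx : ∀ x, F x = (f x : ℂ) := fun x => rfl
  set I := ∫ x, f x ^ 2 with hI
  have hI0 : 0 ≤ I := integral_nonneg fun x => sq_nonneg _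
  have hFI : ∫ x, ‖F x‖ ^ 2 = I := by simp [hFx, hI]
  set Q : 𝓢(Vec d, ℂ) := fourierMultiplierCLM ℂ (besselSymbol d) F with hQ
  have hm := besselSymbol_temperate (d := d)
  have hcoord : ∀ i, (fun ξ : Vec d => inner ℝ ξ (basisVec i)).HasTemperateGrowth := fun i =>
    by fun_prop
  have hpi : (3 : ℝ) < Real.pi := Real.pi_gt_three
  have hpi4 : (2 * Real.pi) ^ 2 ≤ 40 := by nlinarith [Real.pi_lt_d2]
  have hn2pi : ‖(2 * Real.pi * Complex.I : ℂ)‖ = 2 * Real.pi := by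
    simp [abs_of_pos Real.pi_pos]
  have hden : ∀ ξ : Vec d, 0 < 1 + ‖ξ‖ ^ 2 := fun ξ => by positivity
  have b0 : ∫ x, ‖Q x‖ ^ 2 ≤ I := by
    have := integral_norm_sq_fourierMultiplier_le hm (B := 1) (fun ξ => ?_) F
    · simpa [hFI] using this
    · rw [besselSymbol_eq, abs_of_pos (inv_pos.2 (hden ξ))]
      exact inv_le_one_of_one_le₀ (by nlinarith [sq_nonneg ‖ξ‖])
  have e1 : ∀ i, (∂_{(basisVec i : Vec d)} Q : 𝓢(Vec d, ℂ)) = (2 * Real.pi * Complex.I : ℂ) •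
      fourierMultiplierCLM ℂ ((fun ξ : Vec d => inner ℝ ξ (basisVec i)) * besselSymbol d) F := by
    intro i
    rw [lineDeriv_eq_fourierMultiplierCLM, hQ,
      fourierMultiplierCLM_fourierMultiplierCLM_apply (hcoord i) hm]
  have b1 : ∀ i, ∫ x, ‖(∂_{(basisVec i : Vec d)} Q : 𝓢(Vec d, ℂ)) x‖ ^ 2 ≤ (2 * Real.pi) ^ 2 * I := by
    intro i
    rw [e1, integral_norm_sq_smul, hn2pi]
    refine mul_le_mul_of_nonneg_left ?_ (by positivity)
    have := integral_norm_sq_fourierMultiplier_le ((hcoord i).mul hm) (B := 1) (fun ξ => ?_) F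
    · simpa [hFI] using this
    · simp only [Pi.mul_apply, inner_basisVec]
      rw [besselSymbol_eq, abs_mul, abs_of_pos (inv_pos.2 (hden ξ)), ← div_eq_mul_inv,
        div_le_one (hden ξ)]
      nlinarith [abs_coord_le_norm ξ i, sq_nonneg (‖ξ‖ - 1)]
  have e2 : ∀ i j, (∂_{(basisVec i : Vec d)} (∂_{(basisVec j : Vec d)} Q : 𝓢(Vec d, ℂ)) : 𝓢(Vec d, ℂ)) =
      (2 * Real.pi * Complex.I : ℂ) • (2 * Real.pi * Complex.I : ℂ) •
      fourierMultiplierCLM ℂ ((fun ξ : Vec d => inner ℝ ξ (basisVec i)) *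
        ((fun ξ : Vec d => inner ℝ ξ (basisVec j)) * besselSymbol d)) F := by
    intro i j
    rw [lineDeriv_eq_fourierMultiplierCLM, e1, fourierMultiplierCLM_smul_complex (hcoord i),
      fourierMultiplierCLM_fourierMultiplierCLM_apply (hcoord i) ((hcoord j).mul hm)]
  have b2 : ∀ i j, ∫ x, ‖(∂_{(basisVec i : Vec d)} (∂_{(basisVec j : Vec d)} Q : 𝓢(Vec d, ℂ)) : 𝓢(Vec d, ℂ)) x‖ ^ 2
      ≤ (2 * Real.pi) ^ 2 * ((2 * Real.pi) ^ 2 * I) := by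
    intro i j
    rw [e2, integral_norm_sq_smul, integral_norm_sq_smul, hn2pi]
    refine mul_le_mul_of_nonneg_left (mul_le_mul_of_nonneg_left ?_ (by positivity)) (by positivity)
    have := integral_norm_sq_fourierMultiplier_le ((hcoord i).mul ((hcoord j).mul hm)) (B := 1)
      (fun ξ => ?_) F
    · simpa [hFI] using this
    · simp only [Pi.mul_apply, inner_basisVec]
      rw [besselSymbol_eq, abs_mul, abs_mul, abs_of_pos (inv_pos.2 (hden ξ)), ← mul_assoc,
        ← div_eq_mul_inv, div_le_one (hden ξ)]
      have := mul_le_mul (abs_coord_le_norm ξ i) (abs_coord_le_norm ξ j) (abs_nonneg _)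
        (norm_nonneg _)
      nlinarith
  have e3 : F = Q + fourierMultiplierCLM ℂ (fun ξ : Vec d => ‖ξ‖ ^ 2) Q := by
    have h1 : (fun ξ : Vec d => ‖ξ‖ ^ 2).HasTemperateGrowth := by fun_prop
    have h2 : (fun _ : Vec d => (1 : ℝ)).HasTemperateGrowth := by fun_prop
    have h3 : F = fourierMultiplierCLM ℂ (fun _ : Vec d => (1 : ℝ)) F := by simp
    have h4 : Q = fourierMultiplierCLM ℂ (fun _ : Vec d => (1 : ℝ)) Q := by simp
    rw [h3]
    nth_rewrite 1 [h4]
    rw [hQ, fourierMultiplierCLM_fourierMultiplierCLM_apply h2 hm,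
      fourierMultiplierCLM_fourierMultiplierCLM_apply h1 hm]
    simp only [fourierMultiplierCLM_apply]
    rw [← fourierInv_add]
    congr 1
    ext ξ
    simp only [_root_.add_apply]
    rw [smulLeftCLM_apply_apply h2, smulLeftCLM_apply_apply (h2.mul hm),
      smulLeftCLM_apply_apply (h1.mul hm), ← add_smul]
    congr 1
    simp only [Pi.mul_apply, besselSymbol_eq]
    field_simp [(hden ξ).ne']
  have e4 := laplacian_eq_fourierMultiplierCLM Q
  rw [laplacian_eq_sum (EuclideanSpace.basisFun (Fin d) ℝ)] at e4
  set c : ℝ := ((2 * Real.pi) ^ 2)⁻¹ with hcdef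
  have hc0 : c * (2 * Real.pi) ^ 2 = 1 := by rw [hcdef]; field_simp
  have hc1 : c ≤ 1 := by
    rw [hcdef]; exact inv_le_one_of_one_le₀ (by nlinarith)
  have hcpos : 0 < c := by positivity
  have p1 : ∀ i, partialDeriv i (fun x => (Q x).re)
      = fun x => ((∂_{(basisVec i : Vec d)} Q : 𝓢(Vec d, ℂ)) x).re := fun i => partialDeriv_re Q i
  have p2 : ∀ i j, partialDeriv i (fun x => -c * ((∂_{(basisVec j : Vec d)} Q : 𝓢(Vec d, ℂ)) x).re)
      = fun x => -c * ((∂_{(basisVec i : Vec d)} (∂_{(basisVec j : Vec d)} Q : 𝓢(Vec d, ℂ)) : 𝓢(Vec d, ℂ)) x).re := by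
    intro i j; ext x
    rw [partialDeriv_const_mul _ (contDiff_re _), partialDeriv_re]
  refine ⟨fun x => (Q x).re, fun i x => -c * ((∂_{(basisVec i : Vec d)} Q : 𝓢(Vec d, ℂ)) x).re,
    contDiff_re Q, fun i => contDiff_const.mul (contDiff_re _), fun x => ?_,
    (l2Bound_re Q b0).mono (by linarith), fun i => ?_, fun i => ?_, fun i j => ?_⟩
  · have h5 := DFunLike.congr_fun e4 x
    have h6 := DFunLike.congr_fun e3 x
    simp only [_root_.sum_apply, _root_.smul_apply, _root_.add_apply,
      EuclideanSpace.basisFun_apply] at h5 h6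
    have h7 := congrArg Complex.re h5
    have h8 := congrArg Complex.re h6
    simp only [Complex.re_sum, Complex.smul_re, Complex.add_re, hFx, Complex.ofReal_re] at h7 h8
    simp only [p2]
    rw [← Finset.mul_sum, h7, h8]
    simp only [smul_eq_mul]
    have : ∀ a : ℝ, -c * (-(2 * Real.pi) ^ 2 * a) = c * (2 * Real.pi) ^ 2 * a := fun a => by ring
    rw [this, hc0]; ring
  · rw [p1]
    exact l2Bound_re _ ((b1 i).trans (mul_le_mul_of_nonneg_right hpi4 hI0))
  · refine ((l2Bound_re _ (b1 i)).const_mul (-c)).mono ?_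
    calc (-c) ^ 2 * ((2 * Real.pi) ^ 2 * I) = c * (c * (2 * Real.pi) ^ 2) * I := by ring
      _ = c * I := by rw [hc0]; ring
      _ ≤ 40 * I := by nlinarith
  · rw [p2]
    refine ((l2Bound_re _ (b2 i j)).const_mul (-c)).mono ?_
    calc (-c) ^ 2 * ((2 * Real.pi) ^ 2 * ((2 * Real.pi) ^ 2 * I))
        = (c * (2 * Real.pi) ^ 2) ^ 2 * I := by ring
      _ ≤ 40 * I := by rw [hc0]; nlinarith

end Bessel

section Corrector

variable {d : ℕ} [NeZero d]

/-- The constant in the estimate of the right inverse of the divergence. -/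
def divConst (d : ℕ) : ℝ := 100000 * (d + 1) ^ 4

/-- The field is φ = ηs + ζw e₁. Since η = 1 on the support of f, div(ηs) = f - g with g = ηq -
∇η·s, and both g and ∇g are bounded in L². The error g is removed by integrating it vertically: D₁w
= g in the half ball. The field w need not vanish on the flat boundary, where test fields are
unrestricted, so f needs no mean value condition. -/
theorem exists_div_corrector_of_cutoff {r ρ R M : ℝ} (hM : 1 ≤ M) (hR : R ≤ 2)
    {η ζ : Vec d → ℝ} (hη : IsCutoff r ρ M η) (hζ : IsCutoff ρ R M ζ) (hρ : ρ ≤ R)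
    {f : Vec d → ℝ} (hf : IsTestFunction (Metric.ball 0 r) f) :
    ∃ φ : Fin d → Vec d → ℝ, (∀ i, IsTestFunction (Metric.ball 0 R) (φ i)) ∧
      (∀ x ∈ halfBall d R, ∑ i, partialDeriv i (φ i) x = f x) ∧
      ∀ i j, L2Bound (partialDeriv i (φ j)) (divConst d * M ^ 4 * ∫ x, f x ^ 2) := by
  obtain ⟨q, s, hq, hs, hdiv, bq, bdq, bs, bds⟩ := exists_resolvent hf.smooth hf.hasCompactSupport
  set I := ∫ x, f x ^ 2 with hI
  have hI0 : 0 ≤ I := integral_nonneg fun x => sq_nonneg _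
  have hη1 : ∀ x, |η x| ≤ M := fun x => by
    rw [abs_of_nonneg (hη.nonneg x)]; exact (hη.le_one x).trans hM
  have hζ1 : ∀ x, |ζ x| ≤ M := fun x => by
    rw [abs_of_nonneg (hζ.nonneg x)]; exact (hζ.le_one x).trans hM
  have hηd : ∀ i, ContDiff ℝ ∞ (partialDeriv i η) := partialDeriv_contDiff hη.smooth
  -- the remaining error, smooth and supported in the smaller ball
  set g : Vec d → ℝ := fun x => η x * q x - ∑ i, partialDeriv i η x * s i x with hg
  have hgc : ContDiff ℝ ∞ g :=
    (hη.smooth.mul hq).sub (ContDiff.sum fun i _ => (hηd i).mul (hs i))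
  have hg0 : ∀ x, x ∉ tsupport η → g x = 0 := by
    intro x hx
    have h1 : η x = 0 := image_eq_zero_of_notMem_tsupport hx
    have h2 : ∀ i, partialDeriv i η x = 0 := fun i =>
      image_eq_zero_of_notMem_tsupport fun h => hx (tsupport_partialDeriv_subset i η h)
    simp [hg, h1, h2]
  have hgs : tsupport g ⊆ tsupport η :=
    closure_minimal (fun x hx => by_contra fun h => hx (hg0 x h)) (isClosed_tsupport η)
  have hgcs : HasCompactSupport g := hη.hasCompactSupport.of_isClosed_subset (isClosed_tsupport _) hgs
  have hgd : ∀ a x, partialDeriv a g x = (partialDeriv a η x * q x + η x * partialDeriv a q x)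
      - ∑ i, (partialDeriv a (partialDeriv i η) x * s i x
        + partialDeriv i η x * partialDeriv a (s i) x) := by
    intro a x
    rw [hg, partialDeriv_sub (hη.smooth.mul hq) (ContDiff.sum fun i _ => (hηd i).mul (hs i)),
      partialDeriv_mul hη.smooth hq, partialDeriv_sum _ fun i _ => (hηd i).mul (hs i)]
    simp only [partialDeriv_mul (hηd _) (hs _)]
  have hd0 : (0 : ℝ) ≤ d := by positivity
  set B := (400 * (d + 1) ^ 2) * M ^ 2 * I with hB
  have hMI : 0 ≤ M ^ 2 * I := by positivity
  have bg : L2Bound g B := by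
    have h1 := (bq.mul hη.smooth.continuous hη1).sub
      (L2Bound.sum Finset.univ fun i _ => (bs i).mul (hηd i).continuous (hη.deriv_le i))
    refine h1.mono ?_
    simp only [Finset.card_univ, Fintype.card_fin]
    rw [hB]
    nlinarith [mul_nonneg hd0 hMI, mul_nonneg (mul_nonneg hd0 hd0) hMI]
  have bdg : ∀ a, L2Bound (partialDeriv a g) B := by
    intro a
    have h1 := ((bq.mul (hηd a).continuous (hη.deriv_le a)).add
      ((bdq a).mul hη.smooth.continuous hη1)).sub
      (L2Bound.sum Finset.univ fun i _ =>
        ((bs i).mul (partialDeriv_contDiff (hηd i) a).continuous (hη.deriv2_le a i)).add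
          ((bds a i).mul (hηd i).continuous (hη.deriv_le i)))
    rw [show partialDeriv a g = _ from funext (hgd a)]
    refine h1.mono ?_
    simp only [Finset.card_univ, Fintype.card_fin]
    rw [hB]
    nlinarith [mul_nonneg hd0 hMI, mul_nonneg (mul_nonneg hd0 hd0) hMI]
  -- Length 4 carries every point of the ball of radius R ≤ 2 outside the support of g, so the upper
  -- endpoint contributes nothing.
  set ν := segMeas (0 : Fin d) 4 with hν
  have hνm : ν.real Set.univ = 4 := segMeas_real_univ 0 (by norm_num)
  set w : Vec d → ℝ := fun x => -measConv ν g x with hw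
  have hwc : ContDiff ℝ ∞ w := (measConv_contDiff ν hgc hgcs).neg
  have hwd : ∀ a, partialDeriv a w = fun x => -measConv ν (partialDeriv a g) x := by
    intro a; ext x
    rw [hw, partialDeriv_neg, partialDeriv_measConv ν hgc hgcs]
  have bw : L2Bound w (16 * B) := by
    have := (bg.measConv ν).neg
    rw [hνm] at this
    exact this.mono (by norm_num)
  have bdw : ∀ a, L2Bound (partialDeriv a w) (16 * B) := by
    intro a
    rw [hwd]
    have := ((bdg a).measConv ν).neg
    rw [hνm] at this
    exact this.mono (by norm_num)
  have hgR : ∀ x : Vec d, ρ ≤ ‖x‖ → g x = 0 := fun x hx => hg0 x fun h => by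
    have := hη.tsupport_subset h
    rw [mem_ball_zero_iff] at this
    linarith
  have hwd0 : ∀ x ∈ halfBall d R, partialDeriv 0 w x = g x := by
    intro x hx
    rw [mem_halfBall] at hx
    rw [hwd]
    simp only
    rw [hν, measConv_segMeas_partialDeriv hgc 0 (by norm_num) x, hgR (x + (4 : ℝ) • basisVec 0)]
    · ring
    · have h1 : ‖(4 : ℝ) • (basisVec 0 : Vec d)‖ = 4 := by
        rw [norm_smul, PiLp.norm_single]; norm_num
      have h2 := norm_sub_le (x + (4 : ℝ) • (basisVec 0 : Vec d)) x
      rw [add_sub_cancel_left, h1] at h2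
      linarith [hx.1]
  -- In the half space moving upwards increases the norm, so w vanishes there outside the ball of
  -- radius ρ. The cutoff ζ therefore changes w only where x₁ ≤ 0 and does not disturb the
  -- divergence in the half ball.
  have hw0 : ∀ x : Vec d, 0 < x 0 → ρ ≤ ‖x‖ → w x = 0 := by
    intro x hx0 hx
    simp only [hw]
    rw [hν, measConv_segMeas 0 4 hgc.continuous, setIntegral_eq_zero_of_forall_eq_zero]
    · simp
    · intro t ht
      refine hgR _ (hx.trans ?_)
      rw [EuclideanSpace.norm_eq, EuclideanSpace.norm_eq]
      refine Real.sqrt_le_sqrt (Finset.sum_le_sum fun i _ => ?_)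
      by_cases hi : i = 0
      · subst hi
        simp only [PiLp.add_apply, PiLp.smul_apply, PiLp.single_apply, Real.norm_eq_abs, sq_abs]
        simp
        nlinarith [ht.1]
      · simp [hi]
  have hζd : ∀ i, ContDiff ℝ ∞ (partialDeriv i ζ) := partialDeriv_contDiff hζ.smooth
  have hζw : ∀ a x, partialDeriv a (fun y => ζ y * w y) x
      = partialDeriv a ζ x * w x + ζ x * partialDeriv a w x := fun a x =>
    partialDeriv_mul hζ.smooth hwc a x
  have hηs : ∀ a j x, partialDeriv a (fun y => η y * s j y) x
      = partialDeriv a η x * s j x + η x * partialDeriv a (s j) x := fun a j x =>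
    partialDeriv_mul hη.smooth (hs j) a x
  set φ : Fin d → Vec d → ℝ := fun j x => η x * s j x + (if j = 0 then 1 else 0) * (ζ x * w x)
    with hφ
  have hφd : ∀ a j x, partialDeriv a (φ j) x = (partialDeriv a η x * s j x
      + η x * partialDeriv a (s j) x)
      + (if j = 0 then 1 else 0) * (partialDeriv a ζ x * w x + ζ x * partialDeriv a w x) := by
    intro a j x
    rw [hφ, partialDeriv_add (hη.smooth.mul (hs j)) (contDiff_const.mul (hζ.smooth.mul hwc)),
      partialDeriv_const_mul _ (hζ.smooth.mul hwc), hηs, hζw]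
  have hφs : ∀ j, tsupport (φ j) ⊆ tsupport η ∪ tsupport ζ := by
    intro j
    refine closure_minimal (fun x hx => by_contra fun h => hx ?_)
      ((isClosed_tsupport η).union (isClosed_tsupport ζ))
    rw [Set.mem_union, not_or] at h
    simp [hφ, image_eq_zero_of_notMem_tsupport h.1, image_eq_zero_of_notMem_tsupport h.2]
  refine ⟨φ, fun j => ⟨?_, ?_, ?_⟩, fun x hx => ?_, fun a j => ?_⟩
  · exact (hη.smooth.mul (hs j)).add (contDiff_const.mul (hζ.smooth.mul hwc))
  · exact (hη.hasCompactSupport.union hζ.hasCompactSupport).of_isClosed_subset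
      (isClosed_tsupport _) (hφs j)
  · exact (hφs j).trans (Set.union_subset
      (hη.tsupport_subset.trans (Metric.ball_subset_ball hρ)) hζ.tsupport_subset)
  · simp only [hφd]
    rw [Finset.sum_add_distrib, Finset.sum_add_distrib]
    have h1 : ∑ j : Fin d, (if j = 0 then (1 : ℝ) else 0)
        * (partialDeriv j ζ x * w x + ζ x * partialDeriv j w x)
        = partialDeriv 0 ζ x * w x + ζ x * partialDeriv 0 w x := by
      simp [ite_mul]
    rw [h1, ← Finset.mul_sum, hdiv, hwd0 x hx]
    have h2 : partialDeriv 0 ζ x * w x = 0 := by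
      by_cases hxρ : ‖x‖ < ρ
      · have : ζ =ᶠ[𝓝 x] fun _ => 1 := by
          filter_upwards [Metric.isOpen_ball.mem_nhds (mem_ball_zero_iff.2 hxρ)] with y hy
          exact hζ.eq_one y (mem_ball_zero_iff.1 hy).le
        rw [partialDeriv_congr_of_eventuallyEq this]
        simp [partialDeriv]
      · rw [hw0 x hx.2 (not_lt.1 hxρ), mul_zero]
    have h3 : ζ x * g x = g x := by
      by_cases hxρ : ‖x‖ < ρ
      · rw [hζ.eq_one x hxρ.le, one_mul]
      · rw [hgR x (not_lt.1 hxρ), mul_zero]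
    have h4 : η x * f x = f x := by
      by_cases hxr : x ∈ tsupport f
      · rw [hη.eq_one x (mem_ball_zero_iff.1 (hf.tsupport_subset hxr)).le, one_mul]
      · rw [image_eq_zero_of_notMem_tsupport hxr, mul_zero]
    rw [h2, h3, mul_sub, h4]
    simp only [hg]
    ring
  · have h1 := ((bs j).mul (hηd a).continuous (hη.deriv_le a)).add
      ((bds a j).mul hη.smooth.continuous hη1)
    have h2 := ((bw.mul (hζd a).continuous (hζ.deriv_le a)).add
      ((bdw a).mul hζ.smooth.continuous hζ1)).const_mul (if j = 0 then 1 else 0)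
    have h3 := h1.add h2
    rw [show partialDeriv a (φ j) = _ from funext (hφd a j)]
    refine h3.mono ?_
    have h4 : ((if j = 0 then 1 else 0 : ℝ)) ^ 2 ≤ 1 := by split_ifs <;> norm_num
    have hB0 : 0 ≤ B := by positivity
    have hM2 : 1 ≤ M ^ 2 := one_le_pow₀ hM
    have h5 : M ^ 2 * I ≤ M ^ 4 * I := by
      have : M ^ 2 ≤ M ^ 4 := pow_le_pow_right₀ hM (by norm_num)
      gcongr
    have h6 : M ^ 2 * B = 400 * (d + 1) ^ 2 * (M ^ 4 * I) := by rw [hB]; ring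
    have h7 : (1 : ℝ) ≤ (d + 1) ^ 2 := one_le_pow₀ (by linarith)
    have h8 : 0 ≤ M ^ 4 * I := by positivity
    calc 2 * (2 * (M ^ 2 * (40 * I)) + 2 * (M ^ 2 * (40 * I))) +
          2 * ((if j = 0 then 1 else 0 : ℝ) ^ 2 * (2 * (M ^ 2 * (16 * B)) + 2 * (M ^ 2 * (16 * B))))
        ≤ 2 * (2 * (M ^ 2 * (40 * I)) + 2 * (M ^ 2 * (40 * I))) +
          2 * (1 * (2 * (M ^ 2 * (16 * B)) + 2 * (M ^ 2 * (16 * B)))) := by gcongr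
      _ = 320 * (M ^ 2 * I) + 128 * (M ^ 2 * B) := by ring
      _ ≤ 320 * ((d + 1) ^ 2 * (d + 1) ^ 2 * (M ^ 4 * I))
          + 128 * (400 * ((d + 1) ^ 2 * (d + 1) ^ 2) * (M ^ 4 * I)) := by
        rw [h6]
        have h9 : (1 : ℝ) ≤ (d + 1) ^ 2 * (d + 1) ^ 2 := by nlinarith
        have h10 : ((d : ℝ) + 1) ^ 2 ≤ (d + 1) ^ 2 * (d + 1) ^ 2 := by nlinarith
        have h11 : M ^ 2 * I ≤ (d + 1) ^ 2 * (d + 1) ^ 2 * (M ^ 4 * I) :=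
          h5.trans (le_mul_of_one_le_left h8 h9)
        gcongr
      _ ≤ divConst d * M ^ 4 * I := by
        unfold divConst
        have : 0 ≤ ((d : ℝ) + 1) ^ 4 * (M ^ 4 * I) := by positivity
        nlinarith

/-- Two cutoffs, through the midpoint radius, each contribute M² to the squared norm with M of order
(R - r)⁻⁴; this is the exponent 16. -/
theorem exists_div_corrector (d : ℕ) [NeZero d] : ∃ C : ℝ, 0 ≤ C ∧ ∀ r R : ℝ, 0 ≤ r → r < R →
    R ≤ 2 → ∀ f : Vec d → ℝ, IsTestFunction (Metric.ball 0 r) f →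
    ∃ φ : Fin d → Vec d → ℝ, (∀ i, IsTestFunction (Metric.ball 0 R) (φ i)) ∧
      (∀ x ∈ halfBall d R, ∑ i, partialDeriv i (φ i) x = f x) ∧
      ∀ i j, L2Bound (partialDeriv i (φ j)) (C / (R - r) ^ 16 * ∫ x, f x ^ 2) := by
  obtain ⟨K, hK, hcut⟩ := exists_isCutoff d
  refine ⟨divConst d * (16 * K) ^ 4, by unfold divConst; positivity, fun r R hr hrR hR f hf => ?_⟩
  have hpos : 0 < R - r := by linarith
  obtain ⟨η, hη⟩ := hcut r ((r + R) / 2) hr (by linarith) (by linarith)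
  obtain ⟨ζ, hζ⟩ := hcut ((r + R) / 2) R (by linarith) (by linarith) hR
  have e1 : K / ((r + R) / 2 - r) ^ 4 = 16 * K / (R - r) ^ 4 := by
    rw [show (r + R) / 2 - r = (R - r) / 2 by ring]; field_simp; norm_num
  have e2 : K / (R - (r + R) / 2) ^ 4 = 16 * K / (R - r) ^ 4 := by
    rw [show R - (r + R) / 2 = (R - r) / 2 by ring]; field_simp; norm_num
  rw [e1] at hη
  rw [e2] at hζ
  have hM : 1 ≤ 16 * K / (R - r) ^ 4 := by
    rw [one_le_div (by positivity)]
    have : (R - r) ^ 4 ≤ 2 ^ 4 := pow_le_pow_left₀ hpos.le (by linarith) 4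
    linarith
  obtain ⟨φ, h1, h2, h3⟩ := exists_div_corrector_of_cutoff hM hR hη hζ (by linarith) hf
  refine ⟨φ, h1, h2, fun i j => (h3 i j).mono (le_of_eq ?_)⟩
  field_simp

end Corrector

/-! ### L² pairings and mollification up to the flat boundary -/

section L2Tools

theorem abs_integral_mul_le_sqrt {α : Type*} [MeasurableSpace α] {μ : Measure α} {F G : α → ℝ}
    (hF : MemLp F 2 μ) (hG : MemLp G 2 μ) :
    |∫ x, F x * G x ∂μ| ≤ √(∫ x, F x ^ 2 ∂μ) * √(∫ x, G x ^ 2 ∂μ) := by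
  have h := integral_mul_norm_le_Lp_mul_Lq (μ := μ) (f := F) (g := G) Real.HolderConjugate.two_two
    (by simpa using hF) (by simpa using hG)
  simp only [Real.norm_eq_abs, Real.rpow_ofNat, sq_abs, ← Real.sqrt_eq_rpow] at h
  refine (abs_integral_le_integral_abs).trans ?_
  simpa only [abs_mul] using h

theorem integral_mul_le_of_weight {α : Type*} [MeasurableSpace α] {μ : Measure α} {F G : α → ℝ}
    (hF : MemLp F 2 μ) (hG : MemLp G 2 μ) {k : ℝ} (hk : 0 < k) :
    |∫ x, F x * G x ∂μ| ≤ k / 2 * (∫ x, F x ^ 2 ∂μ) + 1 / (2 * k) * ∫ x, G x ^ 2 ∂μ := by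
  refine (abs_integral_le_integral_abs).trans ?_
  rw [← integral_const_mul, ← integral_const_mul,
    ← integral_add (hF.integrable_sq.const_mul _) (hG.integrable_sq.const_mul _)]
  refine integral_mono (hF.integrable_mul hG).abs
    ((hF.integrable_sq.const_mul _).add (hG.integrable_sq.const_mul _)) fun x => ?_
  simp only
  rw [abs_mul, ← sq_abs (F x), ← sq_abs (G x)]
  have e : k / 2 * |F x| ^ 2 + 1 / (2 * k) * |G x| ^ 2 - |F x| * |G x|
      = (k * |F x| - |G x|) ^ 2 / (2 * k) := by field_simp; ring
  have : 0 ≤ (k * |F x| - |G x|) ^ 2 / (2 * k) := by positivity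
  linarith

theorem integrable_mul_of_memLp {α : Type*} [MeasurableSpace α] {μ : Measure α} {F G : α → ℝ}
    (hF : MemLp F 2 μ) (hG : MemLp G 2 μ) : Integrable (fun x => F x * G x) μ :=
  hF.integrable_mul hG

variable {d : ℕ} [NeZero d]

theorem tendsto_integral_mul_moll {F G : Vec d → ℝ} (hF : MemLp F 2 volume)
    (hG : MemLp G 2 volume) (E : Set (Vec d)) :
    Tendsto (fun n => ∫ x in E, F x * moll n G x) atTop (𝓝 (∫ x in E, F x * G x)) := by
  rw [tendsto_iff_norm_sub_tendsto_zero]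
  have h1 : Tendsto (fun n => √(∫ x, F x ^ 2) * √(∫ x, (moll n G x - G x) ^ 2)) atTop (𝓝 0) := by
    have := ((Real.continuous_sqrt.tendsto 0).comp (moll_tendsto hG)).const_mul (√(∫ x, F x ^ 2))
    simpa [Function.comp_def] using this
  refine squeeze_zero (fun n => norm_nonneg _) (fun n => ?_) h1
  have hm := moll_memLp n hG
  rw [← integral_sub (integrable_mul_of_memLp (hF.restrict E) (hm.restrict E))
    (integrable_mul_of_memLp (hF.restrict E) (hG.restrict E)), Real.norm_eq_abs]
  have h2 := abs_integral_mul_le_sqrt (hF.restrict E) ((hm.sub hG).restrict E)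
  simp only [Pi.sub_apply, mul_sub] at h2
  refine h2.trans ?_
  exact mul_le_mul
    (Real.sqrt_le_sqrt (setIntegral_le_integral hF.integrable_sq (ae_of_all _ fun _ => sq_nonneg _)))
    (Real.sqrt_le_sqrt (setIntegral_le_integral (hm.sub hG).integrable_sq
      (ae_of_all _ fun _ => sq_nonneg _))) (Real.sqrt_nonneg _) (Real.sqrt_nonneg _)

/-- Weak lower semicontinuity of the norm: ∫F² is the limit of ∫F·`moll n F`, which is at most ½∫F²
+ ½B. -/
theorem integral_sq_le_of_moll {F : Vec d → ℝ} (hF : MemLp F 2 volume) (E : Set (Vec d)) {B : ℝ}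
    (h : ∀ᶠ n in atTop, ∫ x in E, moll n F x ^ 2 ≤ B) : ∫ x in E, F x ^ 2 ≤ B := by
  have h1 := tendsto_integral_mul_moll hF hF E
  have h2 : ∫ x in E, F x * F x ≤ 1 / 2 * (∫ x in E, F x ^ 2) + 1 / 2 * B := by
    refine le_of_tendsto h1 ?_
    filter_upwards [h] with n hn
    have := integral_mul_le_of_weight (hF.restrict E) ((moll_memLp n hF).restrict E) one_pos
    have := (le_abs_self _).trans this
    norm_num at this ⊢
    linarith
  have h3 : ∫ x in E, F x * F x = ∫ x in E, F x ^ 2 := by simp only [sq]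
  rw [h3] at h2
  linarith

theorem moll_eq_zero_of_ball {F : Vec d → ℝ} {n : ℕ} {x : Vec d}
    (h : ∀ y ∈ Metric.closedBall (x + (2 * molScale n) • (basisVec 0 : Vec d)) (molScale n),
      F y = 0) : moll n F x = 0 := by
  rw [moll_eq_integral_molTest]
  refine integral_eq_zero_of_ae (ae_of_all _ fun y => ?_)
  by_cases hy : y ∈ tsupport (molTest n x)
  · simp [h y (tsupport_molTest_subset n x hy)]
  · simp [image_eq_zero_of_notMem_tsupport hy]

theorem norm_shift (n : ℕ) : ‖(2 * molScale n) • (basisVec 0 : Vec d)‖ = 2 * molScale n := by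
  rw [norm_smul, PiLp.norm_single]
  have := molScale_pos n
  simp [abs_of_pos this]

theorem abs_norm_sub_le_of_mem_stencil {n : ℕ} {x y : Vec d}
    (h : y ∈ Metric.closedBall (x + (2 * molScale n) • (basisVec 0 : Vec d)) (molScale n)) :
    ‖y - x‖ ≤ 3 * molScale n := by
  rw [mem_closedBall_iff_norm] at h
  have h1 : y - x = (y - (x + (2 * molScale n) • (basisVec 0 : Vec d)))
    + (2 * molScale n) • (basisVec 0 : Vec d) := by abel
  have h2 := norm_add_le (y - (x + (2 * molScale n) • (basisVec 0 : Vec d)))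
    ((2 * molScale n) • (basisVec 0 : Vec d))
  rw [← h1, norm_shift] at h2
  linarith

theorem lt_coord_of_mem_stencil {n : ℕ} {x y : Vec d}
    (h : y ∈ Metric.closedBall (x + (2 * molScale n) • (basisVec 0 : Vec d)) (molScale n)) :
    x 0 < y 0 := by
  rw [mem_closedBall_iff_norm] at h
  have h1 := (PiLp.norm_apply_le (y - (x + (2 * molScale n) • (basisVec 0 : Vec d))) 0).trans h
  simp only [PiLp.sub_apply, PiLp.add_apply, PiLp.smul_apply, PiLp.single_apply, if_true,
    smul_eq_mul, mul_one, Real.norm_eq_abs] at h1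
  have := (abs_le.1 h1).1
  have := molScale_pos n
  linarith

/-- The reason for the shift of the kernel: the ball that enters the mollification lies strictly
above x, so even at points of the flat boundary only values inside the half ball are used. -/
theorem stencil_subset_halfBall {n : ℕ} {x : Vec d} {r R : ℝ} (hx : ‖x‖ < r) (hx0 : 0 ≤ x 0)
    (hn : r + 3 * molScale n ≤ R) :
    Metric.closedBall (x + (2 * molScale n) • (basisVec 0 : Vec d)) (molScale n) ⊆ halfBall d R := by
  intro y hy
  rw [mem_halfBall]
  refine ⟨?_, hx0.trans_lt (lt_coord_of_mem_stencil hy)⟩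
  have h1 := abs_norm_sub_le_of_mem_stencil hy
  have h2 := norm_le_norm_sub_add y x
  linarith

theorem eventually_molScale {r R : ℝ} (h : r < R) : ∀ᶠ n in atTop, r + 3 * molScale n ≤ R := by
  have h1 : Tendsto (fun n => r + 3 * molScale n) atTop (𝓝 (r + 3 * 0)) :=
    (molScale_tendsto.const_mul 3).const_add r
  rw [mul_zero, add_zero] at h1
  exact h1.eventually_le_const h

theorem integral_moll_sq_le {F : Vec d → ℝ} (hF : MemLp F 2 volume) {r R : ℝ} {n : ℕ}
    (hn : r + 3 * molScale n ≤ R) :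
    ∫ x in halfBall d r, moll n F x ^ 2 ≤ ∫ x in halfBall d R, F x ^ 2 := by
  have := integral_measConv_sq_le (molMeas d n) hF (measurableSet_halfBall r)
    (measurableSet_halfBall R) ?_
  · simpa [moll] using this
  · filter_upwards [ae_molMeas n] with t ht x hx
    rw [mem_halfBall] at hx
    refine stencil_subset_halfBall hx.1 hx.2.le hn ?_
    rw [mem_closedBall_iff_norm]
    rw [mem_ball_iff_norm, ← norm_neg] at ht
    rw [show x - t - (x + (2 * molScale n) • (basisVec 0 : Vec d)) =
      -(t - -((2 * molScale n) • (basisVec 0 : Vec d))) by abel]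
    exact ht.le

end L2Tools

/-! ### Solutions in components and the pressure estimate -/

section Fields

variable {d : ℕ}

theorem IsTestFunction.mono {Ω Ω' : Set (Vec d)} (h : Ω ⊆ Ω') {φ : Vec d → ℝ}
    (hφ : IsTestFunction Ω φ) : IsTestFunction Ω' φ :=
  ⟨hφ.smooth, hφ.hasCompactSupport, hφ.tsupport_subset.trans h⟩

/-- The square of the `L²` norm of a matrix valued function. -/
def gradSq (E : Set (Vec d)) (D : Fin d → Fin d → Vec d → ℝ) : ℝ :=
  ∑ β, ∑ j, ∫ x in E, D β j x ^ 2

theorem gradSq_nonneg (E : Set (Vec d)) (D : Fin d → Fin d → Vec d → ℝ) : 0 ≤ gradSq E D :=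
  Finset.sum_nonneg fun _ _ => Finset.sum_nonneg fun _ _ => integral_nonneg fun _ => sq_nonneg _

theorem setIntegral_sq_mono {F : Vec d → ℝ} (hF : MemLp F 2 volume) {E E' : Set (Vec d)}
    (h : E ⊆ E') : ∫ x in E, F x ^ 2 ≤ ∫ x in E', F x ^ 2 :=
  setIntegral_mono_set hF.integrable_sq.integrableOn (ae_of_all _ fun _ => sq_nonneg _)
    h.eventuallyLE

theorem integral_sum_sum_sq {D : Fin d → Fin d → Vec d → ℝ}
    (hD : ∀ β j, MemLp (D β j) 2 volume) (E : Set (Vec d)) :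
    ∫ x in E, ∑ β, ∑ j, D β j x ^ 2 = gradSq E D := by
  have hi : ∀ β j, Integrable (fun x => D β j x ^ 2) (volume.restrict E) := fun β j =>
    ((hD β j).restrict E).integrable_sq
  rw [integral_finsetSum _ fun β _ => integrable_finsetSum _ fun j _ => hi β j]
  refine Finset.sum_congr rfl fun β _ => ?_
  rw [integral_finsetSum _ fun j _ => hi β j]

theorem IsTestFunction.memLp {Ω : Set (Vec d)} {φ : Vec d → ℝ} (hφ : IsTestFunction Ω φ) :
    MemLp φ 2 volume := hφ.smooth.continuous.memLp_of_hasCompactSupport hφ.hasCompactSupport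

theorem IsTestFunction.partialDeriv_memLp {Ω : Set (Vec d)} {φ : Vec d → ℝ}
    (hφ : IsTestFunction Ω φ) (i : Fin d) : MemLp (partialDeriv i φ) 2 volume :=
  (partialDeriv_contDiff hφ.smooth i).continuous.memLp_of_hasCompactSupport
    (hasCompactSupport_partialDeriv hφ.hasCompactSupport i)

theorem partialDeriv_eq_zero_of_notMem {Ω : Set (Vec d)} {φ : Vec d → ℝ}
    (hφ : IsTestFunction Ω φ) (i : Fin d) {x : Vec d} (hx : x ∉ Ω) : partialDeriv i φ x = 0 :=
  image_eq_zero_of_notMem_tsupport fun h =>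
    hx (hφ.tsupport_subset (tsupport_partialDeriv_subset i φ h))

theorem gradSq_mono {D : Fin d → Fin d → Vec d → ℝ} (hD : ∀ β j, MemLp (D β j) 2 volume)
    {E E' : Set (Vec d)} (h : E ⊆ E') : gradSq E D ≤ gradSq E' D :=
  Finset.sum_le_sum fun β _ => Finset.sum_le_sum fun j _ => setIntegral_sq_mono (hD β j) h

end Fields

section Solutions

variable {d : ℕ} [NeZero d]

/-- The components of `A^{αβ} D_β u`. -/
def flux (A : Coeff d) (D : Fin d → Fin d → Vec d → ℝ) (α i : Fin d) (x : Vec d) : ℝ :=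
  ∑ β, ∑ j, A (x 0) α β i j * D β j x

/-- The components of `A^{αβ} D_β u + p e_α`. -/
def stress (A : Coeff d) (D : Fin d → Fin d → Vec d → ℝ) (p : Vec d → ℝ) (α i : Fin d)
    (x : Vec d) : ℝ := flux A D α i x + (if α = i then 1 else 0) * p x

/-- The upper half space. -/
def halfSpace (d : ℕ) [NeZero d] : Set (Vec d) := {x | 0 < x 0}

theorem measurableSet_halfSpace : MeasurableSet (halfSpace d) :=
  (isOpen_lt continuous_const
    (EuclideanSpace.proj (0 : Fin d) : Vec d →L[ℝ] ℝ).continuous).measurableSet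

theorem halfBall_subset_halfSpace (r : ℝ) : halfBall d r ⊆ halfSpace d := fun _ hx => hx.2

/-- Solutions of the conormal problem for the Stokes system, in components and with smooth test
functions. All functions are square integrable on the whole space. -/
structure Sol (A : Coeff d) (R : ℝ) (u : Fin d → Vec d → ℝ) (D : Fin d → Fin d → Vec d → ℝ)
    (p : Vec d → ℝ) : Prop where
  u_mem : ∀ j, MemLp (u j) 2 volume
  D_mem : ∀ β j, MemLp (D β j) 2 volume
  p_mem : MemLp p 2 volume
  weak : ∀ β j φ, IsTestFunction (halfBall d R) φ →
    ∫ x, u j x * partialDeriv β φ x = -∫ x, D β j x * φ x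
  div_eq : ∀ᵐ x, x ∈ halfBall d R → ∑ i, D i i x = 0
  eq : ∀ φ : Fin d → Vec d → ℝ, (∀ i, IsTestFunction (Metric.ball 0 R) (φ i)) →
    ∫ x in halfSpace d, ∑ α, ∑ i, stress A D p α i x * partialDeriv α (φ i) x = 0

theorem Sol.mono {A : Coeff d} {r R : ℝ} {u : Fin d → Vec d → ℝ} {D : Fin d → Fin d → Vec d → ℝ}
    {p : Vec d → ℝ} (hS : Sol A R u D p) (h : r ≤ R) : Sol A r u D p where
  u_mem := hS.u_mem
  D_mem := hS.D_mem
  p_mem := hS.p_mem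
  weak β j φ hφ := hS.weak β j φ (hφ.mono (halfBall_mono h))
  div_eq := by
    filter_upwards [hS.div_eq] with x hx hxr using hx (halfBall_mono h hxr)
  eq φ hφ := hS.eq φ fun i => (hφ i).mono (Metric.ball_subset_ball h)

theorem aemeasurable_coeff {A : Coeff d} {δ : ℝ} (hA : IsStronglyElliptic δ A) (α β i j : Fin d) :
    AEMeasurable (fun x : Vec d => A (x 0) α β i j) volume := by
  have h1 : Measure.QuasiMeasurePreserving (fun x : Vec d => x 0) volume volume := by
    have h2 := (Measure.quasiMeasurePreserving_eval (fun _ : Fin d => (volume : Measure ℝ)) 0)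
    exact h2.comp (PiLp.volume_preserving_ofLp (Fin d)).quasiMeasurePreserving
  exact (hA.aemeasurable α β i j).comp_quasiMeasurePreserving h1

theorem coeff_mul_memLp {A : Coeff d} {δ : ℝ} (hA : IsStronglyElliptic δ A) (α β i j : Fin d)
    {F : Vec d → ℝ} (hF : MemLp F 2 volume) :
    MemLp (fun x => A (x 0) α β i j * F x) 2 volume := by
  refine MemLp.of_le_mul (c := δ⁻¹) hF
    ((aemeasurable_coeff hA α β i j).aestronglyMeasurable.mul hF.1) (ae_of_all _ fun x => ?_)
  rw [norm_mul]
  exact mul_le_mul_of_nonneg_right (hA.bounded _ _ _ _ _) (norm_nonneg _)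

theorem flux_memLp {A : Coeff d} {δ : ℝ} (hA : IsStronglyElliptic δ A)
    {D : Fin d → Fin d → Vec d → ℝ} (hD : ∀ β j, MemLp (D β j) 2 volume) (α i : Fin d) :
    MemLp (flux A D α i) 2 volume :=
  memLp_finsetSum _ fun β _ => memLp_finsetSum _ fun j _ => coeff_mul_memLp hA α β i j (hD β j)

theorem stress_memLp {A : Coeff d} {δ : ℝ} (hA : IsStronglyElliptic δ A)
    {D : Fin d → Fin d → Vec d → ℝ} (hD : ∀ β j, MemLp (D β j) 2 volume) {p : Vec d → ℝ}
    (hp : MemLp p 2 volume) (α i : Fin d) : MemLp (stress A D p α i) 2 volume :=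
  (flux_memLp hA hD α i).add (hp.const_mul _)

theorem flux_sq_le {A : Coeff d} {δ : ℝ} (hA : IsStronglyElliptic δ A)
    (D : Fin d → Fin d → Vec d → ℝ) (α i : Fin d) (x : Vec d) :
    flux A D α i x ^ 2 ≤ d ^ 2 * (δ⁻¹) ^ 2 * ∑ β, ∑ j, D β j x ^ 2 := by
  unfold flux
  calc (∑ β, ∑ j, A (x 0) α β i j * D β j x) ^ 2
      ≤ d * ∑ β, (∑ j, A (x 0) α β i j * D β j x) ^ 2 := by
        simpa using sq_sum_le_card_mul_sum_sq (s := (Finset.univ : Finset (Fin d)))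
          (f := fun β => ∑ j, A (x 0) α β i j * D β j x)
    _ ≤ d * ∑ β, (d * ∑ j, (A (x 0) α β i j * D β j x) ^ 2) := by
        gcongr with β _
        simpa using sq_sum_le_card_mul_sum_sq (s := (Finset.univ : Finset (Fin d)))
          (f := fun j => A (x 0) α β i j * D β j x)
    _ ≤ d * ∑ β, (d * ∑ j, (δ⁻¹) ^ 2 * D β j x ^ 2) := by
        gcongr with β _ j _
        rw [mul_pow]
        refine mul_le_mul_of_nonneg_right ?_ (sq_nonneg _)
        exact sq_le_sq' (abs_le.1 (hA.bounded _ _ _ _ _)).1 (abs_le.1 (hA.bounded _ _ _ _ _)).2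
    _ = _ := by
        simp only [← Finset.mul_sum]; ring

theorem integral_flux_sq_le {A : Coeff d} {δ : ℝ} (hA : IsStronglyElliptic δ A)
    {D : Fin d → Fin d → Vec d → ℝ} (hD : ∀ β j, MemLp (D β j) 2 volume) (α i : Fin d)
    (E : Set (Vec d)) :
    ∫ x in E, flux A D α i x ^ 2 ≤ d ^ 2 * (δ⁻¹) ^ 2 * gradSq E D := by
  rw [← integral_sum_sum_sq hD E, ← integral_const_mul]
  refine integral_mono ((flux_memLp hA hD α i).restrict E).integrable_sq ?_
    fun x => flux_sq_le hA D α i x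
  exact (integrable_finsetSum _ fun β _ => integrable_finsetSum _ fun j _ =>
    ((hD β j).restrict E).integrable_sq).const_mul _

theorem integral_stress_sq_le {A : Coeff d} {δ : ℝ} (hA : IsStronglyElliptic δ A)
    {D : Fin d → Fin d → Vec d → ℝ} (hD : ∀ β j, MemLp (D β j) 2 volume) {p : Vec d → ℝ}
    (hp : MemLp p 2 volume) (α i : Fin d) (E : Set (Vec d)) :
    ∫ x in E, stress A D p α i x ^ 2
      ≤ 2 * (d ^ 2 * (δ⁻¹) ^ 2 * gradSq E D) + 2 * ∫ x in E, p x ^ 2 := by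
  have i1 := ((flux_memLp hA hD α i).restrict E).integrable_sq
  have i2 := (hp.restrict E).integrable_sq
  calc ∫ x in E, stress A D p α i x ^ 2
      ≤ ∫ x in E, (2 * flux A D α i x ^ 2 + 2 * p x ^ 2) := by
        refine integral_mono ((stress_memLp hA hD hp α i).restrict E).integrable_sq
          ((i1.const_mul 2).add (i2.const_mul 2)) fun x => ?_
        simp only [stress]
        split_ifs
        · nlinarith [sq_nonneg (flux A D α i x - p x)]
        · nlinarith [sq_nonneg (p x), sq_nonneg (flux A D α i x)]
    _ = 2 * (∫ x in E, flux A D α i x ^ 2) + 2 * ∫ x in E, p x ^ 2 := by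
        rw [integral_add (i1.const_mul 2) (i2.const_mul 2), integral_const_mul, integral_const_mul]
    _ ≤ _ := by linarith [integral_flux_sq_le hA hD α i E]

theorem sum_stress_mul (A : Coeff d) (D : Fin d → Fin d → Vec d → ℝ) (p : Vec d → ℝ) (x : Vec d)
    (Φ : Fin d → Fin d → ℝ) :
    ∑ α, ∑ i, stress A D p α i x * Φ α i
      = ∑ α, ∑ i, flux A D α i x * Φ α i + p x * ∑ i, Φ i i := by
  simp only [stress, add_mul, Finset.sum_add_distrib]
  congr 1
  rw [Finset.mul_sum]
  refine Finset.sum_congr rfl fun α _ => ?_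
  simp

theorem setIntegral_halfSpace_eq {R : ℝ} {f : Vec d → ℝ} (h : ∀ x ∉ Metric.ball (0 : Vec d) R,
    f x = 0) : ∫ x in halfSpace d, f x = ∫ x in halfBall d R, f x := by
  refine (setIntegral_eq_of_subset_of_forall_sdiff_eq_zero measurableSet_halfSpace
    (halfBall_subset_halfSpace R) fun x hx => h x fun hb => hx.2 ⟨hb, hx.1⟩)

theorem integral_halfBall_pressure {A : Coeff d} {δ : ℝ} (hA : IsStronglyElliptic δ A) {R : ℝ}
    {u : Fin d → Vec d → ℝ} {D : Fin d → Fin d → Vec d → ℝ} {p : Vec d → ℝ} (hS : Sol A R u D p)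
    {φ : Fin d → Vec d → ℝ} (hφ : ∀ i, IsTestFunction (Metric.ball 0 R) (φ i)) :
    ∫ x in halfBall d R, p x * ∑ i, partialDeriv i (φ i) x
      = -∑ α, ∑ i, ∫ x in halfBall d R, flux A D α i x * partialDeriv α (φ i) x := by
  have h := hS.eq φ hφ
  rw [setIntegral_halfSpace_eq (R := R)] at h
  swap
  · intro x hx
    simp [partialDeriv_eq_zero_of_notMem (hφ _) _ hx]
  simp only [sum_stress_mul] at h
  have hi : ∀ α i, Integrable (fun x => flux A D α i x * partialDeriv α (φ i) x)
      (volume.restrict (halfBall d R)) := fun α i =>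
    ((flux_memLp hA hS.D_mem α i).restrict _).integrable_mul
      (((hφ i).partialDeriv_memLp α).restrict _)
  rw [integral_add (integrable_finsetSum _ fun α _ => integrable_finsetSum _ fun i _ => hi α i)
    (integrable_mul_of_memLp (hS.p_mem.restrict _) (memLp_finsetSum _ fun i _ =>
      ((hφ i).partialDeriv_memLp i).restrict _)),
    integral_finsetSum _ fun α _ => integrable_finsetSum _ fun i _ => hi α i] at h
  simp_rw [integral_finsetSum _ fun i _ => hi _ i] at h
  linarith

/-- Duality: a test field whose divergence is the mollified restriction of p to the smaller half
ball turns ∫p² into a pairing of the flux with ∇φ. The norm of ∇φ is controlled by that of p, and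
this part is absorbed. -/
theorem exists_pressure_bound (d : ℕ) [NeZero d] {δ : ℝ} (hδ : 0 < δ) : ∃ C : ℝ, 0 ≤ C ∧
    ∀ (A : Coeff d), IsStronglyElliptic δ A → ∀ (r R : ℝ), 0 ≤ r → r < R → R ≤ 2 →
    ∀ u D p, Sol A R u D p →
      ∫ x in halfBall d r, p x ^ 2 ≤ C / (R - r) ^ 16 * gradSq (halfBall d R) D := by
  obtain ⟨C, hC0, hC⟩ := exists_div_corrector d
  refine ⟨2 ^ 16 * (d ^ 2 * (C + 1)) * (d ^ 2 * (d ^ 2 * (δ⁻¹) ^ 2)), by positivity, ?_⟩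
  intro A hA r R hr hrR hR u D p hS
  have hd : (0 : ℝ) < d := Nat.cast_pos.2 (Nat.pos_of_ne_zero (NeZero.ne d))
  set ρ := (r + R) / 2 with hρ
  have hRρ : 0 < R - ρ := by rw [hρ]; linarith
  set P : Vec d → ℝ := (halfBall d r).indicator p with hP
  have hPm : MemLp P 2 volume := hS.p_mem.indicator (measurableSet_halfBall r)
  have hPP : ∫ x, P x ^ 2 = ∫ x in halfBall d r, p x ^ 2 := by
    rw [← integral_indicator (measurableSet_halfBall r)]
    congr 1; ext x
    by_cases hx : x ∈ halfBall d r <;> simp [hP, hx]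
  have hpP : ∫ x in halfBall d R, p x * P x = ∫ x in halfBall d r, p x ^ 2 := by
    rw [setIntegral_eq_of_subset_of_forall_sdiff_eq_zero (f := fun x => p x * P x)
      (measurableSet_halfBall R) (halfBall_mono hrR.le) fun x hx => by simp [hP, hx.2]]
    refine setIntegral_congr_fun (measurableSet_halfBall r) fun x hx => ?_
    simp [hP, hx, sq]
  -- The weight in Young's inequality: the d² contributions of ∇φ then add up to at most ½∫P². Using
  -- C + 1 keeps the weight positive when C = 0.
  set k := d ^ 2 * (C + 1) / (R - ρ) ^ 16 with hk
  have hk0 : 0 < k := by positivity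
  have key : ∫ x in halfBall d R, p x * P x ≤
      k / 2 * (∑ α, ∑ i, ∫ x in halfBall d R, flux A D α i x ^ 2) + 1 / 2 * ∫ x, P x ^ 2 := by
    refine le_of_tendsto (tendsto_integral_mul_moll hS.p_mem hPm (halfBall d R)) ?_
    filter_upwards [eventually_molScale (show r < (r + ρ) / 2 by rw [hρ]; linarith)] with n hn
    have hf0 : ∀ x, x ∉ Metric.closedBall (0 : Vec d) (r + 3 * molScale n) → moll n P x = 0 := by
      intro x hx
      refine moll_eq_zero_of_ball fun y hy => ?_
      have : y ∉ halfBall d r := by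
        intro hyr
        rw [mem_halfBall] at hyr
        apply hx
        rw [mem_closedBall_zero_iff]
        have h1 := abs_norm_sub_le_of_mem_stencil hy
        have h2 := norm_le_norm_sub_add x y
        rw [norm_sub_rev] at h2
        linarith [hyr.1]
      simp [hP, this]
    have hfs : tsupport (moll n P) ⊆ Metric.closedBall (0 : Vec d) (r + 3 * molScale n) :=
      closure_minimal (fun x hx => by_contra fun h => hx (hf0 x h)) Metric.isClosed_closedBall
    have hf : IsTestFunction (Metric.ball 0 ρ) (moll n P) :=
      ⟨moll_contDiff n hPm, (isCompact_closedBall _ _).of_isClosed_subset (isClosed_tsupport _) hfs,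
        hfs.trans (Metric.closedBall_subset_ball (by linarith))⟩
    obtain ⟨φ, hφ, hdiv, hbd⟩ := hC ρ R (by linarith) (by linarith) hR _ hf
    have e1 : ∫ x in halfBall d R, p x * moll n P x
        = ∫ x in halfBall d R, p x * ∑ i, partialDeriv i (φ i) x :=
      setIntegral_congr_fun (measurableSet_halfBall R) fun x hx => by
        simp only [hdiv x hx]
    have hfP : ∫ x, moll n P x ^ 2 ≤ ∫ x, P x ^ 2 := by
      simpa [moll] using ((⟨hPm, le_rfl⟩ : L2Bound P _).measConv (molMeas d n)).le
    have e2 : ∀ α i, -∫ x in halfBall d R, flux A D α i x * partialDeriv α (φ i) x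
        ≤ k / 2 * (∫ x in halfBall d R, flux A D α i x ^ 2)
          + 1 / (2 * k) * (C / (R - ρ) ^ 16 * ∫ x, P x ^ 2) := by
      intro α i
      have h1 := integral_mul_le_of_weight ((flux_memLp hA hS.D_mem α i).restrict (halfBall d R))
        (((hφ i).partialDeriv_memLp α).restrict (halfBall d R)) hk0
      have h2 : ∫ x in halfBall d R, partialDeriv α (φ i) x ^ 2
          ≤ C / (R - ρ) ^ 16 * ∫ x, P x ^ 2 := by
        refine (setIntegral_le_integral ((hφ i).partialDeriv_memLp α).integrable_sq
          (ae_of_all _ fun x => sq_nonneg _)).trans ((hbd α i).le.trans ?_)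
        exact mul_le_mul_of_nonneg_left hfP (by positivity)
      refine (neg_le_abs _).trans (h1.trans ?_)
      gcongr
    rw [e1, integral_halfBall_pressure hA hS hφ, ← Finset.sum_neg_distrib]
    simp_rw [← Finset.sum_neg_distrib]
    refine (Finset.sum_le_sum fun α _ => Finset.sum_le_sum fun i _ => e2 α i).trans ?_
    simp only [Finset.sum_add_distrib, ← Finset.mul_sum, Finset.sum_const, Finset.card_univ,
      Fintype.card_fin, nsmul_eq_mul]
    have hX : 0 ≤ ∫ x, P x ^ 2 := integral_nonneg fun x => sq_nonneg _
    have e3 : 1 / (2 * k) * (C / (R - ρ) ^ 16 * (d * (d * ∫ x, P x ^ 2)))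
        = C / (C + 1) * (1 / 2 * ∫ x, P x ^ 2) := by
      rw [hk]; field_simp
    rw [e3]
    have e4 : C / (C + 1) ≤ 1 := (div_le_one (by linarith)).2 (by linarith)
    have : C / (C + 1) * (1 / 2 * ∫ x, P x ^ 2) ≤ 1 * (1 / 2 * ∫ x, P x ^ 2) := by gcongr
    linarith
  rw [hpP, hPP] at key
  have h1 : ∑ α, ∑ i, ∫ x in halfBall d R, flux A D α i x ^ 2
      ≤ d ^ 2 * (d ^ 2 * (δ⁻¹) ^ 2 * gradSq (halfBall d R) D) := by
    calc _ ≤ ∑ _α : Fin d, ∑ _i : Fin d, (d ^ 2 * (δ⁻¹) ^ 2 * gradSq (halfBall d R) D) :=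
          Finset.sum_le_sum fun α _ => Finset.sum_le_sum fun i _ =>
            integral_flux_sq_le hA hS.D_mem α i _
      _ = _ := by simp; ring
  have h2 : k = 2 ^ 16 * (d ^ 2 * (C + 1)) / (R - r) ^ 16 := by
    rw [hk, show R - ρ = (R - r) / 2 by rw [hρ]; ring, div_pow]
    field_simp
  calc ∫ x in halfBall d r, p x ^ 2
      ≤ k * (∑ α, ∑ i, ∫ x in halfBall d R, flux A D α i x ^ 2) := by linarith
    _ ≤ k * (d ^ 2 * (d ^ 2 * (δ⁻¹) ^ 2 * gradSq (halfBall d R) D)) := by gcongr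
    _ = _ := by rw [h2]; ring

end Solutions

/-! ### The Caccioppoli inequality up to the flat boundary -/

section Iteration

/-- Absorption by iteration on a sequence of radii. -/
theorem le_of_forall_le_half_add {F : ℝ → ℝ} {r R B : ℝ} (hrR : r < R) (hB : 0 ≤ B)
    (hmono : ∀ s, s ≤ R → F s ≤ F R)
    (h : ∀ s t, r ≤ s → s < t → t ≤ R → F s ≤ 1 / 2 * F t + B / (t - s) ^ 24) :
    F r ≤ 4 * 72 ^ 24 * B / (R - r) ^ 24 := by
  -- The gaps between successive radii shrink by the factor τ, with τ⁻²⁴ ≤ 3/2. The factor 1/2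
  -- gained at each step beats this growth: the errors form a series of ratio 3/4 and sum 4.
  set τ : ℝ := 71 / 72 with hτ
  set l := R - r with hl
  have hl0 : 0 < l := by rw [hl]; linarith
  set ρ : ℕ → ℝ := fun k => R - l * τ ^ k with hρ
  have hρ0 : ρ 0 = r := by simp [hρ, hl]
  have hτ0 : 0 < τ := by norm_num [hτ]
  have hτ1 : τ < 1 := by norm_num [hτ]
  have hdiff : ∀ k, ρ (k + 1) - ρ k = l * τ ^ k / 72 := fun k => by
    simp only [hρ, pow_succ, hτ]; ring
  have hle : ∀ k, ρ k ≤ R := fun k => by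
    have : 0 ≤ l * τ ^ k := by positivity
    simp only [hρ]; linarith
  have hge : ∀ k, r ≤ ρ k := fun k => by
    have : l * τ ^ k ≤ l * 1 := by
      gcongr; exact pow_le_one₀ hτ0.le hτ1.le
    simp only [hρ]; linarith
  set D := 72 ^ 24 * B / l ^ 24 with hD
  have hD0 : 0 ≤ D := by positivity
  have hstep : ∀ k, F (ρ k) ≤ 1 / 2 * F (ρ (k + 1)) + D * (3 / 2) ^ k := by
    intro k
    have hpos : 0 < ρ (k + 1) - ρ k := by rw [hdiff]; positivity
    have h1 := h (ρ k) (ρ (k + 1)) (hge k) (by linarith) (hle _)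
    rw [hdiff] at h1
    have h2 : B / (l * τ ^ k / 72) ^ 24 = D * ((τ ^ 24)⁻¹) ^ k := by
      rw [hD, div_pow, mul_pow, ← pow_mul, mul_comm k 24, pow_mul, inv_pow]
      field_simp
    have h3 : (τ ^ 24)⁻¹ ≤ 3 / 2 := by rw [hτ]; norm_num
    have h4 : ((τ ^ 24)⁻¹) ^ k ≤ (3 / 2) ^ k := pow_le_pow_left₀ (by positivity) h3 k
    rw [h2] at h1
    have := mul_le_mul_of_nonneg_left h4 hD0
    linarith
  have hind : ∀ k, F r ≤ (1 / 2) ^ k * F (ρ k) + 4 * D * (1 - (3 / 4) ^ k) := by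
    intro k
    induction k with
    | zero => simp [hρ0]
    | succ k ih =>
      have h1 := mul_le_mul_of_nonneg_left (hstep k) (by positivity : (0 : ℝ) ≤ (1 / 2) ^ k)
      have h2 : (1 / 2 : ℝ) ^ k * (D * (3 / 2) ^ k) = D * (3 / 4) ^ k := by
        rw [mul_left_comm, ← mul_pow]; norm_num
      rw [mul_add, h2] at h1
      rw [pow_succ, pow_succ (3 / 4 : ℝ)]
      linarith
  have hlim : Tendsto (fun k : ℕ => (1 / 2 : ℝ) ^ k * F R + 4 * D) atTop (𝓝 (0 * F R + 4 * D)) :=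
    ((tendsto_pow_atTop_nhds_zero_of_lt_one (by norm_num) (by norm_num)).mul_const _).add_const _
  have := ge_of_tendsto' hlim fun k => (hind k).trans (by
    have h1 := mul_le_mul_of_nonneg_left (hmono _ (hle k)) (by positivity : (0 : ℝ) ≤ (1 / 2) ^ k)
    have h2 : 0 ≤ D * (3 / 4) ^ k := by positivity
    linarith)
  rw [zero_mul, zero_add] at this
  calc F r ≤ 4 * D := this
    _ = _ := by rw [hD]; ring

end Iteration

section Preliminaries

variable {d : ℕ}

theorem memLp_mul_of_hasCompactSupport {F h : Vec d → ℝ} (hF : MemLp F 2 volume)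
    (hh : Continuous h) (hc : HasCompactSupport h) : MemLp (fun x => h x * F x) 2 volume := by
  obtain ⟨M, hM⟩ := hh.bounded_above_of_compact_support hc
  exact ((⟨hF, le_rfl⟩ : L2Bound F _).mul hh hM).memLp

/-- The square of the `L²` norm of a vector field. -/
def vecSq (E : Set (Vec d)) (u : Fin d → Vec d → ℝ) : ℝ := ∑ j, ∫ x in E, u j x ^ 2

theorem vecSq_nonneg (E : Set (Vec d)) (u : Fin d → Vec d → ℝ) : 0 ≤ vecSq E u :=
  Finset.sum_nonneg fun _ _ => integral_nonneg fun _ => sq_nonneg _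

theorem vecSq_mono {u : Fin d → Vec d → ℝ} (hu : ∀ j, MemLp (u j) 2 volume)
    {E E' : Set (Vec d)} (h : E ⊆ E') : vecSq E u ≤ vecSq E' u :=
  Finset.sum_le_sum fun j _ => setIntegral_sq_mono (hu j) h

/-- The difference quotient in the direction `e_i` with step `h`. -/
def diffQ (i : Fin d) (h : ℝ) (F : Vec d → ℝ) (x : Vec d) : ℝ :=
  h⁻¹ * (F (x + h • basisVec i) - F x)

theorem diffQ_memLp (i : Fin d) (h : ℝ) {F : Vec d → ℝ} (hF : MemLp F 2 volume) :
    MemLp (diffQ i h F) 2 volume := ((memLp_comp_add hF _).sub hF).const_mul _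

theorem norm_smul_basisVec (i : Fin d) {h : ℝ} (hh : 0 ≤ h) : ‖h • (basisVec i : Vec d)‖ = h := by
  rw [norm_smul, PiLp.norm_single]
  simp [abs_of_nonneg hh]

theorem IsTestFunction.comp_add {Ω Ω' : Set (Vec d)} {φ : Vec d → ℝ} (hφ : IsTestFunction Ω φ)
    (v : Vec d) (h : ∀ x, x + v ∈ Ω → x ∈ Ω') : IsTestFunction Ω' (fun x => φ (x + v)) where
  smooth := hφ.smooth.comp (contDiff_id.add contDiff_const)
  hasCompactSupport := hφ.hasCompactSupport.comp_homeomorph (Homeomorph.addRight v)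
  tsupport_subset := by
    intro x hx
    refine h x (hφ.tsupport_subset ?_)
    have := tsupport_comp_subset_preimage φ (f := fun x : Vec d => x + v) (by fun_prop) hx
    exact this

theorem partialDeriv_comp_add (i : Fin d) (φ : Vec d → ℝ) (v x : Vec d) :
    partialDeriv i (fun y => φ (y + v)) x = partialDeriv i φ (x + v) := by
  unfold partialDeriv
  rw [fderiv_comp_add_right]

theorem ae_segMeas_exists (i : Fin d) (T : ℝ) :
    ∀ᵐ v ∂(segMeas i T), ∃ t ∈ Set.Icc 0 T, -(t • (basisVec i : Vec d)) = v := by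
  refine ae_segMeas i T ?_ fun t ht => ⟨t, ht, rfl⟩
  exact (isCompact_Icc.image
    (by fun_prop : Continuous fun t : ℝ => -(t • (basisVec i : Vec d)))).measurableSet

theorem ae_comp_add {P : Vec d → Prop} (v : Vec d) (h : ∀ᵐ x, P x) : ∀ᵐ x, P (x + v) :=
  (measurePreserving_add_right volume v).quasiMeasurePreserving.ae h

end Preliminaries

section Energy

variable {d : ℕ} [NeZero d] {A : Coeff d} {δ R : ℝ} {u : Fin d → Vec d → ℝ}
  {D : Fin d → Fin d → Vec d → ℝ} {p : Vec d → ℝ}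

theorem Sol.partialDeriv_moll (hS : Sol A R u D p) {n : ℕ} {x : Vec d}
    (hx : Metric.closedBall (x + (2 * molScale n) • (basisVec 0 : Vec d)) (molScale n)
      ⊆ halfBall d R) (β j : Fin d) :
    partialDeriv β (moll n (u j)) x = moll n (D β j) x := by
  rw [StokesConormal.partialDeriv_moll n (hS.u_mem j), moll_eq_integral_molTest,
    hS.weak β j _ (molTest_isTestFunction n x hx), neg_neg]

/-- The test field is ηu, approximated by η times the mollification of u to stay within smooth
fields. As div u = 0, the pressure drops out of the term with Du and survives only against ∇η. -/
theorem Sol.energy_identity (hA : IsStronglyElliptic δ A) (hS : Sol A R u D p) {ρ : ℝ}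
    (hρ : ρ < R) {η : Vec d → ℝ} (hη : IsTestFunction (Metric.ball 0 ρ) η) :
    ∫ x in halfBall d R, η x * ∑ α, ∑ i, flux A D α i x * D α i x
      = -∑ α, ∑ i, ∫ x in halfBall d R, stress A D p α i x * (partialDeriv α η x * u i x) := by
  have hTm := stress_memLp hA hS.D_mem hS.p_mem
  have hηc := hη.smooth.continuous
  have hdη : ∀ α, Continuous (partialDeriv α η) := fun α =>
    (partialDeriv_contDiff hη.smooth α).continuous
  have hdηc : ∀ α, HasCompactSupport (partialDeriv α η) := fun α =>
    hasCompactSupport_partialDeriv hη.hasCompactSupport α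
  have m1 : ∀ α i, MemLp (fun x => partialDeriv α η x * stress A D p α i x) 2 volume := fun α i =>
    memLp_mul_of_hasCompactSupport (hTm α i) (hdη α) (hdηc α)
  have m2 : ∀ α i, MemLp (fun x => η x * stress A D p α i x) 2 volume := fun α i =>
    memLp_mul_of_hasCompactSupport (hTm α i) hηc hη.hasCompactSupport
  have hn : ∀ᶠ n in atTop, ∑ α, ∑ i,
      ((∫ x in halfBall d R, (partialDeriv α η x * stress A D p α i x) * moll n (u i) x)
        + ∫ x in halfBall d R, (η x * stress A D p α i x) * moll n (D α i) x) = 0 := by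
    filter_upwards [eventually_molScale hρ] with n hn
    have hφ : ∀ i, IsTestFunction (Metric.ball 0 R) (fun x => η x * moll n (u i) x) := fun i =>
      ⟨hη.smooth.mul (moll_contDiff n (hS.u_mem i)), hη.hasCompactSupport.mul_right,
        (tsupport_mul_subset_left).trans
          (hη.tsupport_subset.trans (Metric.ball_subset_ball hρ.le))⟩
    have h1 := hS.eq _ hφ
    rw [setIntegral_halfSpace_eq (R := R)] at h1
    swap
    · intro x hx
      simp [partialDeriv_eq_zero_of_notMem (hφ _) _ hx]
    rw [← h1, integral_finsetSum]
    swap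
    · exact fun α _ => integrable_finsetSum _ fun i _ =>
        integrable_mul_of_memLp ((hTm α i).restrict _) (((hφ i).partialDeriv_memLp α).restrict _)
    refine Finset.sum_congr rfl fun α _ => ?_
    rw [integral_finsetSum]
    swap
    · exact fun i _ =>
        integrable_mul_of_memLp ((hTm α i).restrict _) (((hφ i).partialDeriv_memLp α).restrict _)
    refine Finset.sum_congr rfl fun i _ => ?_
    rw [← integral_add
      (integrable_mul_of_memLp ((m1 α i).restrict _) ((moll_memLp n (hS.u_mem i)).restrict _))
      (integrable_mul_of_memLp ((m2 α i).restrict _) ((moll_memLp n (hS.D_mem α i)).restrict _))]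
    refine setIntegral_congr_fun (measurableSet_halfBall R) fun x hx => ?_
    rw [partialDeriv_mul hη.smooth (moll_contDiff n (hS.u_mem i))]
    by_cases hxρ : x ∈ Metric.ball (0 : Vec d) ρ
    · rw [hS.partialDeriv_moll (stencil_subset_halfBall (mem_ball_zero_iff.1 hxρ) hx.2.le hn)]
      ring
    · rw [partialDeriv_eq_zero_of_notMem hη α hxρ,
        image_eq_zero_of_notMem_tsupport fun h => hxρ (hη.tsupport_subset h)]
      ring
  have hlim := tendsto_finsetSum (Finset.univ : Finset (Fin d)) fun α _ =>
    tendsto_finsetSum (Finset.univ : Finset (Fin d)) fun i _ =>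
      (tendsto_integral_mul_moll (m1 α i) (hS.u_mem i) (halfBall d R)).add
        (tendsto_integral_mul_moll (m2 α i) (hS.D_mem α i) (halfBall d R))
  have h0 : ∑ α, ∑ i, ((∫ x in halfBall d R, (partialDeriv α η x * stress A D p α i x) * u i x)
        + ∫ x in halfBall d R, (η x * stress A D p α i x) * D α i x) = 0 :=
    tendsto_nhds_unique hlim (tendsto_const_nhds.congr' (hn.mono fun n h => h.symm))
  simp only [Finset.sum_add_distrib] at h0
  have hi2 : ∀ α i, Integrable (fun x => (η x * stress A D p α i x) * D α i x)
      (volume.restrict (halfBall d R)) := fun α i =>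
    integrable_mul_of_memLp ((m2 α i).restrict _) ((hS.D_mem α i).restrict _)
  have h2 : ∫ x in halfBall d R, η x * ∑ α, ∑ i, flux A D α i x * D α i x
      = ∑ α, ∑ i, ∫ x in halfBall d R, (η x * stress A D p α i x) * D α i x := by
    simp_rw [← integral_finsetSum _ fun i _ => hi2 _ i]
    rw [← integral_finsetSum _ fun α _ => integrable_finsetSum _ fun i _ => hi2 α i]
    refine setIntegral_congr_ae (measurableSet_halfBall R) ?_
    filter_upwards [hS.div_eq] with x hx hxR
    have h3 := sum_stress_mul A D p x (fun α i => D α i x)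
    rw [hx hxR, mul_zero, add_zero] at h3
    rw [← h3, Finset.mul_sum]
    refine Finset.sum_congr rfl fun α _ => ?_
    rw [Finset.mul_sum]
    exact Finset.sum_congr rfl fun i _ => by ring
  have h4 : ∀ α i, ∫ x in halfBall d R, stress A D p α i x * (partialDeriv α η x * u i x)
      = ∫ x in halfBall d R, (partialDeriv α η x * stress A D p α i x) * u i x := fun α i => by
    congr 1; ext x; ring
  simp_rw [h2, h4]
  linarith

theorem ellipticity (hA : IsStronglyElliptic δ A) (D : Fin d → Fin d → Vec d → ℝ) (x : Vec d) :
    δ * ∑ α, ∑ i, D α i x ^ 2 ≤ ∑ α, ∑ i, flux A D α i x * D α i x := by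
  have h := hA.elliptic (x 0) (fun α => WithLp.toLp 2 fun i => D α i x)
  simp only [EuclideanSpace.norm_sq_eq, Real.norm_eq_abs, sq_abs] at h
  refine h.trans (le_of_eq ?_)
  refine Finset.sum_congr rfl fun α _ => ?_
  simp only [flux, Finset.sum_mul]
  rw [Finset.sum_comm]

/-- The remaining pressure is bounded only by Du on a larger half ball. Young's inequality makes its
coefficient 1/2, which leaves a term to be absorbed by iteration over radii. The exponent 24 is 16
from the pressure estimate plus 8 from the square of ∇η. -/
theorem exists_energy_step (d : ℕ) [NeZero d] {δ : ℝ} (hδ : 0 < δ) : ∃ C : ℝ, 0 ≤ C ∧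
    ∀ (A : Coeff d), IsStronglyElliptic δ A → ∀ (r R : ℝ), 0 ≤ r → r < R → R ≤ 2 →
    ∀ u D p, Sol A R u D p →
      gradSq (halfBall d r) D
        ≤ 1 / 2 * gradSq (halfBall d R) D + C / (R - r) ^ 24 * vecSq (halfBall d R) u := by
  obtain ⟨K, hK, hcut⟩ := exists_isCutoff d
  obtain ⟨Cp, hCp, hpress⟩ := exists_pressure_bound d hδ
  refine ⟨d * (16 * K) ^ 2 * (d ^ 2 * (d ^ 2 * (δ⁻¹) ^ 2 + Cp) * 2 ^ 16) / δ ^ 2, by positivity, ?_⟩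
  intro A hA r R hr hrR hR u D p hS
  have hd : (0 : ℝ) < d := Nat.cast_pos.2 (Nat.pos_of_ne_zero (NeZero.ne d))
  set ρ := (r + R) / 2 with hρ
  set s := R - r with hs
  have hs0 : 0 < s := by rw [hs]; linarith
  have hρs : R - ρ = s / 2 := by rw [hρ, hs]; ring
  have hρr : ρ - r = s / 2 := by rw [hρ, hs]; ring
  have hρR : ρ < R := by linarith
  obtain ⟨η, hη⟩ := hcut r ρ hr (by linarith) (by linarith)
  have hM : K / (ρ - r) ^ 4 = 16 * K / s ^ 4 := by rw [hρr]; field_simp; norm_num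
  rw [hM] at hη
  set M := 16 * K / s ^ 4 with hMdef
  have hηt : IsTestFunction (Metric.ball 0 ρ) η := ⟨hη.smooth, hη.hasCompactSupport, hη.tsupport_subset⟩
  set G := gradSq (halfBall d R) D with hG
  have hG0 : 0 ≤ G := gradSq_nonneg _ _
  set V := vecSq (halfBall d R) u with hV
  have hV0 : 0 ≤ V := vecSq_nonneg _ _
  set Z := d ^ 2 * (d ^ 2 * (δ⁻¹) ^ 2 + Cp) * 2 ^ 16 / s ^ 16 with hZ
  have hZ0 : 0 < Z := by positivity
  -- `Z` bounds the total coefficient of the stress terms, so that k Z G is exactly half of δ G.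
  set k := δ / (2 * Z) with hk
  have hk0 : 0 < k := by positivity
  have hpρ := hpress A hA ρ R (by linarith) hρR hR u D p hS
  -- lower bound
  have lower : δ * gradSq (halfBall d r) D
      ≤ ∫ x in halfBall d R, η x * ∑ α, ∑ i, flux A D α i x * D α i x := by
    have hfi : Integrable (fun x => ∑ α, ∑ i, flux A D α i x * D α i x) volume :=
      integrable_finsetSum _ fun α _ => integrable_finsetSum _ fun i _ =>
        integrable_mul_of_memLp (flux_memLp hA hS.D_mem α i) (hS.D_mem α i)
    have hpos : ∀ x, 0 ≤ ∑ α, ∑ i, flux A D α i x * D α i x := fun x =>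
      le_trans (by positivity) (ellipticity hA D x)
    have hηi : Integrable (fun x => η x * ∑ α, ∑ i, flux A D α i x * D α i x) volume := by
      refine hfi.mono (hη.smooth.continuous.aestronglyMeasurable.mul hfi.1) (ae_of_all _ fun x => ?_)
      rw [norm_mul]
      refine mul_le_of_le_one_left (norm_nonneg _) ?_
      rw [Real.norm_of_nonneg (hη.nonneg x)]
      exact hη.le_one x
    calc δ * gradSq (halfBall d r) D = ∫ x in halfBall d r, δ * ∑ α, ∑ i, D α i x ^ 2 := by
          rw [integral_const_mul, integral_sum_sum_sq hS.D_mem]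
      _ ≤ ∫ x in halfBall d r, η x * ∑ α, ∑ i, flux A D α i x * D α i x := by
          refine setIntegral_mono_on ?_ hηi.integrableOn (measurableSet_halfBall r) fun x hx => ?_
          · exact ((integrable_finsetSum _ fun α _ => integrable_finsetSum _ fun i _ =>
              (hS.D_mem α i).integrable_sq).const_mul δ).integrableOn
          · rw [hη.eq_one x (mem_halfBall.1 hx).1.le, one_mul]
            exact ellipticity hA D x
      _ ≤ _ := setIntegral_mono_set hηi.integrableOn
          (ae_of_all _ fun x => mul_nonneg (hη.nonneg x) (hpos x))
          (halfBall_mono hrR.le).eventuallyLE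
  rw [hS.energy_identity hA hρR hηt] at lower
  -- upper bound, term by term
  have hTm := stress_memLp hA hS.D_mem hS.p_mem
  have term : ∀ α i, -∫ x in halfBall d R, stress A D p α i x * (partialDeriv α η x * u i x)
      ≤ k / 2 * (2 * (d ^ 2 * (δ⁻¹) ^ 2 * G) + 2 * (Cp / (R - ρ) ^ 16 * G))
        + 1 / (2 * k) * (M ^ 2 * ∫ x in halfBall d R, u i x ^ 2) := by
    intro α i
    have hum : MemLp (fun x => partialDeriv α η x * u i x) 2 volume :=
      memLp_mul_of_hasCompactSupport (hS.u_mem i) (partialDeriv_contDiff hη.smooth α).continuous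
        (hasCompactSupport_partialDeriv hη.hasCompactSupport α)
    have e1 : ∫ x in halfBall d R, stress A D p α i x * (partialDeriv α η x * u i x)
        = ∫ x in halfBall d ρ, stress A D p α i x * (partialDeriv α η x * u i x) := by
      refine setIntegral_eq_of_subset_of_forall_sdiff_eq_zero (measurableSet_halfBall R)
        (halfBall_mono hρR.le) fun x hx => ?_
      rw [partialDeriv_eq_zero_of_notMem hηt α fun hb => hx.2 ⟨hb, hx.1.2⟩]
      ring
    rw [e1]
    refine (neg_le_abs _).trans ((integral_mul_le_of_weight ((hTm α i).restrict _)
      (hum.restrict _) hk0).trans ?_)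
    have e2 := integral_stress_sq_le hA hS.D_mem hS.p_mem α i (halfBall d ρ)
    have e3 : gradSq (halfBall d ρ) D ≤ G := gradSq_mono hS.D_mem (halfBall_mono hρR.le)
    have e4 : ∫ x in halfBall d ρ, (partialDeriv α η x * u i x) ^ 2
        ≤ M ^ 2 * ∫ x in halfBall d R, u i x ^ 2 := by
      refine (setIntegral_sq_mono hum (halfBall_mono hρR.le)).trans ?_
      rw [← integral_const_mul]
      refine integral_mono (hum.restrict _).integrable_sq
        (((hS.u_mem i).restrict _).integrable_sq.const_mul _) fun x => ?_
      simp only [mul_pow]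
      exact mul_le_mul_of_nonneg_right (sq_le_sq' (abs_le.1 (hη.deriv_le α x)).1
        (abs_le.1 (hη.deriv_le α x)).2) (sq_nonneg _)
    have e5 : ∫ x in halfBall d ρ, stress A D p α i x ^ 2
        ≤ 2 * (d ^ 2 * (δ⁻¹) ^ 2 * G) + 2 * (Cp / (R - ρ) ^ 16 * G) := by
      refine e2.trans ?_
      gcongr
    gcongr
  have upper : δ * gradSq (halfBall d r) D ≤ d ^ 2 * (k / 2 * (2 * (d ^ 2 * (δ⁻¹) ^ 2 * G)
      + 2 * (Cp / (R - ρ) ^ 16 * G))) + d * (1 / (2 * k) * (M ^ 2 * V)) := by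
    refine lower.trans ?_
    rw [← Finset.sum_neg_distrib]
    simp_rw [← Finset.sum_neg_distrib]
    refine (Finset.sum_le_sum fun α _ => Finset.sum_le_sum fun i _ => term α i).trans (le_of_eq ?_)
    simp only [Finset.sum_add_distrib, ← Finset.mul_sum, Finset.sum_const, Finset.card_univ,
      Fintype.card_fin, nsmul_eq_mul, hV, vecSq]
    ring
  have hs2 : s ≤ 2 := by rw [hs]; linarith
  have e6 : d ^ 2 * (k / 2 * (2 * (d ^ 2 * (δ⁻¹) ^ 2 * G) + 2 * (Cp / (R - ρ) ^ 16 * G)))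
      ≤ k * Z * G := by
    have h1 : (1 : ℝ) ≤ 2 ^ 16 / s ^ 16 := by
      rw [one_le_div (by positivity)]
      exact pow_le_pow_left₀ hs0.le hs2 16
    have h2 : Cp / (R - ρ) ^ 16 = Cp * (2 ^ 16 / s ^ 16) := by
      rw [hρs, div_pow]; field_simp
    have h3 : Z = d ^ 2 * (d ^ 2 * (δ⁻¹) ^ 2 + Cp) * (2 ^ 16 / s ^ 16) := by rw [hZ]; ring
    rw [h2, h3]
    have h4 : d ^ 2 * (δ⁻¹) ^ 2 ≤ d ^ 2 * (δ⁻¹) ^ 2 * (2 ^ 16 / s ^ 16) :=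
      le_mul_of_one_le_right (by positivity) h1
    have h5 : 0 ≤ (d : ℝ) ^ 2 * (k * G) := by positivity
    nlinarith [mul_le_mul_of_nonneg_left h4 h5]
  have e7 : k * Z * G = δ * (1 / 2 * G) := by rw [hk]; field_simp
  have e8 : d * (1 / (2 * k) * (M ^ 2 * V)) = δ * (d * (16 * K) ^ 2 *
      (d ^ 2 * (d ^ 2 * (δ⁻¹) ^ 2 + Cp) * 2 ^ 16) / δ ^ 2 / s ^ 24 * V) := by
    rw [hk, hMdef, hZ]; field_simp
  rw [e8] at upper
  rw [e7] at e6
  have h9 : δ * gradSq (halfBall d r) D ≤ δ * (1 / 2 * G + d * (16 * K) ^ 2 *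
      (d ^ 2 * (d ^ 2 * (δ⁻¹) ^ 2 + Cp) * 2 ^ 16) / δ ^ 2 / s ^ 24 * V) := by
    rw [mul_add]; linarith
  exact le_of_mul_le_mul_left h9 hδ

/-- The Caccioppoli inequality. -/
theorem exists_caccioppoli (d : ℕ) [NeZero d] {δ : ℝ} (hδ : 0 < δ) : ∃ C : ℝ, 0 ≤ C ∧
    ∀ (A : Coeff d), IsStronglyElliptic δ A → ∀ (r R : ℝ), 0 ≤ r → r < R → R ≤ 2 →
    ∀ u D p, Sol A R u D p →
      gradSq (halfBall d r) D ≤ C / (R - r) ^ 24 * vecSq (halfBall d R) u := by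
  obtain ⟨C, hC, hstep⟩ := exists_energy_step d hδ
  refine ⟨4 * 72 ^ 24 * C, by positivity, fun A hA r R hr hrR hR u D p hS => ?_⟩
  have h := le_of_forall_le_half_add (F := fun s => gradSq (halfBall d s) D)
    (B := C * vecSq (halfBall d R) u) hrR (mul_nonneg hC (vecSq_nonneg _ _))
    (fun s hs => gradSq_mono hS.D_mem (halfBall_mono hs)) ?_
  · refine h.trans (le_of_eq (by ring))
  · intro s t hs hst ht
    refine (hstep A hA s t (by linarith) hst (by linarith) u D p (hS.mono ht)).trans ?_
    have h1 : vecSq (halfBall d t) u ≤ vecSq (halfBall d R) u :=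
      vecSq_mono hS.u_mem (halfBall_mono ht)
    have h2 : 0 < t - s := by linarith
    have : C / (t - s) ^ 24 * vecSq (halfBall d t) u ≤ C / (t - s) ^ 24 * vecSq (halfBall d R) u := by
      gcongr
    calc _ ≤ 1 / 2 * gradSq (halfBall d t) D + C / (t - s) ^ 24 * vecSq (halfBall d R) u := by
          linarith
      _ = _ := by ring

end Energy

/-! ### Tangential difference quotients of solutions -/

section Differences

variable {d : ℕ} [NeZero d]

theorem add_tangential_coord {i : Fin d} (hi : i ≠ 0) (h : ℝ) (x : Vec d) :
    (x + h • (basisVec i : Vec d)) 0 = x 0 := by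
  simp [hi.symm]

theorem add_mem_halfBall {i : Fin d} (hi : i ≠ 0) {h r R : ℝ} (hh : |h| ≤ R - r) {x : Vec d}
    (hx : x ∈ halfBall d r) : x + h • (basisVec i : Vec d) ∈ halfBall d R := by
  rw [mem_halfBall] at hx ⊢
  rw [add_tangential_coord hi]
  refine ⟨(norm_add_le _ _).trans_lt ?_, hx.2⟩
  rw [norm_smul, PiLp.norm_single, Real.norm_eq_abs, norm_one, mul_one]
  linarith [hx.1]

theorem halfSpace_setIntegral_comp_add {i : Fin d} (hi : i ≠ 0) (h : ℝ) (f : Vec d → ℝ) :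
    ∫ x in halfSpace d, f (x + h • basisVec i) = ∫ x in halfSpace d, f x := by
  rw [← integral_indicator measurableSet_halfSpace, ← integral_indicator measurableSet_halfSpace,
    ← integral_add_right_eq_self ((halfSpace d).indicator f) (h • (basisVec i : Vec d))]
  congr 1; ext x
  by_cases hx : 0 < x 0 <;> simp only [Set.indicator, halfSpace, Set.mem_ofPred_eq, add_tangential_coord hi, hx, if_true, if_false]

variable {A : Coeff d} {δ R : ℝ} {u : Fin d → Vec d → ℝ}
  {D : Fin d → Fin d → Vec d → ℝ} {p : Vec d → ℝ}

theorem stress_comp_add {i : Fin d} (hi : i ≠ 0) (h : ℝ) (A : Coeff d)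
    (D : Fin d → Fin d → Vec d → ℝ) (p : Vec d → ℝ) (α j : Fin d) (x : Vec d) :
    stress A D p α j (x + h • basisVec i) = stress A (fun β k x => D β k (x + h • basisVec i))
      (fun x => p (x + h • basisVec i)) α j x := by
  simp only [stress, flux, add_tangential_coord hi]

/-- Here the dependence of A on x₁ alone is decisive: a tangential difference never falls on the
coefficients. -/
theorem stress_diffQ {i : Fin d} (hi : i ≠ 0) (h : ℝ) (A : Coeff d)
    (D : Fin d → Fin d → Vec d → ℝ) (p : Vec d → ℝ) (α j : Fin d) :
    stress A (fun β k => diffQ i h (D β k)) (diffQ i h p) α j = diffQ i h (stress A D p α j) := by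
  ext x
  simp only [stress, flux, diffQ, add_tangential_coord hi]
  have e : ∑ β, ∑ k, A (x 0) α β j k * (h⁻¹ * (D β k (x + h • basisVec i) - D β k x))
      = h⁻¹ * ((∑ β, ∑ k, A (x 0) α β j k * D β k (x + h • basisVec i))
        - ∑ β, ∑ k, A (x 0) α β j k * D β k x) := by
    rw [← Finset.sum_sub_distrib, Finset.mul_sum]
    refine Finset.sum_congr rfl fun β _ => ?_
    rw [← Finset.sum_sub_distrib, Finset.mul_sum]
    exact Finset.sum_congr rfl fun k _ => by ring
  rw [e]
  ring

/-- A tangential shift preserves the half space, its boundary and the coefficients. Only the ball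
moves, which costs h in the radius. -/
theorem Sol.translate (hS : Sol A R u D p) {i : Fin d} (hi : i ≠ 0)
    {h : ℝ} (hh : 0 ≤ h) :
    Sol A (R - h) (fun j x => u j (x + h • basisVec i)) (fun β j x => D β j (x + h • basisVec i))
      (fun x => p (x + h • basisVec i)) where
  u_mem j := memLp_comp_add (hS.u_mem j) _
  D_mem β j := memLp_comp_add (hS.D_mem β j) _
  p_mem := memLp_comp_add hS.p_mem _
  weak β j φ hφ := by
    have hφ' : IsTestFunction (halfBall d R) (fun x => φ (x + -(h • basisVec i))) := by
      refine hφ.comp_add _ fun x hx => ?_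
      have := add_mem_halfBall hi (h := h) (r := R - h) (R := R)
        (by rw [abs_of_nonneg hh]; linarith) hx
      simpa using this
    have h1 := hS.weak β j _ hφ'
    rw [← integral_add_right_eq_self _ (h • (basisVec i : Vec d)),
      ← integral_add_right_eq_self (fun x => D β j x * _) (h • (basisVec i : Vec d))] at h1
    simpa [partialDeriv_comp_add] using h1
  div_eq := by
    filter_upwards [ae_comp_add (h • basisVec i) hS.div_eq] with x hx hxr
    exact hx (add_mem_halfBall hi (by rw [abs_of_nonneg hh]; linarith) hxr)
  eq φ hφ := by
    have hφ' : ∀ k, IsTestFunction (Metric.ball 0 R) (fun x => φ k (x + -(h • basisVec i))) := by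
      intro k
      refine (hφ k).comp_add _ fun x hx => ?_
      rw [mem_ball_zero_iff] at hx ⊢
      have h1 := norm_add_le (x + -(h • (basisVec i : Vec d))) (h • (basisVec i : Vec d))
      rw [norm_smul_basisVec i hh, neg_add_cancel_right] at h1
      linarith
    have h1 := hS.eq _ hφ'
    rw [← halfSpace_setIntegral_comp_add hi h] at h1
    simp only [partialDeriv_comp_add, stress_comp_add hi, add_neg_cancel_right] at h1
    exact h1

theorem Sol.diffQ (hA : IsStronglyElliptic δ A) (hS : Sol A R u D p) {i : Fin d} (hi : i ≠ 0)
    {h : ℝ} (hh : 0 ≤ h) :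
    Sol A (R - h) (fun j => diffQ i h (u j)) (fun β j => diffQ i h (D β j))
      (diffQ i h p) where
  u_mem j := diffQ_memLp i h (hS.u_mem j)
  D_mem β j := diffQ_memLp i h (hS.D_mem β j)
  p_mem := diffQ_memLp i h hS.p_mem
  weak β j φ hφ := by
    have hT := hS.translate hi hh
    have h1 := hT.weak β j φ hφ
    have h2 := (hS.mono (by linarith : R - h ≤ R)).weak β j φ hφ
    have hd := hφ.partialDeriv_memLp β
    have e1 : ∫ x, StokesConormal.diffQ i h (u j) x * partialDeriv β φ x
        = h⁻¹ * ((∫ x, u j (x + h • basisVec i) * partialDeriv β φ x)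
          - ∫ x, u j x * partialDeriv β φ x) := by
      rw [← integral_sub (integrable_mul_of_memLp (hT.u_mem j) hd)
        (integrable_mul_of_memLp (hS.u_mem j) hd), ← integral_const_mul]
      congr 1; ext x; simp only [StokesConormal.diffQ]; ring
    have e2 : ∫ x, StokesConormal.diffQ i h (D β j) x * φ x
        = h⁻¹ * ((∫ x, D β j (x + h • basisVec i) * φ x) - ∫ x, D β j x * φ x) := by
      rw [← integral_sub (integrable_mul_of_memLp (hT.D_mem β j) hφ.memLp)
        (integrable_mul_of_memLp (hS.D_mem β j) hφ.memLp), ← integral_const_mul]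
      congr 1; ext x; simp only [StokesConormal.diffQ]; ring
    rw [e1, e2, h1, h2]; ring
  div_eq := by
    filter_upwards [(hS.translate hi hh).div_eq, (hS.mono (by linarith : R - h ≤ R)).div_eq]
      with x h1 h2 hx
    simp only [StokesConormal.diffQ]
    rw [← Finset.mul_sum, Finset.sum_sub_distrib, h1 hx, h2 hx]
    simp
  eq φ hφ := by
    have hT := hS.translate hi hh
    have h1 := hT.eq φ hφ
    have h2 := (hS.mono (by linarith : R - h ≤ R)).eq φ hφ
    have hint : ∀ {u D p} {R' : ℝ}, Sol A R' u D p → Integrable (fun x => ∑ α, ∑ k,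
        stress A D p α k x * partialDeriv α (φ k) x) (volume.restrict (halfSpace d)) :=
      fun hS => integrable_finsetSum _ fun α _ => integrable_finsetSum _ fun k _ =>
        integrable_mul_of_memLp ((stress_memLp hA hS.D_mem hS.p_mem α k).restrict _)
          (((hφ k).partialDeriv_memLp α).restrict _)
    calc _ = ∫ x in halfSpace d, h⁻¹ * ((∑ α, ∑ k,
          stress A (fun β k x => D β k (x + h • basisVec i)) (fun x => p (x + h • basisVec i))
            α k x * partialDeriv α (φ k) x)
          - ∑ α, ∑ k, stress A D p α k x * partialDeriv α (φ k) x) := by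
          congr 1; ext x
          rw [← Finset.sum_sub_distrib, Finset.mul_sum]
          refine Finset.sum_congr rfl fun α _ => ?_
          rw [← Finset.sum_sub_distrib, Finset.mul_sum]
          refine Finset.sum_congr rfl fun k _ => ?_
          rw [stress_diffQ hi, ← stress_comp_add hi]
          simp only [StokesConormal.diffQ]; ring
      _ = 0 := by
          rw [integral_const_mul, integral_sub (hint hT) (hint hS), h1, h2]; simp

theorem moll_diffQ (n : ℕ) (i : Fin d) (h : ℝ) {F : Vec d → ℝ} (hF : MemLp F 2 volume) :
    moll n (diffQ i h F) = diffQ i h (moll n F) := by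
  unfold diffQ
  rw [moll_const_mul, moll_sub n (memLp_comp_add hF _) hF, moll_comp_add]

/-- A difference quotient is the average of D_i u over a segment of length h, and averaging does not
increase the L² norm. Mollification makes the fundamental theorem of calculus available. -/
theorem Sol.integral_diffQ_sq_le (hS : Sol A R u D p) {i : Fin d} (hi : i ≠ 0) {h r : ℝ}
    (hh : 0 < h) (hr : r + h < R) (j : Fin d) :
    ∫ x in halfBall d r, StokesConormal.diffQ i h (u j) x ^ 2 ≤ ∫ x in halfBall d R, D i j x ^ 2 := by
  refine integral_sq_le_of_moll (diffQ_memLp i h (hS.u_mem j)) _ ?_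
  filter_upwards [eventually_molScale hr] with n hn
  have hmD := moll_memLp n (hS.D_mem i j)
  have hcD := (moll_contDiff n (hS.D_mem i j)).continuous
  have hcu := moll_contDiff n (hS.u_mem j)
  have e1 : ∀ x ∈ halfBall d r, moll n (StokesConormal.diffQ i h (u j)) x
      = h⁻¹ * measConv (segMeas i h) (moll n (D i j)) x := by
    intro x hx
    rw [moll_diffQ n i h (hS.u_mem j), StokesConormal.diffQ,
      ← measConv_segMeas_partialDeriv hcu i hh.le,
      measConv_segMeas i h (partialDeriv_contDiff hcu i).continuous, measConv_segMeas i h hcD]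
    congr 1
    refine setIntegral_congr_fun measurableSet_Icc fun t ht => ?_
    have hm := add_mem_halfBall hi (h := t) (r := r) (R := r + h)
      (by rw [abs_of_nonneg ht.1]; linarith [ht.2]) hx
    exact hS.partialDeriv_moll
      (stencil_subset_halfBall (mem_halfBall.1 hm).1 (mem_halfBall.1 hm).2.le hn) i j
  calc ∫ x in halfBall d r, moll n (StokesConormal.diffQ i h (u j)) x ^ 2
      = ∫ x in halfBall d r, (h⁻¹) ^ 2 * measConv (segMeas i h) (moll n (D i j)) x ^ 2 := by
        refine setIntegral_congr_fun (measurableSet_halfBall r) fun x hx => ?_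
        simp only [e1 x hx, mul_pow]
    _ = (h⁻¹) ^ 2 * ∫ x in halfBall d r, measConv (segMeas i h) (moll n (D i j)) x ^ 2 :=
        integral_const_mul _ _
    _ ≤ (h⁻¹) ^ 2 * (h ^ 2 * ∫ x in halfBall d (r + h), moll n (D i j) x ^ 2) := by
        gcongr
        have := integral_measConv_sq_le (segMeas i h) hmD (measurableSet_halfBall r)
          (measurableSet_halfBall (r + h)) ?_
        · rwa [segMeas_real_univ i hh.le] at this
        · filter_upwards [ae_segMeas_exists i h] with v hv x hx
          obtain ⟨t, ht, rfl⟩ := hv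
          rw [sub_neg_eq_add]
          exact add_mem_halfBall hi (by rw [abs_of_nonneg ht.1]; linarith [ht.2]) hx
    _ = ∫ x in halfBall d (r + h), moll n (D i j) x ^ 2 := by field_simp
    _ ≤ _ := integral_moll_sq_le (hS.D_mem i j) hn

end Differences

section IteratedDifferences

variable {d : ℕ}

/-- Iterated difference quotients. -/
def diffs : List (Fin d × ℝ) → (Vec d → ℝ) → Vec d → ℝ
  | [], F => F
  | q :: L, F => diffs L (diffQ q.1 q.2 F)

theorem diffQ_contDiff (i : Fin d) (h : ℝ) {g : Vec d → ℝ} (hg : ContDiff ℝ ∞ g) :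
    ContDiff ℝ ∞ (diffQ i h g) :=
  contDiff_const.mul ((hg.comp (contDiff_id.add contDiff_const)).sub hg)

theorem partialDeriv_diffQ (i j : Fin d) (h : ℝ) {g : Vec d → ℝ} (hg : ContDiff ℝ ∞ g) :
    partialDeriv j (diffQ i h g) = diffQ i h (partialDeriv j g) := by
  ext x
  have h1 : ContDiff ℝ ∞ fun y => g (y + h • basisVec i) :=
    hg.comp (contDiff_id.add contDiff_const)
  unfold diffQ
  rw [partialDeriv_const_mul _ (h1.sub hg), partialDeriv_sub h1 hg, partialDeriv_comp_add]

theorem iterPartial_diffQ (L : List (Fin d)) (i : Fin d) (h : ℝ) {g : Vec d → ℝ}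
    (hg : ContDiff ℝ ∞ g) : iterPartial L (diffQ i h g) = diffQ i h (iterPartial L g) := by
  induction L generalizing g with
  | nil => rfl
  | cons j L ih =>
    simp only [iterPartial]
    rw [partialDeriv_diffQ i j h hg, ih (partialDeriv_contDiff hg j)]

theorem diffQ_tendsto (i : Fin d) {g : Vec d → ℝ} (hg : ContDiff ℝ ∞ g) (x : Vec d)
    {h : ℕ → ℝ} (h0 : ∀ k, 0 < h k) (hlim : Tendsto h atTop (𝓝 0)) :
    Tendsto (fun k => diffQ i (h k) g x) atTop (𝓝 (partialDeriv i g x)) := by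
  have h1 := hasDerivAt_along hg x i 0
  rw [hasDerivAt_iff_tendsto_slope_zero] at h1
  have h2 : Tendsto h atTop (𝓝[≠] 0) :=
    tendsto_nhdsWithin_iff.2 ⟨hlim, Eventually.of_forall fun k => (h0 k).ne'⟩
  have h3 := h1.comp h2
  simpa [Function.comp_def, diffQ] using h3

end IteratedDifferences

section Bounds

variable {d : ℕ} [NeZero d]

theorem diffs_stress {L : List (Fin d × ℝ)} (hL : ∀ q ∈ L, q.1 ≠ 0) (A : Coeff d)
    (D : Fin d → Fin d → Vec d → ℝ) (p : Vec d → ℝ) (α j : Fin d) :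
    diffs L (stress A D p α j) = stress A (fun β k => diffs L (D β k)) (diffs L p) α j := by
  induction L generalizing D p with
  | nil => rfl
  | cons q L ih =>
    simp only [diffs]
    rw [← ih fun q hq => hL q (List.mem_cons_of_mem _ hq), stress_diffQ (hL q List.mem_cons_self)]

/-- Each difference costs one Caccioppoli inequality: the gradient of a difference quotient of u is
bounded by the difference quotient itself, hence by Du on a larger half ball. The threshold `h₀`
keeps the shifts inside the gaps between radii. -/
theorem exists_diffs_gradSq_bound (d : ℕ) [NeZero d] {δ : ℝ} (hδ : 0 < δ) (k : ℕ) :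
    ∀ r R : ℝ, 0 ≤ r → r < R → R ≤ 2 → ∃ C h₀ : ℝ, 0 ≤ C ∧ 0 < h₀ ∧
      ∀ A : Coeff d, IsStronglyElliptic δ A → ∀ u D p, Sol A R u D p →
      ∀ L : List (Fin d × ℝ), L.length ≤ k → (∀ q ∈ L, q.1 ≠ 0 ∧ 0 < q.2 ∧ q.2 < h₀) →
        Sol A r (fun j => diffs L (u j)) (fun β j => diffs L (D β j)) (diffs L p) ∧
        gradSq (halfBall d r) (fun β j => diffs L (D β j)) ≤ C * gradSq (halfBall d R) D := by
  induction k with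
  | zero =>
    intro r R hr hrR hR
    refine ⟨1, 1, zero_le_one, one_pos, fun A hA u D p hS L hL _ => ?_⟩
    obtain rfl := List.length_eq_zero_iff.1 (Nat.le_zero.1 hL)
    rw [one_mul]
    exact ⟨hS.mono hrR.le, gradSq_mono hS.D_mem (halfBall_mono hrR.le)⟩
  | succ k ih =>
    intro r R hr hrR hR
    obtain ⟨K, hK, hcac⟩ := exists_caccioppoli d hδ
    -- Between r and s the induction hypothesis is used, between s and m the Caccioppoli inequality,
    -- and between m and R there is room for the shift.
    set s := (r + R) / 2 with hs
    set m := (s + R) / 2 with hm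
    have hrs : r < s := by linarith
    have hsm : s < m := by linarith
    have hmR : m < R := by linarith
    have hms : 0 < m - s := by linarith
    obtain ⟨C, h₁, hC, hh₁, hind⟩ := ih r s hr hrs (by linarith)
    refine ⟨1 + C * (K / (m - s) ^ 24), min h₁ (R - m), by positivity,
      lt_min hh₁ (by linarith), fun A hA u D p hS L hL hq => ?_⟩
    have hG := gradSq_nonneg (halfBall d R) D
    cases L with
    | nil =>
      refine ⟨hS.mono hrR.le, (gradSq_mono hS.D_mem (halfBall_mono hrR.le)).trans ?_⟩
      refine le_mul_of_one_le_left hG ?_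
      have : 0 ≤ C * (K / (m - s) ^ 24) := by positivity
      linarith
    | cons q L =>
      obtain ⟨hq0, hqpos, hqlt⟩ := hq q List.mem_cons_self
      have hq1 : q.2 < R - m := hqlt.trans_le (min_le_right _ _)
      have hSd := hS.diffQ hA hq0 hqpos.le
      obtain ⟨h1, h2⟩ := hind A hA _ _ _ (hSd.mono (by linarith : s ≤ R - q.2)) L
        (by simpa using hL) fun q' hq' =>
          ⟨(hq q' (List.mem_cons_of_mem _ hq')).1, (hq q' (List.mem_cons_of_mem _ hq')).2.1,
            (hq q' (List.mem_cons_of_mem _ hq')).2.2.trans_le (min_le_left _ _)⟩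
      refine ⟨h1, h2.trans ?_⟩
      have h3 := hcac A hA s m (by linarith) hsm (by linarith) _ _ _
        (hSd.mono (by linarith : m ≤ R - q.2))
      have h4 : vecSq (halfBall d m) (fun j => diffQ q.1 q.2 (u j)) ≤ gradSq (halfBall d R) D := by
        refine (Finset.sum_le_sum fun j _ =>
          hS.integral_diffQ_sq_le hq0 hqpos (by linarith) j).trans ?_
        exact Finset.single_le_sum (f := fun β => ∑ j, ∫ x in halfBall d R, D β j x ^ 2)
          (fun β _ => Finset.sum_nonneg fun _ _ => integral_nonneg fun _ => sq_nonneg _)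
          (Finset.mem_univ q.1)
      calc _ ≤ C * (K / (m - s) ^ 24 * gradSq (halfBall d R) D) := by
            refine mul_le_mul_of_nonneg_left (h3.trans ?_) hC
            exact mul_le_mul_of_nonneg_left h4 (by positivity)
        _ ≤ _ := by rw [add_mul]; linarith

/-- The differenced pressure belongs to a differenced solution, so one more use of the pressure
estimate, on an intermediate radius, covers the stress. Order d is enough because lists without
repetition have at most d entries. -/
theorem exists_diffs_bound (d : ℕ) [NeZero d] {δ : ℝ} (hδ : 0 < δ) {r R : ℝ} (hr : 0 ≤ r)
    (hrR : r < R) (hR : R ≤ 2) : ∃ C h₀ : ℝ, 0 ≤ C ∧ 0 < h₀ ∧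
      ∀ A : Coeff d, IsStronglyElliptic δ A → ∀ u D p, Sol A R u D p →
      ∀ L : List (Fin d × ℝ), L.length ≤ d → (∀ q ∈ L, q.1 ≠ 0 ∧ 0 < q.2 ∧ q.2 < h₀) →
        (∀ β j, ∫ x in halfBall d r, diffs L (D β j) x ^ 2 ≤ C * gradSq (halfBall d R) D) ∧
        (∀ α i, ∫ x in halfBall d r, diffs L (stress A D p α i) x ^ 2
          ≤ C * gradSq (halfBall d R) D) := by
  set s := (r + R) / 2 with hs
  have hrs : r < s := by linarith
  have hsr : 0 < s - r := by linarith
  obtain ⟨C, h₀, hC, hh₀, hbd⟩ := exists_diffs_gradSq_bound d hδ d s R (by linarith) (by linarith) hR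
  obtain ⟨P, hP, hpress⟩ := exists_pressure_bound d hδ
  refine ⟨C + (2 * (d ^ 2 * (δ⁻¹) ^ 2) + 2 * (P / (s - r) ^ 16)) * C, h₀, by positivity, hh₀,
    fun A hA u D p hS L hL hq => ?_⟩
  obtain ⟨hSL, hb⟩ := hbd A hA u D p hS L hL hq
  have hG := gradSq_nonneg (halfBall d R) D
  have hb' : gradSq (halfBall d r) (fun β j => diffs L (D β j)) ≤ C * gradSq (halfBall d R) D :=
    (gradSq_mono hSL.D_mem (halfBall_mono hrs.le)).trans hb
  refine ⟨fun β j => ?_, fun α i => ?_⟩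
  · refine (Finset.single_le_sum (f := fun j => ∫ x in halfBall d r, diffs L (D β j) x ^ 2)
      (fun _ _ => integral_nonneg fun _ => sq_nonneg _) (Finset.mem_univ j)).trans ?_
    refine (Finset.single_le_sum (f := fun β => ∑ j, ∫ x in halfBall d r, diffs L (D β j) x ^ 2)
      (fun β _ => Finset.sum_nonneg fun _ _ => integral_nonneg fun _ => sq_nonneg _)
      (Finset.mem_univ β)).trans (hb'.trans ?_)
    refine mul_le_mul_of_nonneg_right ?_ hG
    exact le_add_of_nonneg_right (by positivity)
  · rw [diffs_stress fun q hq' => (hq q hq').1]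
    have h1 := integral_stress_sq_le hA hSL.D_mem hSL.p_mem α i (halfBall d r)
    have h2 := hpress A hA r s hr hrs (by linarith) _ _ _ hSL
    have h3 : P / (s - r) ^ 16 * gradSq (halfBall d s) (fun β j => diffs L (D β j))
        ≤ P / (s - r) ^ 16 * (C * gradSq (halfBall d R) D) :=
      mul_le_mul_of_nonneg_left hb (by positivity)
    have h4 : d ^ 2 * (δ⁻¹) ^ 2 * gradSq (halfBall d r) (fun β j => diffs L (D β j))
        ≤ d ^ 2 * (δ⁻¹) ^ 2 * (C * gradSq (halfBall d R) D) :=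
      mul_le_mul_of_nonneg_left hb' (by positivity)
    have h5 : 0 ≤ C * gradSq (halfBall d R) D := mul_nonneg hC hG
    calc _ ≤ _ := h1
      _ ≤ 2 * (d ^ 2 * (δ⁻¹) ^ 2 * (C * gradSq (halfBall d R) D))
          + 2 * (P / (s - r) ^ 16 * (C * gradSq (halfBall d R) D)) := by linarith
      _ ≤ _ := by linarith

/-- Bounds on all iterated difference quotients of a function bound the derivatives of its
mollifications. -/
theorem lintegral_iterPartial_moll_le {n : ℕ} {r R : ℝ} (hn : r + 3 * molScale n ≤ R) {h₀ B : ℝ}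
    (hh₀ : 0 < h₀) (S : List (Fin d)) {F : Vec d → ℝ} (hF : MemLp F 2 volume)
    (h : ∀ L : List (Fin d × ℝ), L.map Prod.fst = S → (∀ q ∈ L, 0 < q.2 ∧ q.2 < h₀) →
      ∫ x in halfBall d R, diffs L F x ^ 2 ≤ B) :
    ∫⁻ x in halfBall d r, ‖iterPartial S (moll n F) x‖ₑ ^ 2 ≤ ENNReal.ofReal B := by
  induction S generalizing F with
  | nil =>
    simp only [iterPartial]
    rw [← ofReal_integral_sq ((moll_memLp n hF).restrict _)]
    exact ENNReal.ofReal_le_ofReal ((integral_moll_sq_le hF hn).trans (h [] rfl (by simp)))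
  | cons i S ih =>
    have hg := moll_contDiff n hF
    have hgS := iterPartial_contDiff S hg
    set t : ℕ → ℝ := fun k => h₀ / ((k : ℝ) + 2) with ht
    have ht0 : ∀ k, 0 < t k := fun k => by positivity
    have ht1 : ∀ k, t k < h₀ := fun k => by
      rw [ht, div_lt_iff₀ (by positivity)]
      nlinarith [(Nat.cast_nonneg k : (0 : ℝ) ≤ k)]
    have htl : Tendsto t atTop (𝓝 0) :=
      tendsto_const_nhds.div_atTop
        (tendsto_atTop_add_const_right _ _ tendsto_natCast_atTop_atTop)
    -- Difference quotients commute with mollification and with derivatives, so the bound is uniform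
    -- in the step. Fatou's lemma then replaces one difference by a derivative.
    have hk : ∀ k, ∫⁻ x in halfBall d r, ‖diffQ i (t k) (iterPartial S (moll n F)) x‖ₑ ^ 2
        ≤ ENNReal.ofReal B := fun k => by
      rw [← iterPartial_diffQ S i (t k) hg, ← moll_diffQ n i (t k) hF]
      refine ih (diffQ_memLp i (t k) hF) fun L hL hq => ?_
      refine h ((i, t k) :: L) (by simp [hL]) fun q hq' => ?_
      rcases List.mem_cons.1 hq' with rfl | hq'
      · exact ⟨ht0 k, ht1 k⟩
      · exact hq q hq'
    simp only [iterPartial]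
    rw [iterPartial_partialDeriv S hg]
    have hlim : ∀ x, ‖partialDeriv i (iterPartial S (moll n F)) x‖ₑ ^ 2
        = liminf (fun k => ‖diffQ i (t k) (iterPartial S (moll n F)) x‖ₑ ^ 2) atTop := fun x =>
      (((ENNReal.continuous_pow 2).tendsto _).comp
        (diffQ_tendsto i hgS x ht0 htl).enorm).liminf_eq.symm
    simp_rw [hlim]
    refine (lintegral_liminf_le fun k =>
      ((diffQ_contDiff i (t k) hgS).continuous.enorm.measurable.pow_const 2)).trans ?_
    exact liminf_le_of_le (by isBoundedDefault) fun b hb => by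
      obtain ⟨k, hk'⟩ := hb.exists
      exact hk'.trans (hk k)

end Bounds

/-! ### Trading normal for tangential derivatives; regular representatives -/

section IteratedPartial

variable {d : ℕ}

theorem iterPartial_congr_on {E : Set (Vec d)} (hE : IsOpen E) (L : List (Fin d))
    {f g : Vec d → ℝ} (h : Set.EqOn f g E) : Set.EqOn (iterPartial L f) (iterPartial L g) E := by
  induction L generalizing f g with
  | nil => exact h
  | cons i L ih =>
    exact ih fun x hx =>
      partialDeriv_congr_of_eventuallyEq (h.eventuallyEq_of_mem (hE.mem_nhds hx)) i

theorem iterPartial_neg_sum (L : List (Fin d)) {ι : Type*} (s : Finset ι) {g : ι → Vec d → ℝ}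
    (hg : ∀ k, ContDiff ℝ ∞ (g k)) :
    iterPartial L (fun x => -∑ k ∈ s, g k x) = fun x => -∑ k ∈ s, iterPartial L (g k) x := by
  induction L generalizing g with
  | nil => rfl
  | cons i L ih =>
    simp only [iterPartial]
    rw [← ih fun k => partialDeriv_contDiff (hg k) i]
    congr 1
    ext x
    rw [partialDeriv_neg, partialDeriv_sum s fun k _ => hg k]

theorem lintegral_enorm_sq_neg_sum_le {ι : Type*} (s : Finset ι) {g : ι → Vec d → ℝ}
    (hg : ∀ k, Continuous (g k)) (E : Set (Vec d)) {B : ℝ≥0∞}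
    (h : ∀ k ∈ s, ∫⁻ x in E, ‖g k x‖ₑ ^ 2 ≤ B) :
    ∫⁻ x in E, ‖-∑ k ∈ s, g k x‖ₑ ^ 2 ≤ s.card * (s.card * B) := by
  calc ∫⁻ x in E, ‖-∑ k ∈ s, g k x‖ₑ ^ 2 ≤ ∫⁻ x in E, s.card * ∑ k ∈ s, ‖g k x‖ₑ ^ 2 := by
        refine lintegral_mono fun x => ?_
        simp only [enorm_sq_eq_ofReal, neg_sq]
        rw [← ENNReal.ofReal_sum_of_nonneg fun k _ => sq_nonneg _, ← ENNReal.ofReal_natCast,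
          ← ENNReal.ofReal_mul (by positivity)]
        exact ENNReal.ofReal_le_ofReal sq_sum_le_card_mul_sum_sq
    _ = s.card * ∑ k ∈ s, ∫⁻ x in E, ‖g k x‖ₑ ^ 2 := by
        rw [lintegral_const_mul' _ _ (ENNReal.natCast_ne_top _), lintegral_finsetSum _ fun k _ =>
          ((hg k).enorm.measurable.pow_const 2)]
    _ ≤ _ := by
        gcongr
        simpa using Finset.sum_le_card_nsmul s _ B h

end IteratedPartial

section Limit

variable {d : ℕ} [NeZero d]

/-- Uniform bounds on the mollifications pass to a representative of the limit. -/
theorem exists_representative {F : Vec d → ℝ} (hF : MemLp F 2 volume) {E : Set (Vec d)}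
    (hE : MeasurableSet E) {K : ℝ}
    (h : ∀ᶠ n in atTop, (∀ x ∈ E, |moll n F x| ≤ K) ∧
      ∀ x ∈ E, ∀ y ∈ E, |moll n F x - moll n F y| ≤ K * √‖x - y‖) :
    ∃ V : Vec d → ℝ, V =ᵐ[volume.restrict E] F ∧ (∀ x ∈ E, |V x| ≤ K) ∧
      ∀ x ∈ E, ∀ y ∈ E, |V x - V y| ≤ K * √‖x - y‖ := by
  have hL : Tendsto (fun n => eLpNorm (moll n F - F) 2 volume) atTop (𝓝 0) := by
    have h1 : ∀ n, eLpNorm (moll n F - F) 2 volume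
        = ENNReal.ofReal (√(∫ x, (moll n F x - F x) ^ 2)) := fun n => by
      have h2 := ofReal_integral_sq ((moll_memLp n hF).sub hF)
      rw [eLpNorm_eq_lintegral_rpow_enorm_toReal (by norm_num) (by norm_num), Real.sqrt_eq_rpow,
        ← ENNReal.ofReal_rpow_of_nonneg (integral_nonneg fun _ => sq_nonneg _) (by norm_num)]
      simp only [Pi.sub_apply] at h2
      rw [h2]
      simp
    simp_rw [h1]
    have := (moll_tendsto hF).sqrt
    rw [Real.sqrt_zero] at this
    simpa using ENNReal.tendsto_ofReal this
  obtain ⟨φ, hφ, hae⟩ := (tendstoInMeasure_of_tendsto_eLpNorm (by norm_num)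
    (fun n => (moll_memLp n hF).1) hF.1 hL).exists_seq_tendsto_ae
  -- By compactness of [-K, K] the limit along an ultrafilter exists at every point of E, so the
  -- bounds pass to all of E. It agrees with F wherever the subsequence converges to F, that is,
  -- almost everywhere.
  set l : Ultrafilter ℕ := hyperfilter ℕ with hl
  have hlt : (l : Filter ℕ) ≤ atTop := by
    rw [hl, ← Nat.cofinite_eq_atTop]; exact hyperfilter_le_cofinite
  have hφl : ∀ᶠ k in (l : Filter ℕ), (∀ x ∈ E, |moll (φ k) F x| ≤ K) ∧
      ∀ x ∈ E, ∀ y ∈ E, |moll (φ k) F x - moll (φ k) F y| ≤ K * √‖x - y‖ :=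
    hlt (hφ.tendsto_atTop.eventually h)
  have hex : ∀ x, ∃ v, x ∈ E → Tendsto (fun k => moll (φ k) F x) l (𝓝 v) := by
    intro x
    by_cases hx : x ∈ E
    · obtain ⟨v, -, hv⟩ := (isCompact_Icc (a := -K) (b := K)).ultrafilter_le_nhds
        (l.map fun k => moll (φ k) F x) (by
          rw [le_principal_iff]
          exact hφl.mono fun k hk => abs_le.1 (hk.1 x hx))
      exact ⟨v, fun _ => hv⟩
    · exact ⟨0, fun h => absurd h hx⟩
  choose V hV using hex
  refine ⟨V, ?_, fun x hx => ?_, fun x hx y hy => ?_⟩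
  · rw [EventuallyEq, ae_restrict_iff' hE]
    filter_upwards [hae] with x hx hxE
    exact tendsto_nhds_unique (hV x hxE) (hx.mono_left hlt)
  · exact le_of_tendsto (hV x hx).abs (hφl.mono fun k hk => hk.1 x hx)
  · exact le_of_tendsto ((hV x hx).sub (hV y hy)).abs (hφl.mono fun k hk => hk.2 x hx y hy)

end Limit

section Regularity

variable {d : ℕ} [NeZero d] {A : Coeff d} {δ R : ℝ} {u : Fin d → Vec d → ℝ}
  {D : Fin d → Fin d → Vec d → ℝ} {p : Vec d → ℝ}

/-- The equation is tested with the translated kernel times e_i, whose support lies inside the half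
ball. -/
theorem Sol.sum_partialDeriv_moll_stress (hA : IsStronglyElliptic δ A) (hS : Sol A R u D p) {n : ℕ}
    {x : Vec d} (hx : Metric.closedBall (x + (2 * molScale n) • (basisVec 0 : Vec d)) (molScale n)
      ⊆ halfBall d R) (i : Fin d) :
    ∑ α, partialDeriv α (moll n (stress A D p α i)) x = 0 := by
  have hTm := stress_memLp hA hS.D_mem hS.p_mem
  have ht := molTest_isTestFunction n x hx
  have hφ : ∀ k : Fin d, IsTestFunction (Metric.ball 0 R)
      (fun y => (if k = i then 1 else 0) * molTest n x y) := fun k =>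
    ⟨contDiff_const.mul ht.smooth, ht.hasCompactSupport.mul_left,
      tsupport_mul_subset_right.trans (ht.tsupport_subset.trans fun y hy => hy.1)⟩
  have h1 := hS.eq _ hφ
  have h2 : ∀ y, ∑ α, ∑ k, stress A D p α k y *
      partialDeriv α (fun y => (if k = i then 1 else 0) * molTest n x y) y
      = ∑ α, stress A D p α i y * partialDeriv α (molTest n x) y := fun y => by
    refine Finset.sum_congr rfl fun α _ => ?_
    simp_rw [partialDeriv_const_mul _ ht.smooth]
    simp
  simp_rw [h2] at h1
  rw [setIntegral_eq_integral_of_forall_compl_eq_zero] at h1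
  swap
  · intro y hy
    refine Finset.sum_eq_zero fun α _ => ?_
    rw [partialDeriv_eq_zero_of_notMem ht α fun h => hy h.2, mul_zero]
  rw [integral_finsetSum _ fun α _ => integrable_mul_of_memLp (hTm α i) (ht.partialDeriv_memLp α)]
    at h1
  simp_rw [StokesConormal.partialDeriv_moll n (hTm _ i)]
  rw [Finset.sum_neg_distrib, h1, neg_zero]

/-- Bounds on all mixed derivatives of the mollified tangential gradient and of the mollified
normal stress. -/
theorem exists_mixed_bound (d : ℕ) [NeZero d] {δ : ℝ} (hδ : 0 < δ) : ∃ C : ℝ, 0 ≤ C ∧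
    ∀ A : Coeff d, IsStronglyElliptic δ A → ∀ u D p, Sol A 2 u D p → ∀ᶠ n in atTop,
      ∀ S : List (Fin d), S.Nodup →
        (∀ j i, j ≠ 0 → ∫⁻ x in halfBall d (3 / 2), ‖iterPartial S (moll n (D j i)) x‖ₑ ^ 2
          ≤ ENNReal.ofReal (C * gradSq (halfBall d 2) D)) ∧
        (∀ i, ∫⁻ x in halfBall d (3 / 2), ‖iterPartial S (moll n (stress A D p 0 i)) x‖ₑ ^ 2
          ≤ ENNReal.ofReal (C * gradSq (halfBall d 2) D)) := by
  obtain ⟨C, h₀, hC, hh₀, hbd⟩ := exists_diffs_bound d hδ (r := 7 / 4) (R := 2) (by norm_num)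
    (by norm_num) le_rfl
  refine ⟨(1 + d * d) * C, by positivity, fun A hA u D p hS => ?_⟩
  have hG := gradSq_nonneg (halfBall d 2) D
  set G := gradSq (halfBall d 2) D with hGdef
  have hTm := stress_memLp hA hS.D_mem hS.p_mem
  have hle : C * G ≤ (1 + d * d) * C * G := by
    have : 0 ≤ (d : ℝ) * d * (C * G) := by positivity
    linarith
  filter_upwards [eventually_molScale (show (3 / 2 : ℝ) < 7 / 4 by norm_num)] with n hn
  have hn2 : 3 / 2 + 3 * molScale n ≤ 2 := by linarith
  have hsten : ∀ x ∈ halfBall d (3 / 2),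
      Metric.closedBall (x + (2 * molScale n) • (basisVec 0 : Vec d)) (molScale n)
        ⊆ halfBall d 2 := fun x hx =>
    stencil_subset_halfBall (mem_halfBall.1 hx).1 (mem_halfBall.1 hx).2.le hn2
  have hdir : ∀ {S : List (Fin d)} {L : List (Fin d × ℝ)}, 0 ∉ S → L.map Prod.fst = S →
      (∀ q ∈ L, 0 < q.2 ∧ q.2 < h₀) → ∀ q ∈ L, q.1 ≠ 0 ∧ 0 < q.2 ∧ q.2 < h₀ := by
    rintro _ L h0 rfl hq q hqL
    exact ⟨fun h => h0 (h ▸ List.mem_map_of_mem hqL), hq q hqL⟩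
  have hlen : ∀ {S : List (Fin d)} {L : List (Fin d × ℝ)}, S.length ≤ d → L.map Prod.fst = S →
      L.length ≤ d := by
    rintro _ L h rfl; simpa using h
  have tanD : ∀ S : List (Fin d), S.length ≤ d → 0 ∉ S → ∀ β j,
      ∫⁻ x in halfBall d (3 / 2), ‖iterPartial S (moll n (D β j)) x‖ₑ ^ 2
        ≤ ENNReal.ofReal (C * G) := fun S hS1 hS0 β j =>
    lintegral_iterPartial_moll_le hn hh₀ S (hS.D_mem β j) fun L hL hq =>
      (hbd A hA u D p hS L (hlen hS1 hL) (hdir hS0 hL hq)).1 β j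
  have tanT : ∀ S : List (Fin d), S.length ≤ d → 0 ∉ S → ∀ α i,
      ∫⁻ x in halfBall d (3 / 2), ‖iterPartial S (moll n (stress A D p α i)) x‖ₑ ^ 2
        ≤ ENNReal.ofReal (C * G) := fun S hS1 hS0 α i =>
    lintegral_iterPartial_moll_le hn hh₀ S (hTm α i) fun L hL hq =>
      (hbd A hA u D p hS L (hlen hS1 hL) (hdir hS0 hL hq)).2 α i
  intro S hSn
  have hSlen : S.length ≤ d := by simpa using hSn.length_le_card
  -- A list without the normal direction is covered by the tangential bounds. Otherwise the normal
  -- direction occurs exactly once and is exchanged for a tangential one. The new direction may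
  -- repeat an entry of the list, which the tangential bounds allow.
  by_cases h0 : 0 ∈ S
  swap
  · exact ⟨fun j i _ => (tanD S hSlen h0 j i).trans (ENNReal.ofReal_le_ofReal hle),
      fun i => (tanT S hSlen h0 0 i).trans (ENNReal.ofReal_le_ofReal hle)⟩
  have hperm := List.perm_cons_erase h0
  set S' := S.erase 0 with hS'
  have h0' : 0 ∉ S' := hSn.not_mem_erase
  have hlen' : S'.length + 1 ≤ d := by
    have := hperm.length_eq
    simp only [List.length_cons] at this
    omega
  refine ⟨fun j i hj => ?_, fun i => ?_⟩
  · have hcu := moll_contDiff n (hS.u_mem i)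
    have hcD := fun β => moll_contDiff n (hS.D_mem β i)
    have e1 : ∀ β, Set.EqOn (moll n (D β i)) (partialDeriv β (moll n (u i))) (halfBall d (3 / 2)) :=
      fun β x hx => (hS.partialDeriv_moll (hsten x hx) β i).symm
    -- Symmetry of second derivatives of the mollified u: D₁D_ju = D_jD₁u.
    have e2 : Set.EqOn (iterPartial S (moll n (D j i))) (iterPartial (j :: S') (moll n (D 0 i)))
        (halfBall d (3 / 2)) := by
      rw [iterPartial_perm hperm (hcD j)]
      refine iterPartial_congr_on (isOpen_halfBall _) S' ?_
      intro x hx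
      have a1 := iterPartial_congr_on (isOpen_halfBall _) [0] (e1 j) hx
      have a2 := iterPartial_congr_on (isOpen_halfBall _) [j] (e1 0) hx
      simp only [iterPartial] at a1 a2
      rw [a1, a2, partialDeriv_comm hcu]
    rw [setLIntegral_congr_fun (measurableSet_halfBall _) fun x hx => by rw [e2 hx]]
    exact (tanD (j :: S') (by simpa using hlen') (by simp [hj.symm, h0']) 0 i).trans
      (ENNReal.ofReal_le_ofReal hle)
  · have hcT := fun α => moll_contDiff n (hTm α i)
    -- The equation expresses the normal derivative of the normal stress through tangential
    -- derivatives of the other stresses.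
    have e2 : Set.EqOn (iterPartial S (moll n (stress A D p 0 i)))
        (fun x => -∑ α ∈ Finset.univ.erase 0, iterPartial (α :: S') (moll n (stress A D p α i)) x)
        (halfBall d (3 / 2)) := by
      rw [iterPartial_perm hperm (hcT 0)]
      simp only [iterPartial]
      rw [← iterPartial_neg_sum S' (Finset.univ.erase 0)
        fun α => partialDeriv_contDiff (hcT α) α]
      refine iterPartial_congr_on (isOpen_halfBall _) S' fun x hx => ?_
      have := hS.sum_partialDeriv_moll_stress hA (hsten x hx) i
      rw [← Finset.add_sum_erase _ _ (Finset.mem_univ 0)] at this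
      linarith
    rw [setLIntegral_congr_fun (measurableSet_halfBall _) fun x hx => by rw [e2 hx]]
    refine (lintegral_enorm_sq_neg_sum_le (Finset.univ.erase 0)
      (fun α => (iterPartial_contDiff (α :: S') (hcT α)).continuous) _ fun α hα =>
        tanT (α :: S') (by simpa using hlen') (by
          simp [(Finset.ne_of_mem_erase hα).symm, h0']) α i).trans ?_
    rw [← ENNReal.ofReal_natCast, ← ENNReal.ofReal_mul (by positivity),
      ← ENNReal.ofReal_mul (by positivity)]
    refine ENNReal.ofReal_le_ofReal ?_
    have hc : ((Finset.univ.erase (0 : Fin d)).card : ℝ) ≤ d := by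
      exact_mod_cast (Finset.card_le_univ _).trans (by simp)
    have hCG : 0 ≤ C * G := mul_nonneg hC hG
    calc _ ≤ (d : ℝ) * (d * (C * G)) := by gcongr
      _ ≤ _ := by linarith

/-- Interior estimates up to the flat boundary for the tangential gradient and the normal
stress. -/
theorem exists_regular_representatives (d : ℕ) [NeZero d] {δ : ℝ} (hδ : 0 < δ) : ∃ C : ℝ, 0 ≤ C ∧
    ∀ A : Coeff d, IsStronglyElliptic δ A → ∀ u D p, Sol A 2 u D p →
      ∀ F : Vec d → ℝ, ((∃ j i, j ≠ 0 ∧ F = D j i) ∨ ∃ i, F = stress A D p 0 i) →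
      ∃ V : Vec d → ℝ, V =ᵐ[volume.restrict (halfBall d 1)] F ∧
        (∀ x ∈ halfBall d 1, |V x| ≤ C * √(gradSq (halfBall d 2) D)) ∧
        ∀ x ∈ halfBall d 1, ∀ y ∈ halfBall d 1,
          |V x - V y| ≤ C * √(gradSq (halfBall d 2) D) * √‖x - y‖ := by
  obtain ⟨C, hC, hmix⟩ := exists_mixed_bound d hδ
  obtain ⟨K, hK, hhol⟩ := exists_holder_bound d
  refine ⟨K * √C, by positivity, fun A hA u D p hS F hF => ?_⟩
  have hG := gradSq_nonneg (halfBall d 2) D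
  have hFm : MemLp F 2 volume := by
    rcases hF with ⟨j, i, -, rfl⟩ | ⟨i, rfl⟩
    · exact hS.D_mem j i
    · exact stress_memLp hA hS.D_mem hS.p_mem 0 i
  refine exists_representative hFm (measurableSet_halfBall 1) ?_
  filter_upwards [hmix A hA u D p hS] with n hn
  have := hhol (moll n F) (moll_contDiff n hFm) (C * gradSq (halfBall d 2) D) (by positivity)
    fun S hSn => by
      rcases hF with ⟨j, i, hj, rfl⟩ | ⟨i, rfl⟩
      · exact (hn S hSn).1 j i hj
      · exact (hn S hSn).2 i
  rwa [Real.sqrt_mul hC, ← mul_assoc] at this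

/-- The tangential gradient and the normal stress control the normal derivative and the
pressure. -/
theorem abs_le_of_tangential (hδ : 0 < δ) (hA : IsStronglyElliptic δ A) {x : Vec d} {K : ℝ}
    (hdiv : ∑ i, D i i x = 0) (hD : ∀ j i, j ≠ 0 → |D j i x| ≤ K)
    (hT : ∀ i, |stress A D p 0 i x| ≤ K) :
    (∀ j i, |D j i x| ≤ (1 + d + d * (1 + d ^ 3 * δ⁻¹) / δ) * K) ∧
      |p x| ≤ (1 + d ^ 2 * δ⁻¹ * (1 + d + d * (1 + d ^ 3 * δ⁻¹) / δ)) * K := by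
  have hK : 0 ≤ K := (abs_nonneg _).trans (hT 0)
  have hd1 : (1 : ℝ) ≤ d := Nat.one_le_cast.2 (Nat.pos_of_ne_zero (NeZero.ne d))
  have h00 : |D 0 0 x| ≤ d * K := by
    rw [← Finset.add_sum_erase _ _ (Finset.mem_univ (0 : Fin d))] at hdiv
    rw [eq_neg_of_add_eq_zero_left hdiv, abs_neg]
    refine (Finset.abs_sum_le_sum_abs _ _).trans ((Finset.sum_le_card_nsmul _ _ K fun i hi =>
      hD i i (Finset.ne_of_mem_erase hi)).trans ?_)
    rw [nsmul_eq_mul]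
    have hc : ((Finset.univ.erase (0 : Fin d)).card : ℝ) ≤ d := by
      exact_mod_cast (Finset.card_le_univ _).trans (by simp)
    gcongr
  have hsum : ∀ (B : Fin d → Fin d → ℝ) (M : ℝ) (α i : Fin d), (∀ β j, |B β j| ≤ M) →
      |∑ β, ∑ j, A (x 0) α β i j * B β j| ≤ d ^ 2 * δ⁻¹ * M := by
    intro B M α i hB
    have h1 : ∀ β j, |A (x 0) α β i j * B β j| ≤ δ⁻¹ * M := fun β j => by
      rw [abs_mul]
      exact mul_le_mul (hA.bounded _ _ _ _ _) (hB β j) (abs_nonneg _) (inv_nonneg.2 hδ.le)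
    refine (Finset.abs_sum_le_sum_abs _ _).trans ((Finset.sum_le_sum fun β _ =>
      (Finset.abs_sum_le_sum_abs _ _).trans (Finset.sum_le_sum fun j _ => h1 β j)).trans ?_)
    simp only [Finset.sum_const, Finset.card_univ, Fintype.card_fin, nsmul_eq_mul]
    exact le_of_eq (by ring)
  -- `w` holds the entries of D₁u still unknown, those other than D₁u₁; `B` holds the entries
  -- already bounded.
  set w : Vec d := WithLp.toLp 2 fun j => if j = 0 then 0 else D 0 j x with hw
  set B : Fin d → Fin d → ℝ := fun β j => D β j x - if β = 0 then w j else 0 with hBdef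
  have hB : ∀ β j, |B β j| ≤ d * K := by
    intro β j
    by_cases hβ : β = 0
    · subst hβ
      by_cases hj : j = 0
      · subst hj; simpa [hBdef, hw] using h00
      · simp only [hBdef, hw, if_true, hj, if_false, sub_self, abs_zero]; positivity
    · simp only [hBdef, hβ, if_false, sub_zero]
      exact (hD β j hβ).trans (le_mul_of_one_le_left hK hd1)
  -- The pressure enters only the first component of the normal stress, so the other components
  -- bound A¹¹w.
  have hflux : ∀ i, i ≠ 0 → |∑ j, A (x 0) 0 0 i j * w j| ≤ (1 + d ^ 3 * δ⁻¹) * K := by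
    intro i hi
    have e1 : ∑ j, A (x 0) 0 0 i j * w j
        = stress A D p 0 i x - ∑ β, ∑ j, A (x 0) 0 β i j * B β j := by
      simp only [stress, flux, hi.symm, if_false, zero_mul, add_zero, hBdef, mul_sub,
        Finset.sum_sub_distrib, sub_sub_cancel]
      simp
    rw [e1]
    have h1 := abs_sub (stress A D p 0 i x) (∑ β, ∑ j, A (x 0) 0 β i j * B β j)
    have h2 := hsum B _ 0 i hB
    have h3 := hT i
    calc _ ≤ K + d ^ 2 * δ⁻¹ * (d * K) := by linarith
      _ = _ := by ring
  have hwi : ∀ i, |w i| ≤ ‖w‖ := fun i => by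
    simpa using PiLp.norm_apply_le w i
  -- Ellipticity with a single nonzero vector gives δ|w|² ≤ A¹¹w·w. As the first component of w is
  -- zero, only the bounded components of A¹¹w enter.
  have hell := hA.elliptic (x 0) (fun α => if α = 0 then w else 0)
  have e2 : ∑ α : Fin d, ‖(if α = 0 then w else 0 : Vec d)‖ ^ 2 = ‖w‖ ^ 2 := by
    rw [Finset.sum_eq_single 0] <;> simp +contextual
  have e3 : ∑ α, ∑ β, ∑ i, ∑ j, A (x 0) α β i j * (if β = 0 then w else 0 : Vec d) j
      * (if α = 0 then w else 0 : Vec d) i = ∑ i, (∑ j, A (x 0) 0 0 i j * w j) * w i := by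
    rw [Finset.sum_eq_single 0 (fun α _ hα => by simp [hα]) (by simp),
      Finset.sum_eq_single 0 (fun β _ hβ => by simp [hβ]) (by simp)]
    simp only [if_true, Finset.sum_mul]
  rw [e2, e3] at hell
  have h5 : ∑ i, (∑ j, A (x 0) 0 0 i j * w j) * w i
      ≤ d * ((1 + d ^ 3 * δ⁻¹) * K * ‖w‖) := by
    refine (Finset.sum_le_card_nsmul _ _ ((1 + d ^ 3 * δ⁻¹) * K * ‖w‖) fun i _ => ?_).trans ?_
    · refine (le_abs_self _).trans ?_
      rw [abs_mul]
      by_cases hi : i = 0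
      · subst hi
        simp only [hw, if_true, abs_zero, mul_zero]
        positivity
      · exact mul_le_mul (hflux i hi) (hwi i) (abs_nonneg _) (by positivity)
    · simp
  have h6 : ‖w‖ ≤ d * (1 + d ^ 3 * δ⁻¹) / δ * K := by
    rcases (norm_nonneg w).eq_or_lt with h | h
    · rw [← h]; positivity
    · have h7 : δ * ‖w‖ ≤ d * ((1 + d ^ 3 * δ⁻¹) * K) := by
        refine le_of_mul_le_mul_right ?_ h
        calc δ * ‖w‖ * ‖w‖ = δ * ‖w‖ ^ 2 := by ring
          _ ≤ _ := hell.trans h5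
          _ = _ := by ring
      rw [div_mul_eq_mul_div, le_div_iff₀ hδ]
      linarith
  have hQ : 0 ≤ d * (1 + d ^ 3 * δ⁻¹) / δ * K := by positivity
  have hdK : 0 ≤ d * K := by positivity
  have hall : ∀ j i, |D j i x| ≤ (1 + d + d * (1 + d ^ 3 * δ⁻¹) / δ) * K := by
    intro j i
    rw [add_mul, add_mul, one_mul]
    by_cases hj : j = 0
    · subst hj
      by_cases hi : i = 0
      · subst hi; linarith
      · have := hwi i
        simp only [hw, hi, if_false] at this
        linarith
    · linarith [hD j i hj]
  refine ⟨hall, ?_⟩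
  have e4 : p x = stress A D p 0 0 x - ∑ β, ∑ j, A (x 0) 0 β 0 j * D β j x := by
    simp [stress, flux]
  rw [e4]
  have h8 := abs_sub (stress A D p 0 0 x) (∑ β, ∑ j, A (x 0) 0 β 0 j * D β j x)
  have h9 := hsum (fun β j => D β j x) _ 0 0 hall
  have h10 := hT 0
  rw [add_mul, one_mul, mul_assoc]
  linarith

end Regularity

/-! ### From the weak formulation to componentwise solutions -/

section TestFields

variable {d : ℕ}

theorem classicalGrad_continuous {φ : Vec d → Vec d} (hφ : ContDiff ℝ ∞ φ) :
    Continuous (classicalGrad φ) := by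
  refine (PiLp.continuous_toLp 2 _).comp (continuous_pi fun k => ?_)
  exact (partialDeriv_contDiff ((EuclideanSpace.proj k.2 : Vec d →L[ℝ] ℝ).contDiff.comp hφ)
    k.1).continuous

theorem classicalGrad_hasCompactSupport {φ : Vec d → Vec d} (hc : HasCompactSupport φ) :
    HasCompactSupport (classicalGrad φ) := by
  refine hc.mono' fun x hx => ?_
  by_contra h
  refine hx ?_
  ext k
  have h1 : (fun y => φ y k.2) =ᶠ[𝓝 x] fun _ => 0 := by
    filter_upwards [notMem_tsupport_iff_eventuallyEq.1 h] with y hy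
    simp [hy]
  simp only [classicalGrad]
  rw [partialDeriv_congr_of_eventuallyEq h1]
  simp [partialDeriv]

theorem integral_mul_partialDeriv {f g : Vec d → ℝ} (hf : ContDiff ℝ ∞ f)
    (hfc : HasCompactSupport f) (hg : ContDiff ℝ ∞ g) (i : Fin d) :
    ∫ x, f x * partialDeriv i g x = -∫ x, partialDeriv i f x * g x := by
  have hf' := partialDeriv_contDiff hf i
  have hg' := partialDeriv_contDiff hg i
  have hfc' := hasCompactSupport_partialDeriv hfc i
  exact integral_mul_fderiv_eq_neg_fderiv_mul_of_integrable
    ((hf'.continuous.mul hg.continuous).integrable_of_hasCompactSupport hfc'.mul_right)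
    ((hf.continuous.mul hg'.continuous).integrable_of_hasCompactSupport hfc.mul_right)
    ((hf.continuous.mul hg.continuous).integrable_of_hasCompactSupport hfc.mul_right)
    (fun x _ => hf.differentiable (by simp) x) (fun x _ => hg.differentiable (by simp) x)

theorem IsTestFunction.isW12Zero {Ω : Set (Vec d)} {φ : Vec d → Vec d} (hφ : IsTestFunction Ω φ) :
    IsW12Zero Ω φ (classicalGrad φ) where
  isW12 :=
    { memLp := (hφ.smooth.continuous.memLp_of_hasCompactSupport hφ.hasCompactSupport).restrict _
      memLp_grad := ((classicalGrad_continuous hφ.smooth).memLp_of_hasCompactSupport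
        (classicalGrad_hasCompactSupport hφ.hasCompactSupport)).restrict _
      hasWeakPartial := fun β j => by
        have hs : ContDiff ℝ ∞ fun x => φ x j :=
          (EuclideanSpace.proj j : Vec d →L[ℝ] ℝ).contDiff.comp hφ.smooth
        have hc : HasCompactSupport fun x => φ x j :=
          hφ.hasCompactSupport.comp_left (g := fun v : Vec d => v j) rfl
        refine ⟨(hs.continuous.locallyIntegrable).locallyIntegrableOn _,
          ((partialDeriv_contDiff hs β).continuous.locallyIntegrable).locallyIntegrableOn _,
          fun ψ hψ => ?_⟩
        rw [setIntegral_eq_integral_of_forall_compl_eq_zero fun x hx => by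
            rw [partialDeriv_eq_zero_of_notMem hψ β hx, mul_zero],
          setIntegral_eq_integral_of_forall_compl_eq_zero fun x hx => by
            rw [image_eq_zero_of_notMem_tsupport fun h => hx (hψ.tsupport_subset h), mul_zero]]
        exact integral_mul_partialDeriv hs hc hψ.smooth β }
  exists_approx := ⟨fun _ => φ, fun _ => hφ, by simp, by simp⟩

end TestFields

section Conversion

variable {d : ℕ} [NeZero d] {A : Coeff d} {δ R : ℝ} {u : Vec d → Vec d} {Du : Vec d → Grad d}
  {p : Vec d → ℝ}

/-- Extension by zero is harmless: the weak gradient is tested only inside the half ball, and test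
fields of the equation vanish outside the full ball. -/
theorem IsConormalStokesSolution.sol (hA : IsStronglyElliptic δ A)
    (h : IsConormalStokesSolution A R u Du p) :
    Sol A R (fun j => (halfBall d R).indicator fun x => u x j)
      (fun β j => (halfBall d R).indicator fun x => Du x (β, j)) ((halfBall d R).indicator p) where
  u_mem j := (memLp_indicator_iff_restrict (measurableSet_halfBall R)).2
    ((EuclideanSpace.proj j : Vec d →L[ℝ] ℝ).comp_memLp' h.isW12.memLp)
  D_mem β j := (memLp_indicator_iff_restrict (measurableSet_halfBall R)).2
    ((EuclideanSpace.proj (β, j) : Grad d →L[ℝ] ℝ).comp_memLp' h.isW12.memLp_grad)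
  p_mem := (memLp_indicator_iff_restrict (measurableSet_halfBall R)).2 h.memLp_pressure
  weak β j φ hφ := by
    simp_rw [← Set.indicator_mul_left]
    rw [integral_indicator (measurableSet_halfBall R), integral_indicator (measurableSet_halfBall R)]
    exact (h.isW12.hasWeakPartial β j).integral_eq φ hφ
  div_eq := by
    filter_upwards [(ae_restrict_iff' (measurableSet_halfBall R)).1 h.div_eq_zero] with x hx hxR
    simpa [Set.indicator_of_mem hxR] using hx hxR
  eq φ hφ := by
    have hDm : ∀ β j, MemLp ((halfBall d R).indicator fun x => Du x (β, j)) 2 volume := fun β j =>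
      (memLp_indicator_iff_restrict (measurableSet_halfBall R)).2
        ((EuclideanSpace.proj (β, j) : Grad d →L[ℝ] ℝ).comp_memLp' h.isW12.memLp_grad)
    have hpm : MemLp ((halfBall d R).indicator p) 2 volume :=
      (memLp_indicator_iff_restrict (measurableSet_halfBall R)).2 h.memLp_pressure
    have hΦ : IsTestFunction (Metric.ball 0 R) (fun x => (WithLp.toLp 2 fun i => φ i x : Vec d)) := by
      have hz : ∀ x, x ∉ (⋃ i, tsupport (φ i)) → (WithLp.toLp 2 fun i => φ i x : Vec d) = 0 := by
        intro x hx
        ext i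
        exact image_eq_zero_of_notMem_tsupport (f := φ i) fun h => hx (Set.mem_iUnion.2 ⟨i, h⟩)
      have hcomp : IsCompact (⋃ i, tsupport (φ i)) :=
        isCompact_iUnion fun i => (hφ i).hasCompactSupport
      refine ⟨(contDiff_piLp _).2 fun i => (hφ i).smooth, HasCompactSupport.intro hcomp hz, ?_⟩
      refine (closure_minimal (fun x hx => ?_) hcomp.isClosed).trans
        (Set.iUnion_subset fun i => (hφ i).tsupport_subset)
      by_contra h
      exact hx (hz x h)
    have h1 := h.weak_eq _ _ hΦ.isW12Zero
    rw [setIntegral_halfSpace_eq (R := R) fun x hx => by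
      simp [partialDeriv_eq_zero_of_notMem (hφ _) _ hx]]
    rw [← h1]
    have e1 : ∫ x in halfBall d R, ∑ α, ∑ β, ∑ i, ∑ j, A (x 0) α β i j * Du x (β, j)
          * classicalGrad (fun x => (WithLp.toLp 2 fun i => φ i x : Vec d)) x (α, i)
        = ∫ x in halfBall d R, ∑ α, ∑ i,
          flux A (fun β j => (halfBall d R).indicator fun x => Du x (β, j)) α i x
            * partialDeriv α (φ i) x := by
      refine setIntegral_congr_fun (measurableSet_halfBall R) fun x hx => ?_
      simp only [flux, Set.indicator_of_mem hx, classicalGrad]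
      refine Finset.sum_congr rfl fun α _ => ?_
      rw [Finset.sum_comm]
      simp only [Finset.sum_mul]
    have e2 : ∫ x in halfBall d R, p x * ∑ i,
          classicalGrad (fun x => (WithLp.toLp 2 fun i => φ i x : Vec d)) x (i, i)
        = ∫ x in halfBall d R, (halfBall d R).indicator p x * ∑ i, partialDeriv i (φ i) x := by
      refine setIntegral_congr_fun (measurableSet_halfBall R) fun x hx => ?_
      simp only [Set.indicator_of_mem hx, classicalGrad]
    rw [e1, e2, ← integral_add]
    · congr 1; ext x
      rw [sum_stress_mul]
    · exact integrable_finsetSum _ fun α _ => integrable_finsetSum _ fun i _ =>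
        integrable_mul_of_memLp ((flux_memLp hA hDm α i).restrict _)
          (((hφ i).partialDeriv_memLp α).restrict _)
    · exact integrable_mul_of_memLp (hpm.restrict _)
        ((memLp_finsetSum _ fun i _ => (hφ i).partialDeriv_memLp i).restrict _)

end Conversion

/-! ### Norms of vector valued functions and the final estimate -/

section Assembly

variable {d : ℕ}

theorem norm_le_card_mul {ι : Type*} [Fintype ι] {v : EuclideanSpace ℝ ι} {M : ℝ} (hM : 0 ≤ M)
    (h : ∀ k, |v k| ≤ M) : ‖v‖ ≤ Fintype.card ι * M := by
  have h1 : ‖v‖ ^ 2 ≤ Fintype.card ι * M ^ 2 := by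
    rw [EuclideanSpace.norm_sq_eq]
    refine (Finset.sum_le_card_nsmul _ _ (M ^ 2) fun k _ => ?_).trans (by simp)
    rw [Real.norm_eq_abs]
    exact pow_le_pow_left₀ (abs_nonneg _) (h k) 2
  refine abs_le_of_sq_le_sq' ?_ (by positivity) |>.2
  refine h1.trans ?_
  rw [mul_pow]
  have : (Fintype.card ι : ℝ) ≤ (Fintype.card ι : ℝ) ^ 2 := by
    exact_mod_cast Nat.le_self_pow two_ne_zero _
  gcongr

theorem sqrt_gradSq_le {Du : Vec d → Grad d} {E : Set (Vec d)} (hE : MeasurableSet E)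
    (h : MemLp Du 2 (volume.restrict E)) :
    √(gradSq E fun β j => E.indicator fun x => Du x (β, j))
      ≤ d * (eLpNorm Du 2 (volume.restrict E)).toReal := by
  refine Real.sqrt_le_iff.2 ⟨by positivity, ?_⟩
  have hk : ∀ β j, ∫ x in E, (E.indicator (fun x => Du x (β, j)) x) ^ 2
      ≤ (eLpNorm Du 2 (volume.restrict E)).toReal ^ 2 := by
    intro β j
    have e1 : ∫ x in E, (E.indicator (fun x => Du x (β, j)) x) ^ 2
        = ∫ x in E, (Du x (β, j)) ^ 2 :=
      setIntegral_congr_fun hE fun x hx => by simp only [Set.indicator_of_mem hx]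
    have hm : MemLp (fun x => Du x (β, j)) 2 (volume.restrict E) :=
      (EuclideanSpace.proj (β, j) : Grad d →L[ℝ] ℝ).comp_memLp' h
    have h2 : eLpNorm Du 2 (volume.restrict E) ^ 2 = ∫⁻ x in E, ‖Du x‖ₑ ^ 2 := by
      rw [eLpNorm_eq_lintegral_rpow_enorm_toReal (by norm_num) (by norm_num), ← ENNReal.rpow_natCast,
        ← ENNReal.rpow_mul]
      simp
    rw [e1, ← ENNReal.toReal_pow, h2]
    refine (ENNReal.ofReal_le_iff_le_toReal (by
      rw [← h2]; exact ENNReal.pow_ne_top h.2.ne)).1 ?_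
    rw [ofReal_integral_sq hm]
    refine lintegral_mono fun x => ?_
    gcongr
    rw [enorm_le_iff_norm_le]
    exact PiLp.norm_apply_le (Du x) (β, j)
  refine (Finset.sum_le_sum fun β _ => Finset.sum_le_sum fun j _ => hk β j).trans (le_of_eq ?_)
  simp only [Finset.sum_const, Finset.card_univ, Fintype.card_fin, nsmul_eq_mul]
  ring

theorem holderSeminorm_half_le {ι : Type*} [Fintype ι] {E : Set (Vec d)}
    {f : Vec d → EuclideanSpace ℝ ι} {M : ℝ} (hM : 0 ≤ M)
    (h : ∀ k, ∀ x ∈ E, ∀ y ∈ E, |f x k - f y k| ≤ M * √‖x - y‖) :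
    holderSeminorm (1 / 2) E f ≤ ENNReal.ofReal (Fintype.card ι * M) := by
  refine HolderWith.eHolderNorm_le (C := (Fintype.card ι * M).toNNReal) fun x y => ?_
  have h1 : ‖f x - f y‖ ≤ Fintype.card ι * (M * √‖(x : Vec d) - y‖) :=
    norm_le_card_mul (by positivity) fun k => h k x x.2 y y.2
  have h2 : edist x y ^ (((1 / 2 : ℝ≥0)) : ℝ) = ENNReal.ofReal (√‖(x : Vec d) - y‖) := by
    rw [Subtype.edist_eq, edist_dist, dist_eq_norm, ENNReal.ofReal_rpow_of_nonneg (norm_nonneg _)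
      (by positivity), Real.sqrt_eq_rpow]
    norm_num
  rw [h2, edist_dist, dist_eq_norm]
  change _ ≤ ENNReal.ofReal (Fintype.card ι * M) * _
  rw [← ENNReal.ofReal_mul (by positivity)]
  exact ENNReal.ofReal_le_ofReal (h1.trans (le_of_eq (by ring)))

end Assembly

end StokesConormal

end

open StokesConormal in
theorem lemma4p3 (d : ℕ) [NeZero d] (hd : 2 ≤ d) (δ : ℝ) (hδ : 0 < δ) (hδ1 : δ ≤ 1) :
    ∃ N : ℝ≥0, ∀ (A : StokesConormal.Coeff d), StokesConormal.IsStronglyElliptic δ A →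
      ∀ (u : StokesConormal.Vec d → StokesConormal.Vec d)
        (Du : StokesConormal.Vec d → StokesConormal.Grad d) (p : StokesConormal.Vec d → ℝ),
        StokesConormal.IsConormalStokesSolution A 2 u Du p →
        ∃ (V : StokesConormal.Vec d → StokesConormal.TanGrad d)
          (W : StokesConormal.Vec d → StokesConormal.Vec d),
          V =ᵐ[volume.restrict (StokesConormal.halfBall d 1)] StokesConormal.tanGrad Du ∧
          W =ᵐ[volume.restrict (StokesConormal.halfBall d 1)] StokesConormal.conormalU A Du p ∧
          eLpNorm Du ∞ (volume.restrict (StokesConormal.halfBall d 1))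
              + eLpNorm p ∞ (volume.restrict (StokesConormal.halfBall d 1))
              + StokesConormal.holderSeminorm (1 / 2) (StokesConormal.halfBall d 1) V
              + StokesConormal.holderSeminorm (1 / 2) (StokesConormal.halfBall d 1) W
            ≤ (N : ℝ≥0∞) * eLpNorm Du 2 (volume.restrict (StokesConormal.halfBall d 2)) := by
  obtain ⟨C, hC, hreg⟩ := exists_regular_representatives d hδ
  set a : ℝ := 1 + d + d * (1 + d ^ 3 * δ⁻¹) / δ with ha
  set b : ℝ := 1 + d ^ 2 * δ⁻¹ * a with hb
  have ha0 : 0 ≤ a := by positivity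
  have hb0 : 0 ≤ b := by positivity
  -- The four summands come from Du, p, the tangential gradient and U, where vector norms are
  -- bounded through the number of components. The factor C·d converts the componentwise bound into
  -- the L² norm of Du.
  refine ⟨((d * d * a + b + d * d + d) * (C * d)).toNNReal, fun A hA u Du p hsol => ?_⟩
  set E := halfBall d 2 with hE
  have hS := hsol.sol hA
  set D : Fin d → Fin d → Vec d → ℝ := fun β j => E.indicator fun x => Du x (β, j) with hD
  set q : Vec d → ℝ := E.indicator p with hq
  set K := C * √(gradSq E D) with hK
  set e := (eLpNorm Du 2 (volume.restrict E)).toReal with he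
  have hK0 : 0 ≤ K := by positivity
  have hKe : K ≤ C * d * e := by
    rw [mul_assoc]
    exact mul_le_mul_of_nonneg_left
      (sqrt_gradSq_le (measurableSet_halfBall 2) hsol.isW12.memLp_grad) hC
  have hVex : ∀ k : {β : Fin d // β ≠ 0} × Fin d, _ := fun k =>
    hreg A hA _ D q hS (D k.1.1 k.2) (Or.inl ⟨k.1.1, k.2, k.1.2, rfl⟩)
  have hWex : ∀ i : Fin d, _ := fun i => hreg A hA _ D q hS (stress A D q 0 i) (Or.inr ⟨i, rfl⟩)
  choose V hVae hVb hVh using hVex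
  choose W hWae hWb hWh using hWex
  have hmem : ∀ᵐ x ∂volume.restrict (halfBall d 1), x ∈ halfBall d 1 :=
    ae_restrict_mem (measurableSet_halfBall 1)
  have hVall := ae_all_iff.2 hVae
  have hWall := ae_all_iff.2 hWae
  have hsub : halfBall d 1 ⊆ E := halfBall_mono (by norm_num)
  have hbound : ∀ᵐ x ∂volume.restrict (halfBall d 1),
      (∀ j i, |D j i x| ≤ a * K) ∧ |q x| ≤ b * K := by
    filter_upwards [hmem, hVall, hWall, ae_restrict_of_ae hS.div_eq] with x hx hV hW hdiv
    refine abs_le_of_tangential hδ hA (hdiv (hsub hx)) (fun j i hj => ?_) fun i => ?_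
    · rw [← hV (⟨j, hj⟩, i)]
      exact hVb _ x hx
    · rw [← hW i]
      exact hWb i x hx
  refine ⟨fun x => WithLp.toLp 2 fun k => V k x, fun x => WithLp.toLp 2 fun i => W i x, ?_, ?_, ?_⟩
  · filter_upwards [hmem, hVall] with x hx hV
    ext k
    simp [tanGrad, hV k, hD, Set.indicator_of_mem (hsub hx)]
  · filter_upwards [hmem, hWall] with x hx hW
    ext i
    simp only [hW i, conormalU, stress, flux, hD, hq, Set.indicator_of_mem (hsub hx),
      PiLp.add_apply, PiLp.single_apply]
    by_cases hi : i = 0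
    · simp [hi]
    · simp [hi, Ne.symm hi]
  have t1 : eLpNorm Du ∞ (volume.restrict (halfBall d 1)) ≤ ENNReal.ofReal (d * d * (a * K)) := by
    rw [eLpNorm_exponent_top]
    refine eLpNormEssSup_le_of_ae_bound ?_
    filter_upwards [hmem, hbound] with x hx hxb
    have := norm_le_card_mul (v := Du x) (M := a * K) (by positivity) fun k => by
      have := hxb.1 k.1 k.2
      simpa [hD, Set.indicator_of_mem (hsub hx)] using this
    simpa using this
  have t2 : eLpNorm p ∞ (volume.restrict (halfBall d 1)) ≤ ENNReal.ofReal (b * K) := by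
    rw [eLpNorm_exponent_top]
    refine eLpNormEssSup_le_of_ae_bound ?_
    filter_upwards [hmem, hbound] with x hx hxb
    simpa [hq, Set.indicator_of_mem (hsub hx)] using hxb.2
  have t3 : holderSeminorm (1 / 2) (halfBall d 1) (fun x => (WithLp.toLp 2 fun k => V k x : TanGrad d))
      ≤ ENNReal.ofReal (d * d * K) := by
    refine (holderSeminorm_half_le hK0 fun k => hVh k).trans (ENNReal.ofReal_le_ofReal ?_)
    have : Fintype.card ({β : Fin d // β ≠ 0} × Fin d) ≤ d * d := by
      rw [Fintype.card_prod, Fintype.card_fin]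
      exact Nat.mul_le_mul_right _ ((Fintype.card_subtype_le _).trans (by simp))
    exact mul_le_mul_of_nonneg_right (by exact_mod_cast this) hK0
  have t4 : holderSeminorm (1 / 2) (halfBall d 1) (fun x => (WithLp.toLp 2 fun i => W i x : Vec d))
      ≤ ENNReal.ofReal (d * K) := by
    simpa using holderSeminorm_half_le hK0 fun k => hWh k
  have hfin : eLpNorm Du 2 (volume.restrict E) = ENNReal.ofReal e :=
    (ENNReal.ofReal_toReal hsol.isW12.memLp_grad.2.ne).symm
  calc _ ≤ ENNReal.ofReal (d * d * (a * K)) + ENNReal.ofReal (b * K) + ENNReal.ofReal (d * d * K)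
        + ENNReal.ofReal (d * K) := by gcongr
    _ = ENNReal.ofReal ((d * d * a + b + d * d + d) * K) := by
        rw [← ENNReal.ofReal_add (by positivity) (by positivity),
          ← ENNReal.ofReal_add (by positivity) (by positivity),
          ← ENNReal.ofReal_add (by positivity) (by positivity)]
        congr 1; ring
    _ ≤ ENNReal.ofReal ((d * d * a + b + d * d + d) * (C * d) * e) := by
        refine ENNReal.ofReal_le_ofReal ?_
        have h0 : 0 ≤ d * d * a + b + d * d + d := by positivity
        exact (mul_le_mul_of_nonneg_left hKe h0).trans (le_of_eq (by ring))
    _ = _ := by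
        rw [hfin, ENNReal.ofReal_mul (by positivity)]
        rfl
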